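/- **Setting.** Consider Bayesian persuasion with states of nature $\mathcal Y=\{0,1\}$, a finite non-empty strategy space $\mathcal S$ with $n=|\mathcal S|$, Receiver (Agent) utility $u(s,y)\in[0,1]$ and Sender (Principal) utility $v(s)\in[0,1]$. Assume that every strategy is strictly optimal for some belief: for every $s\in\mathcal S$ there is $\mu\in[0,1]$ with $u(s,\mu)>u(s',\mu)$ for all $s'\neq s$, where $u(s,\mu)=(1-\mu)u(s,0)+\mu u(s,1)$. A policy is a signaling scheme $p(\cdot\mid y)\in\Delta(\mathcal S)$, $y\in\{0,1\}$; an action of the Agent is a map $a:\mathcal S\to\mathcal S$ from signals to strategies; $U(a,p,y)=\mathbb E_{s\sim p(\cdot|y)}u(a(s),y)$, $V(a,p,y)=\mathbb E_{s\sim p(\cdot|y)}v(a(s))$, and $U(a,p,\pi)$, $V(a,p,\pi)$ are their expectations over $y\sim\pi\in\Delta(\mathcal Y)$. Let $a^*(p,\pi)$ be an action maximizing $U(\cdot,p,\pi)$ and, among the maximizers, $V(\cdot,p,\pi)$ (remaining ties are broken arbitrarily); let $a^*(p,\pi,\epsilon)$ maximize $V(\cdot,p,\pi)$ among the actions with $U(a,p,\pi)\ge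 U(a^*(p,\pi),p,\pi)-\epsilon$. Given a set $\mathcal P_0$ of benchmark policies, a *$(c,\epsilon,\beta,\gamma)$-optimal stable oracle* with output space $\mathcal P_{\mathcal O}$ is a map $O:\Delta(\mathcal Y)\to\mathcal P_{\mathcal O}$ such that for every $\pi$ the policy $p=O(\pi)$ satisfies: (i) for every $a\ne a^*(p,\pi)$, $U(a,p,\pi)\le U(a^*(p,\pi),p,\pi)-\beta$ or $V(a,p,\pi)\ge V(a^*(p,\pi),p,\pi)-\gamma$; (ii) $V(a^*(p,\pi),p,\pi)\ge V(a^*(p_0,\pi,\epsilon),p_0,\pi)-c$ for all $p_0\in\mathcal P_0$. **Part 1.** There are positive constants $C,c_1,c_2$ (depending only on the game) such that for every $\mathcal P_0$ and all $\beta\in[0,C/4)$, $\epsilon,x\in[0,1]$ and $0<\delta\le\beta^2/16$ there is a $$\Big(\tfrac{3\beta}{C}+c_2\sqrt\epsilon+2\sqrt\delta,\ \epsilon,\ \tfrac{x c_1\beta}{2},\ \max(x,\sqrt\delta)\Big)\text{-optimal stable oracle}$$ whose output space satisfies $|\mathcal P_{\mathcal O}|\le K_0\,n^2/\delta^2$,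 where $K_0$ is an absolute constant. **Repeated game.** In rounds $t=1,\dots,T$ a randomized forecasting algorithm $\mathcal F$ produces $\pi_t\in\Delta(\mathcal Y)$ from the past states and forecasts; the mechanism $\sigma^\dagger=(\mathcal F,O)$ offers $p_t=O(\pi_t)$ and recommends $r_t=a^*(p_t,\pi_t)$; the Agent draws $a_t$ from a distribution given by a learning algorithm $\mathcal L$ from the past states and actions and the policies and recommendations up to round $t$; then $y_t$ is revealed, where $y_{1:T}$ is an arbitrary sequence. The constant mechanism of $p_0\in\mathcal P_0$ offers $p_0$ and recommends $r_t^{p_0}=a^*(p_0,\pi_t)$ in all rounds, and $a^{p_0}_{1:T}$ are the actions that $\mathcal L$ then plays. The Principal's regret is $$\mathrm{PR}(\sigma^\dagger,\mathcal L,y_{1:T})=\mathbb E_{\pi_{1:T}}\max_{p_0\in\mathcal P_0}\mathbb E_{\mathcal L}\ \frac1T\sum_{t=1}^T\big(V(a_t^{p_0},p_0,y_t)-V(a_t,p_t,y_t)\big).$$ The Agent *obtains swap regret* $\epsilon_{\rm swap}$ if, under $\sigma^\dagger$ and under each constant mechanism, the expectation of $\max_h\frac1T\sum_t\big(U(h(p_t,r_t,a_t),p_t,y_t)-U(a_t,p_t,y_t)\big)$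 over actions and forecasts is at most $\epsilon_{\rm swap}$, the maximum being over maps $h$ from (policy, recommendation, action) to actions. The Agent has *no secret information* if, under $\sigma^\dagger$ and under each constant mechanism, along every forecast sequence of positive probability, for every $(p,r)$ with $I=\{t:(p_t,r_t)=(p,r)\}\neq\emptyset$ and $\hat\mu$ the empirical distribution of $(a_t)_{t\in I}$, $\frac1{|I|}\mathbb E\big|\sum_{t\in I}(U(a_t,p,y_t)-U(\hat\mu,p,y_t))\big|=O(|I|^{-1/2})$, and likewise for $V$. Let $(p^{\rm opt}(\pi),a^{\rm opt}(\pi))$ maximize $V(a,p_0,\pi)$ over $p_0\in\mathcal P_0$ and $\epsilon$-best responses $a$ to $(p_0,\pi)$, and let $\mathcal E$ consist of the events $\{O(\pi_t)=p,\ a^*(O(\pi_t),\pi_t)=r\}$ ($p\in\mathcal P_{\mathcal O}$), $\{p^{\rm opt}(\pi_t)=p,\ a^{\rm opt}(\pi_t)=a\}$ ($p\in\mathcal P_0$) and $\{a^*(p_0,\pi_t)=a\}$ ($p_0\in\mathcal P_0$), where $r,a$ range over all actions. Say that $\mathcal F$ has *low bias* conditional on $\mathcal E$ if for all $y_{1:T}$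 and $E\in\mathcal E$, with $\ell=\ln(|\mathcal Y||\mathcal E|T)$ and states written as one-hot vectors, $$\mathbb E\,\frac1T\Big\|\sum_{t}\mathbf 1_E(\pi_t)(\pi_t-y_t)\Big\|_1\le O\Big(\mathbb E\Big[\frac{|\mathcal Y|\,\ell+|\mathcal Y|\sqrt{\ell\,|\{t:\mathbf 1_E(\pi_t)=1\}|}}{T}\Big]\Big).$$ **Part 2.** Let $\mathcal P_0$ be finite and non-empty, and put $\epsilon=T^{-1/5}$, $x=\beta=\sqrt\epsilon$, $\delta=\beta^2/16$, with $T\ge2$ so large that $\beta<C/4$. For every oracle $O$ as in Part 1 with these parameters, a forecasting algorithm with low bias conditional on $\mathcal E$ exists (with an absolute constant in the bound), and for each such algorithm $\mathcal F$, every $y_{1:T}$ and every Agent with no secret information who obtains swap regret $\epsilon_{\rm swap}=O(\sqrt{|\mathcal P_{\mathcal O}|/T})$, $$\mathrm{PR}(\sigma^\dagger,\mathcal L,y_{1:T})=\tilde O\big(T^{-1/10}\big),$$ i.e. it is at most $K\,T^{-1/10}(\ln T)^k$, where $k$ depends only on the game and $\mathcal P_0$, and $K$ only on these and on the constants in the bounds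 on bias, swap regret and secret information. -/

import Mathlib

/-! # Repeated Principal-Agent games without a common prior, and binary-state Bayesian persuasion

Rounds are numbered `0, …, T - 1`. Distributions over a finite type are points of the standard
simplex. `A` is the set of actions, `P` the set of policies, `Y` the set of states of nature. -/

noncomputable section

/-! ## The stage game -/

/-- The utility functions `U(a,p,y)` of the Agent and `V(a,p,y)` of the Principal. -/
structure StageGame (A P Y : Type*) where
  agentUtil : A → P → Y → ℝ
  principalUtil : A → P → Y → ℝ

namespace StageGame

variable {A P Y : Type*} [Fintype Y]

/-- `U(a,p,π) = 𝔼_{y ∼ π} U(a,p,y)`. -/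
def U (G : StageGame A P Y) (a : A) (p : P) (π : stdSimplex ℝ Y) : ℝ :=
  ∑ y, π y * G.agentUtil a p y

/-- `V(a,p,π) = 𝔼_{y ∼ π} V(a,p,y)`. -/
def V (G : StageGame A P Y) (a : A) (p : P) (π : stdSimplex ℝ Y) : ℝ :=
  ∑ y, π y * G.principalUtil a p y

/-- `a` is a best response `a^*(p,π)`: it maximizes the Agent's expected utility and, among the
maximizers, the Principal's expected utility. -/
def IsBestResponse (G : StageGame A P Y) (p : P) (π : stdSimplex ℝ Y) (a : A) : Prop :=
  (∀ b, G.U b p π ≤ G.U a p π) ∧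
    ∀ b, (∀ b', G.U b' p π ≤ G.U b p π) → G.V b p π ≤ G.V a p π

/-- `aStar` selects a best response `a^*(p,π)` for all `p` and `π` (remaining ties are broken
arbitrarily). -/
def IsBestResponseRule (G : StageGame A P Y) (aStar : P → stdSimplex ℝ Y → A) : Prop :=
  ∀ p π, G.IsBestResponse p π (aStar p π)

/-- The set `𝓑(p,π,ε)` of `ε`-best responses of the Agent. -/
def epsBestResponses (G : StageGame A P Y) (aStar : P → stdSimplex ℝ Y → A)
    (p : P) (π : stdSimplex ℝ Y) (ε : ℝ) : Set A :=
  {a | G.U (aStar p π) p π - ε ≤ G.U a p π}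

/-- `p` is `(β,γ)`-stable under `π`. -/
def IsStable (G : StageGame A P Y) (aStar : P → stdSimplex ℝ Y → A)
    (β γ : ℝ) (π : stdSimplex ℝ Y) (p : P) : Prop :=
  ∀ a, a ≠ aStar p π →
    G.U a p π ≤ G.U (aStar p π) p π - β ∨ G.V (aStar p π) p π - γ ≤ G.V a p π

/-- `p` is a `(c,ε,β,γ)`-optimal stable policy under `π`, for the benchmark set `P₀`. The value
`V(a^*(p₀,π,ε),p₀,π)` is the maximum of `V(a,p₀,π)` over the `ε`-best responses `a`. -/
def IsOptimalStable (G : StageGame A P Y) (aStar : P → stdSimplex ℝ Y → A) (P₀ : Set P)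
    (c ε β γ : ℝ) (π : stdSimplex ℝ Y) (p : P) : Prop :=
  G.IsStable aStar β γ π p ∧
    ∀ p₀ ∈ P₀, ∀ a ∈ G.epsBestResponses aStar p₀ π ε,
      G.V a p₀ π - c ≤ G.V (aStar p π) p π

/-- `O` is a `(c,ε,β,γ)`-optimal stable policy oracle with output space `PO`. -/
def IsOptimalStableOracle (G : StageGame A P Y) (aStar : P → stdSimplex ℝ Y → A) (P₀ : Set P)
    (c ε β γ : ℝ) (PO : Finset P) (O : stdSimplex ℝ Y → P) : Prop :=
  ∀ π, O π ∈ PO ∧ G.IsOptimalStable aStar P₀ c ε β γ π (O π)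

/-- `pOpt π` and `aOpt π` are the optimistic policy `argmax_{p₀ ∈ P₀} V(a^*(p₀,π,ε),p₀,π)` and the
optimistic action `a^*(pOpt π,π,ε)` (ties are broken arbitrarily). -/
def IsOptimisticRule (G : StageGame A P Y) (aStar : P → stdSimplex ℝ Y → A) (P₀ : Set P)
    (ε : ℝ) (pOpt : stdSimplex ℝ Y → P) (aOpt : stdSimplex ℝ Y → A) : Prop :=
  ∀ π, pOpt π ∈ P₀ ∧ aOpt π ∈ G.epsBestResponses aStar (pOpt π) π ε ∧
    ∀ p₀ ∈ P₀, ∀ a ∈ G.epsBestResponses aStar p₀ π ε, G.V a p₀ π ≤ G.V (aOpt π) (pOpt π) π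

end StageGame

/-! ## Learning algorithms and the laws they generate -/

/-- Expectation of `f` under a discrete probability distribution. -/
def expect {X : Type*} (μ : PMF X) (f : X → ℝ) : ℝ := ∑' x, (μ x).toReal * f x

/-- A randomized forecasting algorithm: in round `t` it maps the past states and the past forecasts
to a distribution of the forecast of round `t`. It does not see the Agent's actions. -/
abbrev Forecaster (Y : Type*) [Fintype Y] :=
  (t : ℕ) → (Fin t → Y) → (Fin t → stdSimplex ℝ Y) → PMF (stdSimplex ℝ Y)

/-- The law of the forecasts of the first `T` rounds when the states of nature are `y`. -/
def forecastLaw {Y : Type*} [Fintype Y] (F : Forecaster Y) (y : ℕ → Y) :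
    (T : ℕ) → PMF (Fin T → stdSimplex ℝ Y)
  | 0 => PMF.pure Fin.elim0
  | T + 1 => (forecastLaw F y T).bind fun π =>
      (F T (fun i => y i) π).map (Fin.snoc (α := fun _ => stdSimplex ℝ Y) π)

/-- A learning algorithm of the Agent: in round `t` it maps the past states, the past actions, and
the recommendations and policies up to and including round `t` to a distribution over actions. -/
abbrev Learner (A P Y : Type*) :=
  (t : ℕ) → (Fin t → Y) → (Fin t → A) → (Fin (t + 1) → A) → (Fin (t + 1) → P) → PMF A

/-- The law of the Agent's actions in the first `T` rounds, when the states of nature are `y`, the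
recommendations are `r` and the policies are `p`. -/
def actionLaw {A P Y : Type*} (L : Learner A P Y) (y : ℕ → Y) :
    (T : ℕ) → (Fin T → A) → (Fin T → P) → PMF (Fin T → A)
  | 0, _, _ => PMF.pure Fin.elim0
  | T + 1, r, p =>
      (actionLaw L y T (fun i => r i.castSucc) (fun i => p i.castSucc)).bind fun a =>
        (L T (fun i => y i) a r p).map (Fin.snoc (α := fun _ => A) a)

namespace StageGame

variable {A P Y : Type*}

/-! ## Behavioral assumptions -/

/-- The Agent's contextual swap regret `SwapReg(y_{1:T},p_{1:T},r_{1:T})`. -/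
def swapReg (G : StageGame A P Y) (L : Learner A P Y) (y : ℕ → Y) (T : ℕ)
    (r : Fin T → A) (p : Fin T → P) : ℝ :=
  expect (actionLaw L y T r p) fun a =>
    ⨆ h : P → A → A → A, (1 / (T : ℝ)) *
      ∑ t : Fin T, (G.agentUtil (h (p t) (r t) (a t)) (p t) (y t) - G.agentUtil (a t) (p t) (y t))

open Classical in
/-- The rounds `t` with `(p_t,r_t) = (p',r')`. -/
def roundsWith {T : ℕ} (r : Fin T → A) (p : Fin T → P) (r' : A) (p' : P) : Finset (Fin T) :=
  Finset.univ.filter fun t => p t = p' ∧ r t = r'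

open Classical in
/-- The empirical distribution of the actions `a` over the rounds in `I`. -/
def empirical {T : ℕ} (I : Finset (Fin T)) (a : Fin T → A) (b : A) : ℝ :=
  ((I.filter fun t => a t = b).card : ℝ) / (I.card : ℝ)

/-- No secret information along given policies and recommendations: for all `(p',r')`, with `I` the
set of rounds in which `(p_t,r_t) = (p',r')` and `n` its cardinality,
`(1/n) 𝔼|∑_{t ∈ I} (U(a_t,p',y_t) - U(μ̂,p',y_t))| ≤ K/√n`, where `μ̂` is the empirical distribution
of the actions on `I`, and likewise for `V`. (Both sides are multiplied by `n`.) -/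
def NoSecretInfo [Fintype A] (G : StageGame A P Y) (L : Learner A P Y) (y : ℕ → Y) (T : ℕ)
    (r : Fin T → A) (p : Fin T → P) (K : ℝ) : Prop :=
  ∀ (p' : P) (r' : A),
    let I := roundsWith r p r' p'
    expect (actionLaw L y T r p) (fun a => |∑ t ∈ I, (G.agentUtil (a t) p' (y t) -
        ∑ b, empirical I a b * G.agentUtil b p' (y t))|) ≤ K * √(I.card : ℝ) ∧
    expect (actionLaw L y T r p) (fun a => |∑ t ∈ I, (G.principalUtil (a t) p' (y t) -
        ∑ b, empirical I a b * G.principalUtil b p' (y t))|) ≤ K * √(I.card : ℝ)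

variable [Fintype Y]

/-- The recommendations `a^*(p_t,π_t)`. -/
def recommend (aStar : P → stdSimplex ℝ Y → A) {T : ℕ} (p : Fin T → P)
    (π : Fin T → stdSimplex ℝ Y) : Fin T → A :=
  fun t => aStar (p t) (π t)

/-- No contextual swap regret. The forecasts are produced by `F`; under the deployed mechanism,
which offers `p_t = O(π_t)`, and under each constant mechanism offering `p₀ ∈ P₀`, the swap regret
of the Agent, averaged over the forecasts, is at most `εswap`. (This is implied by the same bound
for each realized sequence of forecasts.) -/
def NoSwapRegret (G : StageGame A P Y) (aStar : P → stdSimplex ℝ Y → A) (P₀ : Finset P)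
    (O : stdSimplex ℝ Y → P) (F : Forecaster Y) (L : Learner A P Y) (y : ℕ → Y) (T : ℕ)
    (εswap : ℝ) : Prop :=
  expect (forecastLaw F y T) (fun π =>
      G.swapReg L y T (recommend aStar (fun t => O (π t)) π) (fun t => O (π t))) ≤ εswap ∧
  ∀ p₀ ∈ P₀, expect (forecastLaw F y T) (fun π =>
      G.swapReg L y T (recommend aStar (fun _ => p₀) π) (fun _ => p₀)) ≤ εswap

/-- No secret information, with constant `K`, for the deployed mechanism and for the constant
mechanisms, along each sequence of forecasts that `F` produces with positive probability. -/
def NoSecretInformation [Fintype A] (G : StageGame A P Y) (aStar : P → stdSimplex ℝ Y → A)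
    (P₀ : Finset P) (O : stdSimplex ℝ Y → P) (F : Forecaster Y) (L : Learner A P Y) (y : ℕ → Y)
    (T : ℕ) (K : ℝ) : Prop :=
  ∀ π ∈ (forecastLaw F y T).support,
    G.NoSecretInfo L y T (recommend aStar (fun t => O (π t)) π) (fun t => O (π t)) K ∧
    ∀ p₀ ∈ P₀, G.NoSecretInfo L y T (recommend aStar (fun _ => p₀) π) (fun _ => p₀) K

/-! ## The Principal's regret -/

/-- Expected average utility of the Principal when she offers the policies `p`, recommends
`a^*(p_t,π_t)`, and the Agent runs `L`. -/
def avgPrincipalUtil (G : StageGame A P Y) (aStar : P → stdSimplex ℝ Y → A) (L : Learner A P Y)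
    (y : ℕ → Y) (T : ℕ) (π : Fin T → stdSimplex ℝ Y) (p : Fin T → P) : ℝ :=
  expect (actionLaw L y T (recommend aStar p π) p) fun a =>
    (1 / (T : ℝ)) * ∑ t : Fin T, G.principalUtil (a t) (p t) (y t)

/-- The Principal's policy regret `PR(O,π_{1:T},L,y_{1:T})` against the benchmark set `P₀`. -/
def policyRegret (G : StageGame A P Y) (aStar : P → stdSimplex ℝ Y → A) (P₀ : Finset P)
    (hP₀ : P₀.Nonempty) (O : stdSimplex ℝ Y → P) (L : Learner A P Y) (y : ℕ → Y) (T : ℕ)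
    (π : Fin T → stdSimplex ℝ Y) : ℝ :=
  P₀.sup' hP₀ fun p₀ =>
    G.avgPrincipalUtil aStar L y T π (fun _ => p₀) -
      G.avgPrincipalUtil aStar L y T π (fun t => O (π t))

/-- The Principal's regret `PR(σ†,L,y_{1:T})` of the mechanism `σ† = (F,O)`: the expectation of the
policy regret over the forecasts generated by `F`. -/
def principalRegret (G : StageGame A P Y) (aStar : P → stdSimplex ℝ Y → A) (P₀ : Finset P)
    (hP₀ : P₀.Nonempty) (O : stdSimplex ℝ Y → P) (F : Forecaster Y) (L : Learner A P Y)
    (y : ℕ → Y) (T : ℕ) : ℝ :=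
  expect (forecastLaw F y T) fun π => G.policyRegret aStar P₀ hP₀ O L y T π

/-! ## Forecasts that are unbiased conditional on events -/

/-- The events `(p_t,r_t) = (p,r)` for `p ∈ PO`, the events `(p_t^{opt},a_t^{opt}) = (p,a)` for
`p ∈ P₀`, and the events `a^*(p₀,π_t) = a` for `p₀ ∈ P₀`, as sets of forecasts. -/
def events (aStar : P → stdSimplex ℝ Y → A) (P₀ PO : Finset P)
    (O : stdSimplex ℝ Y → P) (pOpt : stdSimplex ℝ Y → P) (aOpt : stdSimplex ℝ Y → A) :
    ((PO × A) ⊕ (P₀ × A)) ⊕ (P₀ × A) → Set (stdSimplex ℝ Y)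
  | .inl (.inl (p, r)) => {π | O π = p ∧ aStar (O π) π = r}
  | .inl (.inr (p, a)) => {π | pOpt π = p ∧ aOpt π = a}
  | .inr (p₀, a) => {π | aStar p₀ π = a}

end StageGame

open Classical in
/-- Over `T` rounds and for every sequence of states, the forecasts of `F` have expected bias
`𝔼 (1/T) ‖∑_t E(π_t)(π_t - y_t)‖₁` conditional on each event `E` of the family `𝓔` at most
`K (|Y| ln(|Y||𝓔|T)/T + |Y| √(ln(|Y||𝓔|T) |{t : E(π_t) = 1}|)/T)` in expectation. -/
def HasLowBias {Y ι : Type*} [Fintype Y] [Fintype ι] (F : Forecaster Y)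
    (𝓔 : ι → Set (stdSimplex ℝ Y)) (T : ℕ) (K : ℝ) : Prop :=
  ∀ (y : ℕ → Y) (i : ι),
    let ℓ : ℝ := Real.log ((Fintype.card Y : ℝ) * (Fintype.card ι : ℝ) * (T : ℝ))
    expect (forecastLaw F y T) (fun π => (1 / (T : ℝ)) * ∑ z : Y,
        |∑ t : Fin T, if π t ∈ 𝓔 i then π t z - (if y t = z then 1 else 0) else 0|) ≤
      expect (forecastLaw F y T) (fun π => K * ((Fintype.card Y : ℝ) * ℓ / T +
        (Fintype.card Y : ℝ) *
          √(ℓ * ((Finset.univ.filter fun t : Fin T => π t ∈ 𝓔 i).card : ℝ)) / T))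

/-! ## Binary-state Bayesian persuasion -/

/-- Signaling schemes with signal space `S`: a distribution over signals for each state. -/
abbrev SignalScheme (S : Type*) [Fintype S] := Fin 2 → stdSimplex ℝ S

/-- Bayesian persuasion with states `{0,1}`, finite strategy space `S`, Receiver's utility `u(s,y)`
and Sender's utility `v(s)`: the Principal's policies are signaling schemes, the Agent's actions are
maps from signals to strategies. -/
def persuasionGame {S : Type*} [Fintype S] (u : S → Fin 2 → ℝ) (v : S → ℝ) :
    StageGame (S → S) (SignalScheme S) (Fin 2) where
  agentUtil a p y := ∑ s, p y s * u (a s) y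
  principalUtil a p y := ∑ s, p y s * v (a s)

/-- Every strategy is the strict optimum of the Receiver for some prior `Ber(μ)`. -/
def EveryStrategyStrictlyOptimal {S : Type*} (u : S → Fin 2 → ℝ) : Prop :=
  ∀ s, ∃ μ ∈ Set.Icc (0 : ℝ) 1, ∀ s', s' ≠ s →
    (1 - μ) * u s' 0 + μ * u s' 1 < (1 - μ) * u s 0 + μ * u s 1

end

/-! ## Expectations of bounded functions -/

section Expect

variable {X : Type*}

/-! The regret bound reduces to inequalities that hold under each single forecast. Within one
context (policy, recommendation), an Agent without secret information earns about what his empirical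
mixture of actions would earn. Since the forecasts are unbiased on that context, realized states may
be replaced by forecasts. Hence an inequality "payoff minus target is at most `D` plus `k` times the
Agent's loss", valid under every forecast, passes to realized play (`sum_payoff_sub_target_le`,
`expect_payoff_le`), and the total loss is at most `T` times the swap regret. With the target
`V(a*(p_t,π_t),p_t,π_t)`, stability gives such an inequality for `-V` under the mechanism (`k =
1/β`, `D = γ`), and optimality gives one for `V` under each benchmark (`k = 1/ε`, `D = c`). Chaining
the two through the common target yields `principalRegret_le`.

Forecasts of low bias come from an exponential potential with one term for each event, sign and
learning rate. Its growth in a round is at most `g(q)(q₁ - y)`, and randomizing between two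
neighbouring grid forecasts at a sign change of `g` makes this nearly zero whatever the state
(`exists_calibrating_mixture`).

For the oracle, an `ε`-best response is turned into a direct scheme whose obedience gaps sum to at
most `ε` (`exists_direct_scheme`). Trimming each signal and revealing the state on the removed mass
makes every recommendation strictly obedient at cost `O(β + ε)` (`exists_obedient_of_gap_le`). Two
signals suffice by Carathéodory (`exists_pair_combination`), and rounding to a grid spoils obedience
only for a rare signal (`exists_robust_gridScheme`). The oracle picks the best stable grid scheme.

With `τ = T^(-1/10)`, the oracle has `O(τ⁻⁴)` policies, so the learning errors are `τ³` up to
logarithms. Multiplied by `1/β` and `1/ε`, both of order `τ⁻²`, they give `τ`, which is also the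
order of `c` and `γ`. -/

theorem PMF.summable_toReal_mul (μ : PMF X) {f : X → ℝ} {M : ℝ} (hf : ∀ x, |f x| ≤ M) :
    Summable fun x => (μ x).toReal * f x := by
  have h : Summable fun x => (μ x).toReal * M :=
    (ENNReal.summable_toReal μ.tsum_coe_ne_top).mul_right M
  refine Summable.of_norm_bounded h fun x => ?_
  rw [norm_mul, Real.norm_eq_abs, Real.norm_eq_abs, abs_of_nonneg ENNReal.toReal_nonneg]
  exact mul_le_mul_of_nonneg_left (hf x) ENNReal.toReal_nonneg

theorem expect_const (μ : PMF X) (c : ℝ) : expect μ (fun _ => c) = c := by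
  unfold expect
  rw [tsum_mul_right, ← ENNReal.tsum_toReal_eq fun x => μ.apply_ne_top x, μ.tsum_coe]
  simp

theorem expect_mono_on_support (μ : PMF X) {f g : X → ℝ} (hf : ∃ M, ∀ x, |f x| ≤ M)
    (hg : ∃ M, ∀ x, |g x| ≤ M) (h : ∀ x ∈ μ.support, f x ≤ g x) : expect μ f ≤ expect μ g := by
  obtain ⟨M, hM⟩ := hf
  obtain ⟨N, hN⟩ := hg
  refine (μ.summable_toReal_mul hM).tsum_le_tsum (fun x => ?_) (μ.summable_toReal_mul hN)
  by_cases hx : μ x = 0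
  · simp [hx]
  · exact mul_le_mul_of_nonneg_left (h x ((μ.mem_support_iff x).2 hx)) ENNReal.toReal_nonneg

theorem expect_add (μ : PMF X) {f g : X → ℝ} (hf : ∃ M, ∀ x, |f x| ≤ M)
    (hg : ∃ M, ∀ x, |g x| ≤ M) : expect μ (fun x => f x + g x) = expect μ f + expect μ g := by
  obtain ⟨M, hM⟩ := hf
  obtain ⟨N, hN⟩ := hg
  simp only [expect, mul_add]
  exact (μ.summable_toReal_mul hM).tsum_add (μ.summable_toReal_mul hN)

theorem expect_const_mul (μ : PMF X) (c : ℝ) (f : X → ℝ) :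
    expect μ (fun x => c * f x) = c * expect μ f := by
  simp only [expect, ← tsum_mul_left]
  exact tsum_congr fun x => by ring

theorem bounded_add {f g : X → ℝ} (hf : ∃ M, ∀ x, |f x| ≤ M) (hg : ∃ M, ∀ x, |g x| ≤ M) :
    ∃ M, ∀ x, |f x + g x| ≤ M := by
  obtain ⟨M, hM⟩ := hf
  obtain ⟨N, hN⟩ := hg
  exact ⟨M + N, fun x => (abs_add_le _ _).trans (add_le_add (hM x) (hN x))⟩

theorem bounded_const_mul (c : ℝ) {f : X → ℝ} (hf : ∃ M, ∀ x, |f x| ≤ M) :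
    ∃ M, ∀ x, |c * f x| ≤ M := by
  obtain ⟨M, hM⟩ := hf
  exact ⟨|c| * M, fun x => by
    rw [abs_mul]; exact mul_le_mul_of_nonneg_left (hM x) (abs_nonneg c)⟩

theorem bounded_const (c : ℝ) : ∃ M, ∀ _ : X, |c| ≤ M := ⟨|c|, fun _ => le_rfl⟩

theorem bounded_sum {ι : Type*} (s : Finset ι) {f : ι → X → ℝ}
    (hf : ∀ i ∈ s, ∃ M, ∀ x, |f i x| ≤ M) : ∃ M, ∀ x, |∑ i ∈ s, f i x| ≤ M := by
  classical
  induction s using Finset.induction_on with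
  | empty => exact ⟨0, by simp⟩
  | insert i s hi ih =>
    simp only [Finset.sum_insert hi]
    exact bounded_add (hf i (by simp)) (ih fun j hj => hf j (by simp [hj]))

theorem expect_sum (μ : PMF X) {ι : Type*} (s : Finset ι) {f : ι → X → ℝ}
    (hf : ∀ i ∈ s, ∃ M, ∀ x, |f i x| ≤ M) :
    expect μ (fun x => ∑ i ∈ s, f i x) = ∑ i ∈ s, expect μ (f i) := by
  classical
  induction s using Finset.induction_on with
  | empty => simpa using expect_const μ 0
  | insert i s hi ih =>
    simp only [Finset.sum_insert hi]
    rw [expect_add μ (hf i (by simp)) (bounded_sum s fun j hj => hf j (by simp [hj])),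
      ih fun j hj => hf j (by simp [hj])]

theorem expect_mem_Icc (μ : PMF X) {f : X → ℝ} {a b : ℝ} (h : ∀ x, f x ∈ Set.Icc a b) :
    expect μ f ∈ Set.Icc a b := by
  have hf : ∃ M, ∀ x, |f x| ≤ M := ⟨max |a| |b|, fun x => abs_le_max_abs_abs (h x).1 (h x).2⟩
  constructor
  · rw [← expect_const μ a]
    exact expect_mono_on_support μ (bounded_const a) hf fun x _ => (h x).1
  · rw [← expect_const μ b]
    exact expect_mono_on_support μ hf (bounded_const b) fun x _ => (h x).2

theorem bounded_of_finite [Finite X] (f : X → ℝ) : ∃ M, ∀ x, |f x| ≤ M := by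
  obtain ⟨M, hM⟩ := (Set.finite_range fun x => |f x|).bddAbove
  exact ⟨M, fun x => hM ⟨x, rfl⟩⟩

end Expect

/-! ## Unbiased forecasts on a set of rounds -/

section Rounds

variable {τ A Y : Type*} [Fintype Y]

open Classical in
-- The error is linear in `f`, with the coordinates of the bias as coefficients, so this is duality
-- between the `ℓ¹` and `ℓ∞` norms.
theorem abs_sum_forecast_sub_le (I : Finset τ) (π : τ → stdSimplex ℝ Y) (y : τ → Y) {f : Y → ℝ}
    (hf : ∀ z, |f z| ≤ 1) :
    |∑ t ∈ I, (∑ z, π t z * f z - f (y t))| ≤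
      ∑ z, |∑ t ∈ I, (π t z - if y t = z then 1 else 0)| := by
  have h : ∑ t ∈ I, (∑ z, π t z * f z - f (y t)) =
      ∑ z, f z * ∑ t ∈ I, (π t z - if y t = z then 1 else 0) := by
    simp only [Finset.mul_sum]
    rw [Finset.sum_comm]
    refine Finset.sum_congr rfl fun t _ => ?_
    simp only [mul_sub, Finset.sum_sub_distrib]
    congr 1
    · exact Finset.sum_congr rfl fun z _ => mul_comm _ _
    · simp
  rw [h]
  refine (Finset.abs_sum_le_sum_abs _ _).trans (Finset.sum_le_sum fun z _ => ?_)
  rw [abs_mul]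
  exact mul_le_of_le_one_left (abs_nonneg _) (hf z)

theorem abs_sum_weights_mul_le [Fintype A] {m : A → ℝ} (hm : ∀ b, 0 ≤ m b) (hm1 : ∑ b, m b = 1)
    {g : A → ℝ} (hg : ∀ b, |g b| ≤ 1) : |∑ b, m b * g b| ≤ 1 := by
  rw [← hm1]
  refine (Finset.abs_sum_le_sum_abs _ _).trans (Finset.sum_le_sum fun b _ => ?_)
  rw [abs_mul, abs_of_nonneg (hm b)]
  exact mul_le_of_le_one_right (hm b) (hg b)

open Classical in
/-- If a payoff `g` exceeds a target `W` by at most `D` plus `k` times the Agent's loss, in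
expectation under each forecast, then the same holds for realized states and actions, up to the
bias of the forecasts and the correlation of actions and states. -/
theorem sum_payoff_sub_target_le [Fintype A] (I : Finset τ) (π : τ → stdSimplex ℝ Y) (y : τ → Y)
    (a : τ → A) (r : A) {u g : A → Y → ℝ} (hu : ∀ b z, |u b z| ≤ 1) (hg : ∀ b z, |g b z| ≤ 1)
    {m : A → ℝ} (hm : ∀ b, 0 ≤ m b) (hm1 : ∑ b, m b = 1) {W : τ → ℝ} {D k : ℝ} (hk : 0 ≤ k)
    (h : ∀ t ∈ I, ∀ b, ∑ z, π t z * g b z - W t ≤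
      D + k * (∑ z, π t z * u r z - ∑ z, π t z * u b z)) :
    ∑ t ∈ I, (g (a t) (y t) - W t) ≤ D * (I.card : ℝ) +
      k * (∑ t ∈ I, (u r (y t) - u (a t) (y t)) +
        |∑ t ∈ I, (u (a t) (y t) - ∑ b, m b * u b (y t))| +
        2 * ∑ z, |∑ t ∈ I, (π t z - if y t = z then 1 else 0)|) +
      |∑ t ∈ I, (g (a t) (y t) - ∑ b, m b * g b (y t))| +
      ∑ z, |∑ t ∈ I, (π t z - if y t = z then 1 else 0)| := by
  have swap : ∀ (w : A → Y → ℝ) t, ∑ z, π t z * ∑ b, m b * w b z =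
      ∑ b, m b * ∑ z, π t z * w b z := by
    intro w t
    simp only [Finset.mul_sum]
    rw [Finset.sum_comm]
    exact Finset.sum_congr rfl fun b _ => Finset.sum_congr rfl fun z _ => by ring
  -- The weights `m` do not depend on the round, so the hypothesis for single actions averages to
  -- one for the mixture.
  have avg : ∀ t ∈ I, ∑ z, π t z * (∑ b, m b * g b z) - W t ≤
      D + k * (∑ z, π t z * u r z - ∑ z, π t z * ∑ b, m b * u b z) := by
    intro t ht
    rw [swap, swap]
    have := Finset.sum_le_sum fun b (_ : b ∈ Finset.univ) =>
      mul_le_mul_of_nonneg_left (h t ht b) (hm b)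
    have e1 : ∑ b, m b * (∑ z, π t z * g b z - W t) = ∑ b, m b * ∑ z, π t z * g b z - W t := by
      simp only [mul_sub, Finset.sum_sub_distrib, ← Finset.sum_mul, hm1, one_mul]
    have e2 : ∑ b, m b * (D + k * (∑ z, π t z * u r z - ∑ z, π t z * u b z)) =
        D + k * (∑ z, π t z * u r z - ∑ b, m b * ∑ z, π t z * u b z) := by
      have : ∀ b, m b * (D + k * (∑ z, π t z * u r z - ∑ z, π t z * u b z)) =
          m b * (D + k * ∑ z, π t z * u r z) - k * (m b * ∑ z, π t z * u b z) := fun b => by ring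
      simp only [this, Finset.sum_sub_distrib, ← Finset.sum_mul, ← Finset.mul_sum, hm1]
      ring
    rwa [e1, e2] at this
  have tot := Finset.sum_le_sum avg
  -- Forecasts are exchanged for states three times: in `u` for the mixture and for `r`, which
  -- explains the factor 2 in front of the bias, and in `g` for the mixture.
  have bu := abs_le.1 (abs_sum_forecast_sub_le I π y fun z =>
    abs_sum_weights_mul_le hm hm1 fun b => hu b z)
  have bg := abs_le.1 (abs_sum_forecast_sub_le I π y fun z =>
    abs_sum_weights_mul_le hm hm1 fun b => hg b z)
  have br := abs_le.1 (abs_sum_forecast_sub_le I π y (hu r))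
  have su := neg_abs_le (∑ t ∈ I, (u (a t) (y t) - ∑ b, m b * u b (y t)))
  have su' := le_abs_self (∑ t ∈ I, (u (a t) (y t) - ∑ b, m b * u b (y t)))
  have sg := le_abs_self (∑ t ∈ I, (g (a t) (y t) - ∑ b, m b * g b (y t)))
  generalize ∑ z, |∑ t ∈ I, (π t z - if y t = z then 1 else 0)| = B at *
  generalize |∑ t ∈ I, (u (a t) (y t) - ∑ b, m b * u b (y t))| = SU at *
  generalize |∑ t ∈ I, (g (a t) (y t) - ∑ b, m b * g b (y t))| = SG at *
  simp only [Finset.sum_sub_distrib, Finset.sum_add_distrib, ← Finset.mul_sum, Finset.sum_const,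
    nsmul_eq_mul] at *
  have key : k * (∑ t ∈ I, ∑ z, π t z * u r z - ∑ t ∈ I, ∑ z, π t z * ∑ b, m b * u b z) ≤
      k * (∑ t ∈ I, u r (y t) - ∑ t ∈ I, u (a t) (y t) + SU + 2 * B) :=
    mul_le_mul_of_nonneg_left (by linarith) hk
  linarith

theorem empirical_nonneg {A : Type*} {T : ℕ} (I : Finset (Fin T)) (a : Fin T → A) (b : A) :
    0 ≤ StageGame.empirical I a b := by
  unfold StageGame.empirical; positivity

theorem sum_empirical {A : Type*} [Fintype A] {T : ℕ} {I : Finset (Fin T)} (hI : I.Nonempty)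
    (a : Fin T → A) : ∑ b, StageGame.empirical I a b = 1 := by
  classical
  unfold StageGame.empirical
  rw [← Finset.sum_div, div_eq_one_iff_eq (by exact_mod_cast hI.card_pos.ne')]
  norm_cast
  rw [Finset.card_eq_sum_card_fiberwise (f := a) (t := Finset.univ) (by simp)]

end Rounds

theorem sum_sqrt_le_sqrt {ι : Type*} (s : Finset ι) {f : ι → ℝ} (hf : ∀ i ∈ s, 0 ≤ f i) :
    ∑ i ∈ s, √(f i) ≤ √((s.card : ℝ) * ∑ i ∈ s, f i) := by
  refine Real.le_sqrt_of_sq_le ((sq_sum_le_card_mul_sum_sq).trans_eq ?_)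
  rw [Finset.sum_congr rfl fun i hi => Real.sq_sqrt (hf i hi)]

/-! ### Payoffs of a learning Agent, summed over contexts. -/

namespace StageGame

theorem agent_regret_bounded {A P Y : Type*} (G : StageGame A P Y)
    (hU : ∀ a p y, G.agentUtil a p y ∈ Set.Icc (0 : ℝ) 1)
    (y : ℕ → Y) (T : ℕ) (r : Fin T → A) (p : Fin T → P) (a : Fin T → A) (h : P → A → A → A) :
    (1 / (T : ℝ)) * ∑ t : Fin T,
      (G.agentUtil (h (p t) (r t) (a t)) (p t) (y t) - G.agentUtil (a t) (p t) (y t)) ≤ 1 := by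
  have : ∑ t : Fin T, (G.agentUtil (h (p t) (r t) (a t)) (p t) (y t) -
      G.agentUtil (a t) (p t) (y t)) ≤ ∑ _ : Fin T, 1 := Finset.sum_le_sum fun t _ => by
    have h1 := (hU (h (p t) (r t) (a t)) (p t) (y t)).2
    have h2 := (hU (a t) (p t) (y t)).1
    linarith
  rcases Nat.eq_zero_or_pos T with rfl | hT
  · simp
  · rw [one_div, inv_mul_le_iff₀ (by positivity)]
    simpa using this

theorem swapReg_mem_Icc {A P Y : Type*} (G : StageGame A P Y)
    (hU : ∀ a p y, G.agentUtil a p y ∈ Set.Icc (0 : ℝ) 1)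
    (L : Learner A P Y) (y : ℕ → Y) (T : ℕ) (r : Fin T → A) (p : Fin T → P) :
    G.swapReg L y T r p ∈ Set.Icc (0 : ℝ) 1 := by
  refine expect_mem_Icc _ fun a => ⟨?_, ?_⟩
  -- Keeping the action that was played is one of the competing maps, so the supremum is
  -- nonnegative.
  · refine le_ciSup_of_le ⟨1, ?_⟩ (fun _ _ b => b) (by simp)
    rintro _ ⟨h, rfl⟩
    exact G.agent_regret_bounded hU y T r p a h
  · have : Nonempty (P → A → A → A) := ⟨fun _ _ b => b⟩
    exact ciSup_le fun h => G.agent_regret_bounded hU y T r p a h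

/-- Following the recommendations improves the Agent's utility by at most the swap regret. -/
theorem expect_obedience_gain_le {A P Y : Type*} [Fintype A] (G : StageGame A P Y)
    (hU : ∀ a p y, G.agentUtil a p y ∈ Set.Icc (0 : ℝ) 1)
    (L : Learner A P Y) (y : ℕ → Y) {T : ℕ} (hT : 0 < T) (r : Fin T → A) (p : Fin T → P) :
    expect (actionLaw L y T r p) (fun a => ∑ t : Fin T,
      (G.agentUtil (r t) (p t) (y t) - G.agentUtil (a t) (p t) (y t))) ≤
      T * G.swapReg L y T r p := by
  have hT' : (0 : ℝ) < T := by exact_mod_cast hT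
  rw [swapReg, ← expect_const_mul]
  refine expect_mono_on_support _ (bounded_of_finite _) (bounded_of_finite _) fun a _ => ?_
  rw [← div_le_iff₀' hT', div_eq_inv_mul, ← one_div]
  -- Obeying the recommendation is one of the maps that swap regret competes with.
  refine le_ciSup_of_le ⟨1, ?_⟩ (fun _ r _ => r) le_rfl
  rintro _ ⟨h, rfl⟩
  exact G.agent_regret_bounded hU y T r p a h

section Regret

variable {A P Y : Type*} [Fintype A] [Fintype Y]

open Classical in
/-- The `ℓ¹` bias of the forecasts `π` on the rounds whose forecast lies in `E`. -/
noncomputable def bias (y : ℕ → Y) {T : ℕ} (π : Fin T → stdSimplex ℝ Y) (E : Set (stdSimplex ℝ Y)) :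
    ℝ :=
  ∑ z, |∑ t : Fin T, if π t ∈ E then π t z - (if y t = z then 1 else 0) else 0|

theorem bias_nonneg (y : ℕ → Y) {T : ℕ} (π : Fin T → stdSimplex ℝ Y) (E : Set (stdSimplex ℝ Y)) :
    0 ≤ bias y π E := Finset.sum_nonneg fun _ _ => abs_nonneg _

theorem bias_bounded (y : ℕ → Y) (T : ℕ) (E : Set (stdSimplex ℝ Y)) :
    ∃ M, ∀ π : Fin T → stdSimplex ℝ Y, |bias y π E| ≤ M := by
  classical
  refine ⟨∑ _ : Y, ∑ _ : Fin T, (1 : ℝ), fun π => ?_⟩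
  rw [abs_of_nonneg (bias_nonneg y π E)]
  refine Finset.sum_le_sum fun z _ => (Finset.abs_sum_le_sum_abs _ _).trans
    (Finset.sum_le_sum fun t _ => ?_)
  have h0 := (π t).2.1 z
  have h1 : π t z ≤ 1 := stdSimplex.le_one (π t) z
  have h0 : 0 ≤ π t z := h0
  split_ifs <;> rw [abs_le] <;> constructor <;> linarith

/-- Total of `√(number of rounds)` over all contexts. -/
theorem sum_sqrt_card_roundsWith_le {T : ℕ} (Q : Finset P) (r : Fin T → A) (p : Fin T → P) :
    ∑ x ∈ Q ×ˢ (Finset.univ : Finset A), √((roundsWith r p x.2 x.1).card : ℝ) ≤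
      √((Q.card * Fintype.card A : ℝ) * T) := by
  classical
  refine (sum_sqrt_le_sqrt _ fun _ _ => by positivity).trans (Real.sqrt_le_sqrt ?_)
  rw [Finset.card_product, Finset.card_univ, Nat.cast_mul]
  refine mul_le_mul_of_nonneg_left ?_ (by positivity)
  norm_cast
  have : ∀ x : P × A, roundsWith r p x.2 x.1 = Finset.univ.filter fun t => (p t, r t) = x := by
    intro x; ext t; simp [roundsWith, Prod.ext_iff]
  simp only [this]
  rw [Finset.sum_card_fiberwise_eq_card_filter]
  exact (Finset.card_filter_le _ _).trans (by simp)

theorem sum_contexts {T : ℕ} {Q : Finset P} (r : Fin T → A) {p : Fin T → P} (hp : ∀ t, p t ∈ Q)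
    (f : Fin T → ℝ) :
    ∑ x ∈ Q ×ˢ (Finset.univ : Finset A), ∑ t ∈ roundsWith r p x.2 x.1, f t = ∑ t, f t := by
  classical
  rw [← Finset.sum_fiberwise_of_maps_to (g := fun t => (p t, r t))
    (t := Q ×ˢ (Finset.univ : Finset A)) (by simp [hp])]
  refine Finset.sum_congr rfl fun x _ => Finset.sum_congr ?_ fun _ _ => rfl
  ext t; simp [roundsWith, Prod.ext_iff]

/-- If, under each forecast, a payoff `g` exceeds a target `W` by at most `D` plus `k` times the
Agent's loss, then the same holds for the payoff that a learning Agent generates, up to his swap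
regret, the information he has on the states, and the bias of the forecasts. -/
theorem expect_payoff_le (G : StageGame A P Y) (hU : ∀ a p y, G.agentUtil a p y ∈ Set.Icc (0 : ℝ) 1)
    (L : Learner A P Y) (y : ℕ → Y) {T : ℕ} (hT : 0 < T) (π : Fin T → stdSimplex ℝ Y)
    (p : Fin T → P) (r : Fin T → A) {Q : Finset P} (hp : ∀ t, p t ∈ Q)
    {g : A → P → Y → ℝ} (hg : ∀ a p y, |g a p y| ≤ 1) {k D K : ℝ} (hk : 0 ≤ k) (hK : 0 ≤ K)
    {W : Fin T → ℝ}
    (h : ∀ t b, ∑ z, π t z * g b (p t) z - W t ≤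
      D + k * (G.U (r t) (p t) (π t) - G.U b (p t) (π t)))
    (hsu : ∀ p' r', expect (actionLaw L y T r p) (fun a => |∑ t ∈ roundsWith r p r' p',
      (G.agentUtil (a t) p' (y t) - ∑ b, empirical (roundsWith r p r' p') a b *
        G.agentUtil b p' (y t))|) ≤ K * √((roundsWith r p r' p').card : ℝ))
    (hsg : ∀ p' r', expect (actionLaw L y T r p) (fun a => |∑ t ∈ roundsWith r p r' p',
      (g (a t) p' (y t) - ∑ b, empirical (roundsWith r p r' p') a b * g b p' (y t))|) ≤
        K * √((roundsWith r p r' p').card : ℝ))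
    {E : P × A → Set (stdSimplex ℝ Y)}
    (hE : ∀ x ∈ Q ×ˢ (Finset.univ : Finset A), ∀ t, π t ∈ E x ↔ p t = x.1 ∧ r t = x.2) :
    expect (actionLaw L y T r p) (fun a => ∑ t, g (a t) (p t) (y t)) ≤ ∑ t, W t + D * T +
      k * (T * G.swapReg L y T r p + K * √((Q.card * Fintype.card A : ℝ) * T) +
        2 * ∑ x ∈ Q ×ˢ (Finset.univ : Finset A), bias y π (E x)) +
      K * √((Q.card * Fintype.card A : ℝ) * T) +
      ∑ x ∈ Q ×ˢ (Finset.univ : Finset A), bias y π (E x) := by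
  classical
  set μ := actionLaw L y T r p
  set X := Q ×ˢ (Finset.univ : Finset A)
  set I : P × A → Finset (Fin T) := fun x => roundsWith r p x.2 x.1
  have hI : ∀ x t, t ∈ I x ↔ p t = x.1 ∧ r t = x.2 := fun x t => by simp [I, roundsWith]
  set su : P × A → (Fin T → A) → ℝ := fun x a => |∑ t ∈ I x,
      (G.agentUtil (a t) x.1 (y t) - ∑ b, empirical (I x) a b * G.agentUtil b x.1 (y t))|
  set sg : P × A → (Fin T → A) → ℝ := fun x a => |∑ t ∈ I x,
      (g (a t) x.1 (y t) - ∑ b, empirical (I x) a b * g b x.1 (y t))|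
  have hbias : ∀ x ∈ X, bias y π (E x) =
      ∑ z, |∑ t ∈ I x, (π t z - if y t = z then 1 else 0)| := by
    intro x hx
    refine Finset.sum_congr rfl fun z _ => ?_
    have : I x = Finset.univ.filter fun t => π t ∈ E x := by
      ext t; simp only [Finset.mem_filter, Finset.mem_univ, true_and, hI, hE x hx t]
    rw [this, Finset.sum_filter]
  have point : ∀ a : Fin T → A, ∑ t, g (a t) (p t) (y t) ≤ ∑ t, W t + D * T +
      k * (∑ t : Fin T, (G.agentUtil (r t) (p t) (y t) - G.agentUtil (a t) (p t) (y t)) +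
        ∑ x ∈ X, su x a + 2 * ∑ x ∈ X, bias y π (E x)) + ∑ x ∈ X, sg x a +
      ∑ x ∈ X, bias y π (E x) := by
    intro a
    have ctx : ∀ x ∈ X, ∑ t ∈ I x, (g (a t) (p t) (y t) - W t) ≤ ∑ t ∈ I x, D +
        k * (∑ t ∈ I x, (G.agentUtil (r t) (p t) (y t) - G.agentUtil (a t) (p t) (y t)) +
          su x a + 2 * bias y π (E x)) + sg x a + bias y π (E x) := by
      intro x hx
      -- On a context without rounds the empirical weights are all `0/0 = 0` and do not sum to one,
      -- so this case is separate.
      rcases (I x).eq_empty_or_nonempty with h0 | hne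
      · have : 0 ≤ bias y π (E x) := bias_nonneg _ _ _
        have h1 : 0 ≤ su x a := abs_nonneg _
        have h2 : 0 ≤ sg x a := abs_nonneg _
        simp only [h0, Finset.sum_empty, zero_add]
        positivity
      · have := sum_payoff_sub_target_le (I x) π (fun t => y t) a x.2
          (u := fun b z => G.agentUtil b x.1 z) (g := fun b z => g b x.1 z)
          (fun b z => abs_le.2 ⟨by linarith [(hU b x.1 z).1], (hU b x.1 z).2⟩)
          (fun b z => hg b x.1 z) (fun b => empirical_nonneg (I x) a b) (sum_empirical hne a)
          (W := W) (D := D) hk (by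
            intro t ht b
            obtain ⟨h1, h2⟩ := (hI x t).1 ht
            have := h t b
            rw [h1, h2] at this
            exact this)
        rw [hbias x hx, Finset.sum_const, nsmul_eq_mul, mul_comm _ D]
        refine le_trans (le_of_eq ?_) (this.trans (le_of_eq ?_))
        · exact Finset.sum_congr rfl fun t ht => by rw [((hI x t).1 ht).1]
        · have : ∑ t ∈ I x, (G.agentUtil (r t) (p t) (y t) - G.agentUtil (a t) (p t) (y t)) =
              ∑ t ∈ I x, (G.agentUtil x.2 x.1 (y t) - G.agentUtil (a t) x.1 (y t)) :=
            Finset.sum_congr rfl fun t ht => by rw [((hI x t).1 ht).1, ((hI x t).1 ht).2]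
          rw [this]
    have tot := Finset.sum_le_sum ctx
    simp only [Finset.sum_add_distrib, ← Finset.mul_sum] at tot
    have hs : ∀ f : Fin T → ℝ, ∑ x ∈ X, ∑ t ∈ I x, f t = ∑ t, f t := sum_contexts r hp
    simp only [hs] at tot
    rw [Finset.sum_sub_distrib] at tot
    simp only [Finset.sum_const, Finset.card_univ, Fintype.card_fin, nsmul_eq_mul] at tot
    linarith
  have e1 : expect μ (fun a => ∑ t, g (a t) (p t) (y t)) ≤ expect μ (fun a =>
      (∑ t, W t + D * T + k * (2 * ∑ x ∈ X, bias y π (E x)) + ∑ x ∈ X, bias y π (E x)) +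
      (k * (∑ t : Fin T, (G.agentUtil (r t) (p t) (y t) - G.agentUtil (a t) (p t) (y t)) +
        ∑ x ∈ X, su x a) + ∑ x ∈ X, sg x a)) := by
    refine expect_mono_on_support _ (bounded_of_finite _) (bounded_of_finite _) fun a _ => ?_
    have := point a
    linarith
  have b := fun f : (Fin T → A) → ℝ => bounded_of_finite f
  rw [expect_add μ (b _) (b _), expect_const, expect_add μ (b _) (b _), expect_const_mul,
    expect_add μ (b _) (b _), expect_sum μ X fun _ _ => b _,
    expect_sum μ X fun _ _ => b _] at e1
  have e2 := G.expect_obedience_gain_le hU L y hT r p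
  have hsq : ∑ x ∈ X, K * √((I x).card : ℝ) ≤ K * √((Q.card * Fintype.card A : ℝ) * T) := by
    rw [← Finset.mul_sum]
    exact mul_le_mul_of_nonneg_left (sum_sqrt_card_roundsWith_le Q r p) hK
  have e3 : ∑ x ∈ X, expect μ (su x) ≤ K * √((Q.card * Fintype.card A : ℝ) * T) :=
    (Finset.sum_le_sum fun x _ => hsu x.1 x.2).trans hsq
  have e4 : ∑ x ∈ X, expect μ (sg x) ≤ K * √((Q.card * Fintype.card A : ℝ) * T) :=
    (Finset.sum_le_sum fun x _ => hsg x.1 x.2).trans hsq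
  have e5 := mul_le_mul_of_nonneg_left (add_le_add e2 e3) hk
  linarith

end Regret

end StageGame

/-! ### Regret of forecasts coupled with an optimal stable oracle. -/

namespace StageGame

section Regret

variable {A P Y : Type*} [Fintype A] [Fintype Y]

/-- Expected total bias over a family of contexts that partitions the rounds. -/
theorem expect_sum_bias_le {F : Forecaster Y} {ι : Type*} [Fintype ι] {𝓔 : ι → Set (stdSimplex ℝ Y)}
    {T : ℕ} (hT : 0 < T) {κ : ℝ} (hF : HasLowBias F 𝓔 T κ) (y : ℕ → Y) {Q : Finset P}
    {E : P × A → Set (stdSimplex ℝ Y)}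
    (hE𝓔 : ∀ x ∈ Q ×ˢ (Finset.univ : Finset A), ∃ i, 𝓔 i = E x)
    (p : (Fin T → stdSimplex ℝ Y) → Fin T → P) (r : (Fin T → stdSimplex ℝ Y) → Fin T → A)
    (hE : ∀ x ∈ Q ×ˢ (Finset.univ : Finset A), ∀ π t, π t ∈ E x ↔ p π t = x.1 ∧ r π t = x.2)
    {ℓ N : ℝ} (hℓ : ℓ = Real.log ((Fintype.card Y : ℝ) * (Fintype.card ι : ℝ) * (T : ℝ)))
    (hN : (Q.card * Fintype.card A : ℝ) ≤ N) :
    expect (forecastLaw F y T) (fun π => ∑ x ∈ Q ×ˢ (Finset.univ : Finset A), bias y π (E x)) ≤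
      |κ| * Fintype.card Y * (N * ℓ + √ℓ * √(N * T)) := by
  classical
  have hT' : (0 : ℝ) < T := by exact_mod_cast hT
  have hℓ0 : 0 ≤ ℓ := by
    rw [hℓ]
    exact_mod_cast Real.log_natCast_nonneg (Fintype.card Y * Fintype.card ι * T)
  set X := Q ×ˢ (Finset.univ : Finset A)
  set n : (Fin T → stdSimplex ℝ Y) → P × A → ℝ := fun π x => (roundsWith (r π) (p π) x.2 x.1).card
  have hn : ∀ π x, |√(n π x)| ≤ √T := by
    intro π x
    rw [abs_of_nonneg (Real.sqrt_nonneg _)]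
    refine Real.sqrt_le_sqrt ?_
    have := (Finset.card_le_univ (roundsWith (r π) (p π) x.2 x.1))
    simp only [Fintype.card_fin] at this
    exact Nat.cast_le.2 this
  have hbdd : ∀ x, ∃ M, ∀ π, |(|κ| * (Fintype.card Y * (ℓ + √ℓ * √(n π x))))| ≤ M := fun x =>
    bounded_const_mul _ (bounded_const_mul _ (bounded_add (bounded_const ℓ)
      (bounded_const_mul _ ⟨√T, fun π => hn π x⟩)))
  have each : ∀ x ∈ X, expect (forecastLaw F y T) (fun π => bias y π (E x)) ≤
      expect (forecastLaw F y T) (fun π => |κ| * (Fintype.card Y * (ℓ + √ℓ * √(n π x)))) := by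
    intro x hx
    obtain ⟨i, hi⟩ := hE𝓔 x hx
    have h := hF y i
    simp only [← hℓ] at h
    rw [expect_const_mul, hi, one_div, inv_mul_le_iff₀ hT', ← expect_const_mul] at h
    refine le_trans (le_of_eq ?_) (h.trans ?_)
    · rfl
    · have hcard : ∀ π : Fin T → stdSimplex ℝ Y,
          ((Finset.univ.filter fun t : Fin T => π t ∈ E x).card : ℝ) = n π x := by
        intro π
        have : (Finset.univ.filter fun t : Fin T => π t ∈ E x) =
            roundsWith (r π) (p π) x.2 x.1 := by
          ext t; simp [roundsWith, hE x hx π t]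
        simp only [n, ← this]
      have heq : ∀ π : Fin T → stdSimplex ℝ Y, (T : ℝ) * (κ * ((Fintype.card Y : ℝ) * ℓ / T +
          (Fintype.card Y : ℝ) *
            √(ℓ * ((Finset.univ.filter fun t : Fin T => π t ∈ E x).card : ℝ)) / T)) =
          κ * (Fintype.card Y * (ℓ + √ℓ * √(n π x))) := by
        intro π
        rw [hcard π, Real.sqrt_mul hℓ0]
        field_simp
      have hb : ∃ M, ∀ π, |κ * (Fintype.card Y * (ℓ + √ℓ * √(n π x)))| ≤ M :=
        bounded_const_mul _ (bounded_const_mul _ (bounded_add (bounded_const ℓ)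
          (bounded_const_mul _ ⟨√T, fun π => hn π x⟩)))
      refine le_trans (le_of_eq ?_) (expect_mono_on_support _ hb (hbdd x) fun π _ => ?_)
      · refine congrArg (expect _) (funext fun π => ?_)
        rw [← heq π]
      · refine mul_le_mul_of_nonneg_right (le_abs_self κ) ?_
        positivity
  rw [expect_sum _ _ fun x _ => bias_bounded y T (E x)]
  refine (Finset.sum_le_sum each).trans ?_
  -- The sum goes back inside the expectation because the numbers of visits are random:
  -- Cauchy–Schwarz is applied along each realization, where they add up to at most `T`.
  rw [← expect_sum _ _ fun x _ => hbdd x]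
  refine le_trans (expect_mono_on_support _ (bounded_sum _ fun x _ => hbdd x)
    (bounded_const (|κ| * Fintype.card Y * (N * ℓ + √ℓ * √(N * T)))) fun π _ => ?_)
    (expect_const _ _).le
  simp only [← Finset.mul_sum, Finset.sum_add_distrib]
  rw [mul_assoc]
  have h1 : ∑ _x ∈ X, ℓ ≤ N * ℓ := by
    rw [Finset.sum_const, nsmul_eq_mul, Finset.card_product, Finset.card_univ, Nat.cast_mul]
    exact mul_le_mul_of_nonneg_right hN hℓ0
  have h2 : ∑ x ∈ X, √(n π x) ≤ √(N * T) :=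
    (sum_sqrt_card_roundsWith_le Q (r π) (p π)).trans
      (Real.sqrt_le_sqrt (mul_le_mul_of_nonneg_right hN hT'.le))
  gcongr

theorem expected_util_mem_Icc {f : Y → ℝ} (hf : ∀ z, f z ∈ Set.Icc (0 : ℝ) 1) (π : stdSimplex ℝ Y) :
    ∑ z, π z * f z ∈ Set.Icc (0 : ℝ) 1 := by
  have h0 : ∀ z, 0 ≤ π z := fun z => π.2.1 z
  refine ⟨Finset.sum_nonneg fun z _ => mul_nonneg (h0 z) (hf z).1, ?_⟩
  rw [← stdSimplex.sum_eq_one π]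
  exact Finset.sum_le_sum fun z _ => mul_le_of_le_one_right (h0 z) (hf z).2

/-- Regret of the mechanism that couples forecasts of low bias with an optimal stable oracle. -/
theorem principalRegret_le (G : StageGame A P Y) (hU : ∀ a p y, G.agentUtil a p y ∈ Set.Icc (0 : ℝ) 1)
    (hV : ∀ a p y, G.principalUtil a p y ∈ Set.Icc (0 : ℝ) 1) {aStar : P → stdSimplex ℝ Y → A}
    (haStar : G.IsBestResponseRule aStar) {P₀ PO : Finset P} (hP₀ : P₀.Nonempty)
    {O : stdSimplex ℝ Y → P} {c ε β γ : ℝ} (hε : 0 < ε) (hβ : 0 < β) (hγ : 0 ≤ γ)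
    (hO : G.IsOptimalStableOracle aStar P₀ c ε β γ PO O)
    {pOpt : stdSimplex ℝ Y → P} {aOpt : stdSimplex ℝ Y → A} {F : Forecaster Y} {T : ℕ} (hT : 0 < T)
    {κ : ℝ} (hF : HasLowBias F (events aStar P₀ PO O pOpt aOpt) T κ) {L : Learner A P Y}
    {y : ℕ → Y} {εs κn : ℝ} (hs : G.NoSwapRegret aStar P₀ O F L y T εs)
    (hn : G.NoSecretInformation aStar P₀ O F L y T κn) {ℓ N : ℝ}
    (hℓ : ℓ = Real.log ((Fintype.card Y : ℝ) *
      (Fintype.card (((PO × A) ⊕ (P₀ × A)) ⊕ (P₀ × A)) : ℝ) * (T : ℝ)))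
    (hN : (PO.card * Fintype.card A : ℝ) = N) :
    G.principalRegret aStar P₀ hP₀ O F L y T ≤ c + γ +
      ((1 / β + 1) + P₀.card * (1 / ε + 1)) *
        ((T * εs + |κn| * √(N * T) +
          2 * (|κ| * Fintype.card Y * (N * ℓ + √ℓ * √(N * T)))) / T) := by
  classical
  have hT' : (0 : ℝ) < T := by exact_mod_cast hT
  set B := |κ| * Fintype.card Y * (N * ℓ + √ℓ * √(N * T))
  set R := |κn| * √(N * T)
  have hR : 0 ≤ R := by positivity
  set μ := forecastLaw F y T
  -- A single policy has no more contexts than the oracle, whose output space is nonempty because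
  -- some forecast occurs. So one budget `N` serves the mechanism and every benchmark.
  have hN1 : ∀ p₀ : P, ((({p₀} : Finset P)).card * Fintype.card A : ℝ) ≤ N := by
    intro p₀
    obtain ⟨π, _⟩ := μ.support_nonempty
    have h1 : 0 < PO.card := Finset.card_pos.2 ⟨_, (hO (π ⟨0, hT⟩)).1⟩
    rw [← hN, Finset.card_singleton]
    gcongr
    exact_mod_cast h1
  set pd : (Fin T → stdSimplex ℝ Y) → Fin T → P := fun π t => O (π t)
  set sd : (Fin T → stdSimplex ℝ Y) → ℝ := fun π => G.swapReg L y T (recommend aStar (pd π) π) (pd π)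
  set sb : P → (Fin T → stdSimplex ℝ Y) → ℝ := fun p₀ π =>
    G.swapReg L y T (recommend aStar (fun _ => p₀) π) (fun _ => p₀)
  set Ed : P × A → Set (stdSimplex ℝ Y) := fun x => {π | O π = x.1 ∧ aStar (O π) π = x.2}
  set Eb : P × A → Set (stdSimplex ℝ Y) := fun x => {π | aStar x.1 π = x.2}
  set bd : (Fin T → stdSimplex ℝ Y) → ℝ := fun π =>
    ∑ x ∈ PO ×ˢ (Finset.univ : Finset A), bias y π (Ed x)
  set bb : P → (Fin T → stdSimplex ℝ Y) → ℝ := fun p₀ π =>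
    ∑ x ∈ {p₀} ×ˢ (Finset.univ : Finset A), bias y π (Eb x)
  have hbd0 : ∀ π, 0 ≤ bd π := fun π => Finset.sum_nonneg fun x _ => bias_nonneg _ _ _
  have hbb0 : ∀ p₀ π, 0 ≤ bb p₀ π := fun p₀ π => Finset.sum_nonneg fun x _ => bias_nonneg _ _ _
  have hsd0 : ∀ π, sd π ∈ Set.Icc (0 : ℝ) 1 := fun π => G.swapReg_mem_Icc hU L y T _ _
  have hsb0 : ∀ p₀ π, sb p₀ π ∈ Set.Icc (0 : ℝ) 1 := fun p₀ π => G.swapReg_mem_Icc hU L y T _ _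
  set dep : (Fin T → stdSimplex ℝ Y) → ℝ := fun π => T * sd π + (R + 2 * bd π)
  set ben : P → (Fin T → stdSimplex ℝ Y) → ℝ := fun p₀ π => T * sb p₀ π + (R + 2 * bb p₀ π)
  set W : (Fin T → stdSimplex ℝ Y) → Fin T → ℝ := fun π t => G.V (aStar (O (π t)) (π t)) (O (π t)) (π t)
  have Vabs : ∀ a p y, |G.principalUtil a p y| ≤ 1 := fun a p y =>
    abs_le.2 ⟨by linarith [(hV a p y).1], (hV a p y).2⟩
  have VIcc : ∀ a p π, G.V a p π ∈ Set.Icc (0 : ℝ) 1 := fun a p π =>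
    expected_util_mem_Icc (hV a p) π
  have sqrtN : |κn| * √((PO.card * Fintype.card A : ℝ) * T) = R := by rw [hN]
  have secret_abs : ∀ n : ℕ, κn * √(n : ℝ) ≤ |κn| * √(n : ℝ) := fun n =>
    mul_le_mul_of_nonneg_right (le_abs_self κn) (Real.sqrt_nonneg _)
  have deployed : ∀ π ∈ μ.support, ∑ t, W π t ≤
      T * G.avgPrincipalUtil aStar L y T π (pd π) + γ * T + (1 / β + 1) * dep π := by
    intro π hπ
    have hsec := (hn π hπ).1
    have h := G.expect_payoff_le hU L y hT π (pd π) (recommend aStar (pd π) π) (Q := PO)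
      (fun t => (hO (π t)).1) (g := fun a p z => - G.principalUtil a p z)
      (fun a p z => by rw [abs_neg]; exact Vabs a p z) (k := 1 / β) (D := γ) (by positivity)
      (abs_nonneg κn) (W := fun t => - W π t) (by
        intro t b
        have hst := (hO (π t)).2.1 b
        have hbr := (haStar (O (π t)) (π t)).1 b
        simp only [mul_neg, Finset.sum_neg_distrib]
        change - G.V b (O (π t)) (π t) - - W π t ≤ γ + 1 / β *
          (G.U (aStar (O (π t)) (π t)) (O (π t)) (π t) - G.U b (O (π t)) (π t))
        -- Either a deviation costs the Agent at least `β`, and `1/β` times his loss exceeds the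
        -- whole range of `V`, or it costs the Principal at most `γ`.
        by_cases hb : b = aStar (O (π t)) (π t)
        · rw [← hb]
          simp only [sub_self, mul_zero, W, ← hb]
          linarith
        · rcases hst hb with h1 | h1
          · have : 1 ≤ 1 / β *
                (G.U (aStar (O (π t)) (π t)) (O (π t)) (π t) - G.U b (O (π t)) (π t)) := by
              rw [one_div, inv_mul_eq_div, le_div_iff₀ hβ]; linarith
            have h2 := (VIcc b (O (π t)) (π t)).1
            have h3 := (VIcc (aStar (O (π t)) (π t)) (O (π t)) (π t)).2
            simp only [W]
            linarith
          · have : 0 ≤ 1 / β *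
                (G.U (aStar (O (π t)) (π t)) (O (π t)) (π t) - G.U b (O (π t)) (π t)) :=
              mul_nonneg (by positivity) (by linarith)
            simp only [W]
            linarith)
      (fun p' r' => ((hsec p' r').1).trans (secret_abs _))
      (fun p' r' => by
        refine le_trans (le_of_eq ?_) (((hsec p' r').2).trans (secret_abs _))
        refine congrArg (expect _) (funext fun a => ?_)
        rw [← abs_neg, ← Finset.sum_neg_distrib]
        refine congrArg abs (Finset.sum_congr rfl fun t _ => ?_)
        simp only [mul_neg, Finset.sum_neg_distrib]
        ring)
      (E := Ed) (by intro x _ t; exact Iff.rfl)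
    rw [sqrtN] at h
    simp only [Finset.sum_neg_distrib] at h
    have e : expect (actionLaw L y T (recommend aStar (pd π) π) (pd π))
        (fun a => -∑ t, G.principalUtil (a t) (pd π t) (y t)) =
        - (T * G.avgPrincipalUtil aStar L y T π (pd π)) := by
      have : ∀ a : Fin T → A, -∑ t, G.principalUtil (a t) (pd π t) (y t) =
          (-T) * ((1 / (T : ℝ)) * ∑ t, G.principalUtil (a t) (pd π t) (y t)) := fun a => by
        field_simp
      simp only [this, avgPrincipalUtil]
      rw [expect_const_mul]; ring
    rw [e] at h
    have h1 : 0 ≤ T * sd π := mul_nonneg hT'.le (hsd0 π).1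
    have h2 := hbd0 π
    have : (1 / β + 1) * dep π = 1 / β * (T * sd π + R + 2 * bd π) + R + bd π +
        (T * sd π + bd π) := by simp only [dep]; ring
    rw [this]
    linarith
  have benchmark : ∀ π ∈ μ.support, ∀ p₀ ∈ P₀,
      T * G.avgPrincipalUtil aStar L y T π (fun _ => p₀) ≤ ∑ t, W π t + c * T +
        (1 / ε + 1) * ben p₀ π := by
    intro π hπ p₀ hp₀
    have hsec := (hn π hπ).2 p₀ hp₀
    have h := G.expect_payoff_le hU L y hT π (fun _ => p₀) (recommend aStar (fun _ => p₀) π)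
      (Q := {p₀}) (fun t => Finset.mem_singleton_self _) (g := G.principalUtil)
      Vabs (k := 1 / ε) (D := c) (by positivity)
      (abs_nonneg κn) (W := W π) (by
        intro t b
        change G.V b p₀ (π t) - W π t ≤ c + 1 / ε *
          (G.U (aStar p₀ (π t)) p₀ (π t) - G.U b p₀ (π t))
        have hbr := (haStar p₀ (π t)).1 b
        have hopt := (hO (π t)).2.2 p₀ hp₀
        by_cases hb : b ∈ G.epsBestResponses aStar p₀ (π t) ε
        · have := hopt b hb
          have : 0 ≤ 1 / ε * (G.U (aStar p₀ (π t)) p₀ (π t) - G.U b p₀ (π t)) :=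
            mul_nonneg (by positivity) (by linarith)
          simp only [W]
          linarith
        · have h1 : G.U b p₀ (π t) < G.U (aStar p₀ (π t)) p₀ (π t) - ε := by
            exact not_le.1 hb
          have h2 : 1 ≤ 1 / ε * (G.U (aStar p₀ (π t)) p₀ (π t) - G.U b p₀ (π t)) := by
            rw [one_div, inv_mul_eq_div, le_div_iff₀ hε]; linarith
          have h3 := (VIcc b p₀ (π t)).2
          -- The exact best response is also an `ε`-best response, so the target plus `c` is
          -- nonnegative. This leaves the value of `b`, at most 1, to be paid for by `1/ε` times a
          -- loss of at least `ε`.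
          have h4 := hopt (aStar p₀ (π t)) (by simp [epsBestResponses, hε.le])
          have h5 := (VIcc (aStar p₀ (π t)) p₀ (π t)).1
          simp only [W]
          linarith)
      (fun p' r' => ((hsec p' r').1).trans (secret_abs _))
      (fun p' r' => ((hsec p' r').2).trans (secret_abs _))
      (E := Eb) (by
        intro x hx t
        have : x.1 = p₀ := Finset.mem_singleton.1 (Finset.mem_product.1 hx).1
        simp [Eb, recommend, this])
    have e : expect (actionLaw L y T (recommend aStar (fun _ => p₀) π) (fun _ => p₀))
        (fun a => ∑ t, G.principalUtil (a t) p₀ (y t)) =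
        T * G.avgPrincipalUtil aStar L y T π (fun _ => p₀) := by
      have : ∀ a : Fin T → A, ∑ t, G.principalUtil (a t) p₀ (y t) =
          T * ((1 / (T : ℝ)) * ∑ t, G.principalUtil (a t) p₀ (y t)) := fun a => by
        field_simp
      rw [avgPrincipalUtil, ← expect_const_mul]
      exact congrArg _ (funext this)
    rw [e] at h
    have hR' : |κn| * √((({p₀} : Finset P).card * Fintype.card A : ℝ) * T) ≤ R :=
      mul_le_mul_of_nonneg_left (Real.sqrt_le_sqrt
        (mul_le_mul_of_nonneg_right (hN1 p₀) hT'.le)) (abs_nonneg _)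
    have h1 : 0 ≤ T * sb p₀ π := mul_nonneg hT'.le (hsb0 p₀ π).1
    have h2 := hbb0 p₀ π
    have : (1 / ε + 1) * ben p₀ π = 1 / ε * (T * sb p₀ π + R + 2 * bb p₀ π) + R + bb p₀ π +
        (T * sb p₀ π + bb p₀ π) := by simp only [ben]; ring
    rw [this]
    have h3 := mul_le_mul_of_nonneg_left hR' (show 0 ≤ 1 / ε by positivity)
    have h4 : 1 / ε * (T * sb p₀ π + |κn| * √((({p₀} : Finset P).card * Fintype.card A : ℝ) * T) +
        2 * bb p₀ π) ≤ 1 / ε * (T * sb p₀ π + R + 2 * bb p₀ π) := by gcongr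
    linarith
  have hben0 : ∀ p₀ π, 0 ≤ ben p₀ π := fun p₀ π => by
    have h1 := (hsb0 p₀ π).1
    have h2 := hbb0 p₀ π
    positivity
  have point : ∀ π ∈ μ.support, G.policyRegret aStar P₀ hP₀ O L y T π ≤
      (c + γ) + (1 / T * (1 / β + 1) * dep π + 1 / T * (1 / ε + 1) * ∑ p₀ ∈ P₀, ben p₀ π) := by
    intro π hπ
    refine Finset.sup'_le _ _ fun p₀ hp₀ => ?_
    have h1 := deployed π hπ
    have h2 := benchmark π hπ p₀ hp₀
    -- The best benchmark may depend on the forecasts. Bounding its error by the sum over all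
    -- benchmarks lets the expectation pass through, at the price of a factor `P₀.card`.
    have h3 : ben p₀ π ≤ ∑ p₀ ∈ P₀, ben p₀ π :=
      Finset.single_le_sum (f := fun p₀ => ben p₀ π) (fun p₀ _ => hben0 p₀ π) hp₀
    have h4 := mul_le_mul_of_nonneg_left h3 (show 0 ≤ 1 / ε + 1 by positivity)
    have h5 : T * (G.avgPrincipalUtil aStar L y T π (fun _ => p₀) -
        G.avgPrincipalUtil aStar L y T π (pd π)) ≤ T * (c + γ) + (1 / β + 1) * dep π +
          (1 / ε + 1) * ∑ p₀ ∈ P₀, ben p₀ π := by linarith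
    rw [← le_div_iff₀' hT'] at h5
    refine h5.trans_eq ?_
    field_simp
    ring
  have bdd_sd : ∃ M, ∀ π, |sd π| ≤ M := ⟨1, fun π => abs_le.2 ⟨by linarith [(hsd0 π).1], (hsd0 π).2⟩⟩
  have bdd_sb : ∀ p₀, ∃ M, ∀ π, |sb p₀ π| ≤ M := fun p₀ =>
    ⟨1, fun π => abs_le.2 ⟨by linarith [(hsb0 p₀ π).1], (hsb0 p₀ π).2⟩⟩
  have bdd_bd : ∃ M, ∀ π, |bd π| ≤ M := bounded_sum _ fun x _ => bias_bounded y T (Ed x)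
  have bdd_bb : ∀ p₀, ∃ M, ∀ π, |bb p₀ π| ≤ M := fun p₀ =>
    bounded_sum _ fun x _ => bias_bounded y T (Eb x)
  have bdd_dep : ∃ M, ∀ π, |dep π| ≤ M :=
    bounded_add (bounded_const_mul _ bdd_sd) (bounded_add (bounded_const R)
      (bounded_const_mul _ bdd_bd))
  have bdd_ben : ∀ p₀, ∃ M, ∀ π, |ben p₀ π| ≤ M := fun p₀ =>
    bounded_add (bounded_const_mul _ (bdd_sb p₀)) (bounded_add (bounded_const R)
      (bounded_const_mul _ (bdd_bb p₀)))
  have bdd_reg : ∃ M, ∀ π, |G.policyRegret aStar P₀ hP₀ O L y T π| ≤ M := by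
    have havg : ∀ π p, G.avgPrincipalUtil aStar L y T π p ∈ Set.Icc (0 : ℝ) 1 := by
      intro π p
      refine expect_mem_Icc _ fun a => ⟨mul_nonneg (by positivity)
        (Finset.sum_nonneg fun t _ => (hV _ _ _).1), ?_⟩
      rw [one_div, inv_mul_le_iff₀ hT']
      have : ∑ t, G.principalUtil (a t) (p t) (y t) ≤ ∑ _t : Fin T, 1 :=
        Finset.sum_le_sum fun t _ => (hV _ _ _).2
      simpa using this
    refine ⟨1, fun π => abs_le.2 ⟨?_, Finset.sup'_le _ _ fun p₀ _ => ?_⟩⟩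
    · obtain ⟨p₀, hp₀⟩ := hP₀
      refine le_trans ?_ (Finset.le_sup' _ hp₀)
      linarith [(havg π fun _ => p₀).1, (havg π fun t => O (π t)).2]
    · linarith [(havg π fun _ => p₀).2, (havg π fun t => O (π t)).1]
  have Ebd : expect μ bd ≤ B := expect_sum_bias_le hT hF y
    (fun x hx => ⟨.inl (.inl (⟨x.1, (Finset.mem_product.1 hx).1⟩, x.2)), rfl⟩) pd
    (fun π => recommend aStar (pd π) π) (fun x _ π t => Iff.rfl) hℓ hN.le
  have Ebb : ∀ p₀ ∈ P₀, expect μ (bb p₀) ≤ B := fun p₀ hp₀ => expect_sum_bias_le hT hF y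
    (fun x hx => ⟨.inr (⟨x.1, by
      have : x.1 = p₀ := Finset.mem_singleton.1 (Finset.mem_product.1 hx).1
      rwa [this]⟩, x.2), rfl⟩) (fun _ _ => p₀)
    (fun π => recommend aStar (fun _ => p₀) π) (fun x hx π t => by
      have : x.1 = p₀ := Finset.mem_singleton.1 (Finset.mem_product.1 hx).1
      simp [Eb, recommend, this]) hℓ (hN1 p₀)
  have Edep : expect μ dep ≤ T * εs + R + 2 * B := by
    simp only [dep]
    rw [expect_add μ (bounded_const_mul _ bdd_sd) (bounded_add (bounded_const R)
      (bounded_const_mul _ bdd_bd)), expect_const_mul, expect_add μ (bounded_const R)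
      (bounded_const_mul _ bdd_bd), expect_const, expect_const_mul]
    have := mul_le_mul_of_nonneg_left hs.1 hT'.le
    linarith
  have Eben : ∀ p₀ ∈ P₀, expect μ (ben p₀) ≤ T * εs + R + 2 * B := by
    intro p₀ hp₀
    simp only [ben]
    rw [expect_add μ (bounded_const_mul _ (bdd_sb p₀)) (bounded_add (bounded_const R)
      (bounded_const_mul _ (bdd_bb p₀))), expect_const_mul, expect_add μ (bounded_const R)
      (bounded_const_mul _ (bdd_bb p₀)), expect_const, expect_const_mul]
    have h1 := mul_le_mul_of_nonneg_left (hs.2 p₀ hp₀) hT'.le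
    have h2 := Ebb p₀ hp₀
    linarith
  have bdd_sum : ∃ M, ∀ π, |∑ p₀ ∈ P₀, ben p₀ π| ≤ M := bounded_sum _ fun p₀ _ => bdd_ben p₀
  have fin := expect_mono_on_support μ bdd_reg (bounded_add (bounded_const (c + γ))
    (bounded_add (bounded_const_mul (1 / T * (1 / β + 1)) bdd_dep)
      (bounded_const_mul (1 / T * (1 / ε + 1)) bdd_sum))) point
  rw [expect_add μ (bounded_const _) (bounded_add (bounded_const_mul _ bdd_dep)
      (bounded_const_mul _ bdd_sum)), expect_const, expect_add μ (bounded_const_mul _ bdd_dep)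
      (bounded_const_mul _ bdd_sum), expect_const_mul, expect_const_mul,
      expect_sum μ P₀ fun p₀ _ => bdd_ben p₀] at fin
  have Esum : ∑ p₀ ∈ P₀, expect μ (ben p₀) ≤ P₀.card * (T * εs + R + 2 * B) := by
    rw [← nsmul_eq_mul]
    exact Finset.sum_le_card_nsmul _ _ _ Eben
  have f1 := mul_le_mul_of_nonneg_left Edep (show 0 ≤ 1 / T * (1 / β + 1) by positivity)
  have f2 := mul_le_mul_of_nonneg_left Esum (show 0 ≤ 1 / T * (1 / ε + 1) by positivity)
  refine (fin.trans (add_le_add_right (add_le_add f1 f2) _)).trans_eq ?_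
  field_simp

end Regret

end StageGame

/-! ## A forecasting algorithm for binary states -/

section Forecasts

open scoped ENNReal

/-- The potential is averaged in `ℝ≥0∞`, where sums can be interchanged without any summability
condition. -/
theorem PMF.tsum_bind_mul {X Z : Type*} (μ : PMF X) (k : X → PMF Z) (f : Z → ℝ≥0∞) :
    ∑' z, (μ.bind k) z * f z = ∑' x, μ x * ∑' z, k x z * f z := by
  simp only [PMF.bind_apply, ← ENNReal.tsum_mul_right, ← ENNReal.tsum_mul_left]
  rw [ENNReal.tsum_comm]
  exact tsum_congr fun x => tsum_congr fun z => mul_assoc _ _ _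

theorem PMF.tsum_pure_mul {X : Type*} (x : X) (f : X → ℝ≥0∞) :
    ∑' z, PMF.pure x z * f z = f x := by
  rw [tsum_eq_single x fun z hz => by simp [PMF.pure_apply, hz]]
  simp

theorem PMF.tsum_map_mul {X Z : Type*} (μ : PMF X) (g : X → Z) (f : Z → ℝ≥0∞) :
    ∑' z, (μ.map g) z * f z = ∑' x, μ x * f (g x) := by
  rw [← PMF.bind_pure_comp, PMF.tsum_bind_mul]
  exact tsum_congr fun x => by rw [Function.comp_apply, PMF.tsum_pure_mul]

theorem expect_eq_toReal {X : Type*} (μ : PMF X) {f : X → ℝ} (hf : ∀ x, 0 ≤ f x) :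
    expect μ f = (∑' x, μ x * ENNReal.ofReal (f x)).toReal := by
  rw [ENNReal.tsum_toReal_eq fun x => ENNReal.mul_ne_top (μ.apply_ne_top x) ENNReal.ofReal_ne_top]
  exact tsum_congr fun x => by rw [ENNReal.toReal_mul, ENNReal.toReal_ofReal (hf x)]

/-- The forecast that assigns probability `k/m` to state `1`. -/
theorem exists_forecast_eq_div {m k : ℕ} (hm : 0 < m) (hk : k ≤ m) :
    ∃ q : stdSimplex ℝ (Fin 2), q 1 = (k : ℝ) / m := by
  have hm' : (0 : ℝ) < m := by exact_mod_cast hm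
  have hk' : (k : ℝ) / m ≤ 1 := (div_le_one hm').2 (by exact_mod_cast hk)
  refine ⟨⟨![1 - k / m, k / m], ⟨fun i => ?_, by simp⟩⟩, rfl⟩
  fin_cases i
  · simpa using hk'
  · change (0 : ℝ) ≤ k / m
    positivity

/-- A randomization between two adjacent points of the grid of mesh `1/m` makes any bounded payoff
of the form `g(π)(π₁ - y)` small, whatever the state `y`. -/
theorem exists_calibrating_mixture (g : stdSimplex ℝ (Fin 2) → ℝ) {B : ℝ} (hg : ∀ q, |g q| ≤ B)
    {m : ℕ} (hm : 0 < m) :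
    ∃ (q₁ q₂ : stdSimplex ℝ (Fin 2)) (θ : ℝ), θ ∈ Set.Icc (0 : ℝ) 1 ∧
      ∀ z ∈ Set.Icc (0 : ℝ) 1,
        θ * (g q₁ * (q₁ 1 - z)) + (1 - θ) * (g q₂ * (q₂ 1 - z)) ≤ B / m := by
  have hm' : (0 : ℝ) < m := by exact_mod_cast hm
  choose! q hq using fun k => exists_forecast_eq_div (m := m) (k := k) hm
  have hB : 0 ≤ B := (abs_nonneg _).trans (hg (q 0))
  have hBm : 0 ≤ B / m := by positivity
  -- If `g` has a favourable sign at an endpoint of the grid, forecasting that endpoint makes the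
  -- payoff nonpositive for every `z`.
  by_cases h0 : 0 ≤ g (q 0)
  · refine ⟨q 0, q 0, 1, by simp, fun z hz => ?_⟩
    rw [hq 0 (Nat.zero_le _)]
    have := mul_nonneg h0 hz.1
    simp only [Nat.cast_zero, zero_div]
    linarith
  by_cases h1 : g (q m) ≤ 0
  · refine ⟨q m, q m, 1, by simp, fun z hz => ?_⟩
    rw [hq m le_rfl, div_self hm'.ne']
    have := mul_nonneg (neg_nonneg.2 h1) (sub_nonneg.2 hz.2)
    linarith
  push Not at h0 h1
  -- Otherwise `g` passes from negative to nonnegative between two neighbouring grid points.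
  obtain ⟨k, hkm, hk, hk1⟩ : ∃ k, k < m ∧ g (q k) < 0 ∧ 0 ≤ g (q (k + 1)) := by
    by_contra hcon
    push Not at hcon
    have : ∀ k ≤ m, g (q k) < 0 := by
      intro k
      induction k with
      | zero => exact fun _ => h0
      | succ k ih => exact fun hk => hcon k hk (ih (by omega))
    linarith [this m le_rfl]
  set a := - g (q k) with ha
  set b := g (q (k + 1)) with hb
  have hab : 0 < a + b := by linarith
  -- These weights make the mean of `g` zero, so `z` cancels. What remains is a fraction of `b`
  -- times the mesh.
  refine ⟨q (k + 1), q k, a / (a + b), ⟨div_nonneg (by linarith) hab.le,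
    (div_le_one hab).2 (by linarith)⟩, fun z _ => ?_⟩
  have hgk : g (q k) = - a := by rw [ha, neg_neg]
  rw [hq _ hkm.le, hq _ hkm, ← hb, hgk]
  have e : a / (a + b) * (b * (((k + 1 : ℕ) : ℝ) / m - z)) +
      (1 - a / (a + b)) * (-a * ((k : ℝ) / m - z)) = a / (a + b) * (b / m) := by
    push_cast
    field_simp
    ring
  rw [e]
  have hbB : b ≤ B := (le_abs_self _).trans (hg _)
  refine (mul_le_of_le_one_left (by positivity) ((div_le_one hab).2 (by linarith))).trans ?_
  gcongr

/-- The mixture of `exists_calibrating_mixture` as a distribution of forecasts. -/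
theorem exists_calibrating_pmf (g : stdSimplex ℝ (Fin 2) → ℝ) {B : ℝ} (hg : ∀ q, |g q| ≤ B)
    {m : ℕ} (hm : 0 < m) :
    ∃ μ : PMF (stdSimplex ℝ (Fin 2)), ∀ z ∈ Set.Icc (0 : ℝ) 1, ∀ (h : stdSimplex ℝ (Fin 2) → ℝ)
      (c : ℝ), (∀ q, 0 ≤ h q) → (∀ q, h q ≤ c + g q * (q 1 - z)) →
      ∑' q, μ q * ENNReal.ofReal (h q) ≤ ENNReal.ofReal (c + B / m) := by
  obtain ⟨q₁, q₂, θ, ⟨hθ0, hθ1⟩, hmix⟩ := exists_calibrating_mixture g hg hm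
  have hsum : ∑ b : Bool, (bif b then ENNReal.ofReal θ else ENNReal.ofReal (1 - θ)) = 1 := by
    rw [Fintype.sum_bool]
    simp only [cond_true, cond_false]
    rw [← ENNReal.ofReal_add hθ0 (by linarith)]
    simp
  refine ⟨(PMF.ofFintype _ hsum).map fun b => bif b then q₁ else q₂, fun z hz h c h0 hc => ?_⟩
  rw [PMF.tsum_map_mul, tsum_fintype, Fintype.sum_bool]
  simp only [PMF.ofFintype_apply, cond_true, cond_false]
  rw [← ENNReal.ofReal_mul hθ0, ← ENNReal.ofReal_mul (by linarith),
    ← ENNReal.ofReal_add (mul_nonneg hθ0 (h0 _)) (mul_nonneg (by linarith) (h0 _))]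
  refine ENNReal.ofReal_le_ofReal ?_
  have h1 := mul_le_mul_of_nonneg_left (hc q₁) hθ0
  have h2 := mul_le_mul_of_nonneg_left (hc q₂) (sub_nonneg.2 hθ1)
  have h3 := hmix z hz
  linarith

/-- From `exp x ≤ 1 + x + x²` and `1 + 2x² ≤ exp (2x²)`, it remains to see that `(1 + x)(1 + 2x²) -
(1 + x + x²) = x²(1 + 2x)` is nonnegative. This is where `x ≥ -1/2` is needed. -/
theorem exp_sub_two_mul_sq_le {x : ℝ} (hx : -(1 / 2) ≤ x) (hx' : x ≤ 1) :
    Real.exp (x - 2 * x ^ 2) ≤ 1 + x := by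
  have h1 := (abs_le.1 (Real.abs_exp_sub_one_sub_id_le (x := x)
    (abs_le.2 ⟨by linarith, hx'⟩))).2
  have h2 := Real.add_one_le_exp (2 * x ^ 2)
  rw [Real.exp_sub, div_le_iff₀ (Real.exp_pos _)]
  have h3 : (1 + x) * (2 * x ^ 2 + 1) ≤ (1 + x) * Real.exp (2 * x ^ 2) :=
    mul_le_mul_of_nonneg_left h2 (by linarith)
  nlinarith [mul_nonneg (sq_nonneg x) (show 0 ≤ 1 + 2 * x by linarith)]

/-- The indicator of state `1`. -/
def stateOne (y : Fin 2) : ℝ := if y = 1 then 1 else 0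

theorem stateOne_mem_Icc (y : Fin 2) : stateOne y ∈ Set.Icc (0 : ℝ) 1 := by
  unfold stateOne; split_ifs <;> simp

open Classical in
/-- Bias of forecasts of state `1` on the event `E`. -/
noncomputable def biasOne (E : Set (stdSimplex ℝ (Fin 2))) {t : ℕ} (y : Fin t → Fin 2)
    (π : Fin t → stdSimplex ℝ (Fin 2)) : ℝ :=
  ∑ s, if π s ∈ E then π s 1 - stateOne (y s) else 0

open Classical in
/-- The number of forecasts in the event `E`. -/
noncomputable def visits (E : Set (stdSimplex ℝ (Fin 2))) {t : ℕ}
    (π : Fin t → stdSimplex ℝ (Fin 2)) : ℝ :=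
  ∑ s, if π s ∈ E then 1 else 0

variable {J : Type*} [Fintype J]

/-- The exponential potential of the biases on the events `E j` at the learning rates `l j`. -/
noncomputable def potential (E : J → Set (stdSimplex ℝ (Fin 2))) (l : J → ℝ) {t : ℕ}
    (y : Fin t → Fin 2) (π : Fin t → stdSimplex ℝ (Fin 2)) : ℝ :=
  ∑ j, Real.exp (l j * biasOne (E j) y π - 2 * l j ^ 2 * visits (E j) π)

theorem potential_nonneg (E : J → Set (stdSimplex ℝ (Fin 2))) (l : J → ℝ) {t : ℕ}
    (y : Fin t → Fin 2) (π : Fin t → stdSimplex ℝ (Fin 2)) : 0 ≤ potential E l y π :=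
  Finset.sum_nonneg fun _ _ => (Real.exp_pos _).le

open Classical in
-- The penalty `2 l²` for each visit absorbs the second order term of the exponential, so a round
-- adds at most an amount linear in `q₁ - y`. Its coefficient is known before the state is revealed.
theorem potential_snoc_le (E : J → Set (stdSimplex ℝ (Fin 2))) {l : J → ℝ}
    (hl : ∀ j, |l j| ≤ 1 / 2) {t : ℕ} (y : Fin (t + 1) → Fin 2)
    (π : Fin t → stdSimplex ℝ (Fin 2)) (q : stdSimplex ℝ (Fin 2)) :
    potential E l y (Fin.snoc (α := fun _ => stdSimplex ℝ (Fin 2)) π q) ≤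
      potential E l (fun i => y i.castSucc) π +
        (∑ j, Real.exp (l j * biasOne (E j) (fun i => y i.castSucc) π -
          2 * l j ^ 2 * visits (E j) π) * if q ∈ E j then l j else 0) *
        (q 1 - stateOne (y (Fin.last t))) := by
  unfold potential
  rw [Finset.sum_mul, ← Finset.sum_add_distrib]
  refine Finset.sum_le_sum fun j _ => ?_
  have e1 : biasOne (E j) y (Fin.snoc (α := fun _ => stdSimplex ℝ (Fin 2)) π q) =
      biasOne (E j) (fun i => y i.castSucc) π +
        if q ∈ E j then q 1 - stateOne (y (Fin.last t)) else 0 := by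
    simp [biasOne, Fin.sum_univ_castSucc]
  have e2 : visits (E j) (Fin.snoc (α := fun _ => stdSimplex ℝ (Fin 2)) π q) =
      visits (E j) π + if q ∈ E j then 1 else 0 := by
    simp [visits, Fin.sum_univ_castSucc, -Finset.sum_boole]
  rw [e1, e2]
  set w := l j * biasOne (E j) (fun i => y i.castSucc) π - 2 * l j ^ 2 * visits (E j) π with hw
  split_ifs with h
  · set d := q 1 - stateOne (y (Fin.last t)) with hd
    have hq0 : 0 ≤ q 1 := q.2.1 1
    have hq1 : q 1 ≤ 1 := stdSimplex.le_one q 1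
    have hz := stateOne_mem_Icc (y (Fin.last t))
    have hd1 : |d| ≤ 1 := abs_le.2 ⟨by linarith [hz.2], by linarith [hz.1]⟩
    have hx : |l j * d| ≤ 1 / 2 := by
      rw [abs_mul]
      nlinarith [abs_nonneg (l j), abs_nonneg d, hl j]
    obtain ⟨hx1, hx2⟩ := abs_le.1 hx
    have hsq : (l j * d) ^ 2 ≤ l j ^ 2 := by
      rw [mul_pow]
      exact mul_le_of_le_one_right (sq_nonneg _) ((sq_le_one_iff_abs_le_one d).2 hd1)
    have : l j * (biasOne (E j) (fun i => y i.castSucc) π + d) -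
        2 * l j ^ 2 * (visits (E j) π + 1) = w + (l j * d - 2 * l j ^ 2) := by rw [hw]; ring
    rw [this, Real.exp_add]
    have h3 : Real.exp (l j * d - 2 * l j ^ 2) ≤ 1 + l j * d :=
      (Real.exp_le_exp.2 (by linarith)).trans (exp_sub_two_mul_sq_le hx1 (by linarith))
    have := mul_le_mul_of_nonneg_left h3 (Real.exp_pos w).le
    linarith
  · simp [hw]

/-- Some forecasting algorithm keeps the expected potential bounded, whatever the states. -/
theorem exists_forecaster_potential_le (E : J → Set (stdSimplex ℝ (Fin 2))) {l : J → ℝ}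
    (hl : ∀ j, |l j| ≤ 1 / 2) {m : ℕ} (hm : 0 < m) :
    ∃ F : Forecaster (Fin 2), ∀ (y : ℕ → Fin 2) (t : ℕ),
      ∑' π, forecastLaw F y t π * ENNReal.ofReal (potential E l (fun i => y i) π) ≤
        ENNReal.ofReal (Fintype.card J * (1 + 1 / (m : ℝ)) ^ t) := by
  classical
  -- The coefficient is bounded by the potential itself, so the error of the mixture is a relative
  -- growth of `1/m` per round.
  have hg : ∀ (t : ℕ) (y : Fin t → Fin 2) (π : Fin t → stdSimplex ℝ (Fin 2))
      (q : stdSimplex ℝ (Fin 2)),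
      |∑ j, Real.exp (l j * biasOne (E j) y π - 2 * l j ^ 2 * visits (E j) π) *
        if q ∈ E j then l j else 0| ≤ potential E l y π := by
    intro t y π q
    refine (Finset.abs_sum_le_sum_abs _ _).trans (Finset.sum_le_sum fun j _ => ?_)
    rw [abs_mul, abs_of_pos (Real.exp_pos _)]
    refine mul_le_of_le_one_right (Real.exp_pos _).le ?_
    split_ifs
    · linarith [hl j]
    · simp
  choose F hF using fun (t : ℕ) (y : Fin t → Fin 2) (π : Fin t → stdSimplex ℝ (Fin 2)) =>
    exists_calibrating_pmf _ (hg t y π) hm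
  refine ⟨F, fun y t => ?_⟩
  induction t with
  | zero =>
    simp only [forecastLaw]
    rw [PMF.tsum_pure_mul]
    simp [potential, biasOne, visits]
  | succ t ih =>
    simp only [forecastLaw]
    rw [PMF.tsum_bind_mul]
    simp only [PMF.tsum_map_mul]
    have step : ∀ π : Fin t → stdSimplex ℝ (Fin 2),
        ∑' q, F t (fun i => y i) π q * ENNReal.ofReal (potential E l (fun i : Fin (t + 1) => y i)
          (Fin.snoc (α := fun _ => stdSimplex ℝ (Fin 2)) π q)) ≤
        ENNReal.ofReal (potential E l (fun i : Fin t => y i) π) *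
          ENNReal.ofReal (1 + 1 / (m : ℝ)) := by
      intro π
      refine (hF t (fun i => y i) π (stateOne (y t)) (stateOne_mem_Icc _) _
        (potential E l (fun i : Fin t => y i) π) (fun q => potential_nonneg _ _ _ _)
        fun q => ?_).trans ?_
      · exact potential_snoc_le E hl (fun i : Fin (t + 1) => y i) π q
      · rw [← ENNReal.ofReal_mul (potential_nonneg _ _ _ _)]
        refine ENNReal.ofReal_le_ofReal (le_of_eq ?_)
        ring
    calc _ ≤ ∑' π, forecastLaw F y t π * (ENNReal.ofReal (potential E l (fun i : Fin t => y i) π) *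
          ENNReal.ofReal (1 + 1 / (m : ℝ))) :=
          ENNReal.tsum_le_tsum fun π => mul_le_mul_right (step π) _
      _ = (∑' π, forecastLaw F y t π * ENNReal.ofReal (potential E l (fun i : Fin t => y i) π)) *
          ENNReal.ofReal (1 + 1 / (m : ℝ)) := by
          rw [← ENNReal.tsum_mul_right]
          exact tsum_congr fun π => (mul_assoc _ _ _).symm
      _ ≤ ENNReal.ofReal (Fintype.card J * (1 + 1 / (m : ℝ)) ^ t) *
          ENNReal.ofReal (1 + 1 / (m : ℝ)) := mul_le_mul_left ih _
      _ = _ := by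
          rw [← ENNReal.ofReal_mul (by positivity), pow_succ, mul_assoc]

theorem visits_nonneg (E : Set (stdSimplex ℝ (Fin 2))) {t : ℕ}
    (π : Fin t → stdSimplex ℝ (Fin 2)) : 0 ≤ visits E π := by
  classical
  exact Finset.sum_nonneg fun s _ => by split_ifs <;> simp

theorem abs_biasOne_le_visits (E : Set (stdSimplex ℝ (Fin 2))) {t : ℕ} (y : Fin t → Fin 2)
    (π : Fin t → stdSimplex ℝ (Fin 2)) : |biasOne E y π| ≤ visits E π := by
  classical
  refine (Finset.abs_sum_le_sum_abs _ _).trans (Finset.sum_le_sum fun s _ => ?_)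
  have hq0 : 0 ≤ π s 1 := (π s).2.1 1
  have hq1 : π s 1 ≤ 1 := stdSimplex.le_one (π s) 1
  have hz := stateOne_mem_Icc (y s)
  split_ifs
  · exact abs_le.2 ⟨by linarith [hz.2], by linarith [hz.1]⟩
  · simp

/-- If the potential controls the bias at every learning rate, the bias is of the order of the
square root of the number of visits. -/
theorem abs_bias_le_of_forall_rate {b n ℓ Φ : ℝ} {N T : ℕ} (hN : n = N) (hNT : N ≤ T) (hℓ : 1 ≤ ℓ)
    (hΦ : 0 ≤ Φ) (hb : |b| ≤ n)
    (h : ∀ j : Fin T, Real.exp (min (1 / 2) √(ℓ / (j + 1 : ℝ)) * |b| -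
      2 * min (1 / 2) √(ℓ / (j + 1 : ℝ)) ^ 2 * n) ≤ Φ) :
    |b| ≤ 4 * √(ℓ * n) + √T * (Φ * Real.exp (-(2 * ℓ))) := by
  have hn0 : 0 ≤ n := (abs_nonneg b).trans hb
  have hlast : 0 ≤ √T * (Φ * Real.exp (-(2 * ℓ))) := by positivity
  rcases lt_or_ge n (4 * ℓ) with hlt | hge
  -- With few visits the trivial bound `|b| ≤ n` is enough.
  · have : n ≤ 4 * √(ℓ * n) := by
      have h1 : n / 2 ≤ √(ℓ * n) := Real.le_sqrt_of_sq_le (by nlinarith)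
      linarith
    linarith
  · have hnpos : 0 < n := by linarith
    have hNpos : 0 < N := by rw [hN] at hnpos; exact_mod_cast hnpos
    set lam := √(ℓ / n) with hlam
    have hlampos : 0 < lam := Real.sqrt_pos.2 (by positivity)
    have hsq : lam ^ 2 = ℓ / n := Real.sq_sqrt (by positivity)
    have hhalf : lam ≤ 1 / 2 := by
      rw [hlam, Real.sqrt_le_left (by norm_num), div_le_iff₀ hnpos]; linarith
    -- The best rate `√(ℓ/n)` depends on the final number of visits, unknown in advance; it is among
    -- the rates because there is one for each possible number. The rate with index `j` belongs to
    -- `j + 1` visits.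
    have h1 := h ⟨N - 1, by omega⟩
    have hcast : (((⟨N - 1, by omega⟩ : Fin T) : ℕ) : ℝ) + 1 = n := by
      rw [hN, ← Nat.cast_succ]; congr 1; simp only [Nat.succ_eq_add_one]; omega
    rw [hcast, ← hlam, min_eq_right hhalf, hsq] at h1
    have hx : lam * |b| - 2 * (ℓ / n) * n = lam * |b| - 2 * ℓ := by field_simp
    rw [hx] at h1
    -- Using `x + 1 ≤ exp x` instead of a logarithm keeps the bound linear in `Φ`, so only the mean
    -- of `Φ` is needed later. The extra `-(2ℓ)` makes that term negligible.
    have h2 := Real.add_one_le_exp (lam * |b| - 2 * ℓ + -(2 * ℓ))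
    rw [Real.exp_add] at h2
    have h3 := mul_le_mul_of_nonneg_right h1 (Real.exp_pos (-(2 * ℓ))).le
    have h4 : lam * |b| ≤ 4 * ℓ + Φ * Real.exp (-(2 * ℓ)) := by linarith
    have hinv : lam * √(n / ℓ) = 1 := by
      rw [hlam, ← Real.sqrt_mul (by positivity)]
      have : ℓ / n * (n / ℓ) = 1 := by field_simp
      rw [this, Real.sqrt_one]
    have hs1 : √(n / ℓ) * ℓ = √(ℓ * n) := by
      have : ℓ * n = (n / ℓ) * ℓ ^ 2 := by field_simp
      rw [this, Real.sqrt_mul (by positivity), Real.sqrt_sq (by linarith)]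
    have hs2 : √(n / ℓ) ≤ √T := by
      refine Real.sqrt_le_sqrt ((div_le_self hn0 hℓ).trans ?_)
      rw [hN]; exact_mod_cast hNT
    calc |b| = √(n / ℓ) * (lam * |b|) := by
          rw [← mul_assoc, mul_comm √(n / ℓ) lam, hinv, one_mul]
      _ ≤ √(n / ℓ) * (4 * ℓ + Φ * Real.exp (-(2 * ℓ))) :=
          mul_le_mul_of_nonneg_left h4 (Real.sqrt_nonneg _)
      _ = 4 * (√(n / ℓ) * ℓ) + √(n / ℓ) * (Φ * Real.exp (-(2 * ℓ))) := by ring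
      _ ≤ _ := by
          rw [hs1]
          have : 0 ≤ Φ * Real.exp (-(2 * ℓ)) := by positivity
          gcongr

/-- With two states the coordinates of a forecast error are opposite, so its `ℓ¹` norm is twice the
error for state 1. -/
theorem sum_abs_bias_eq (E : Set (stdSimplex ℝ (Fin 2))) (y : ℕ → Fin 2) {T : ℕ}
    (π : Fin T → stdSimplex ℝ (Fin 2)) :
    StageGame.bias y π E = 2 * |biasOne E (fun i : Fin T => y i) π| := by
  classical
  have h1 : ∀ t, (if π t ∈ E then π t 1 - (if y t = 1 then 1 else 0) else 0) =
      if π t ∈ E then π t 1 - stateOne (y t) else (0 : ℝ) := fun t => by simp [stateOne]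
  have h0 : ∀ t, (if π t ∈ E then π t 0 - (if y t = 0 then 1 else 0) else 0) =
      - if π t ∈ E then π t 1 - stateOne (y t) else (0 : ℝ) := by
    intro t
    have hs : π t 0 + π t 1 = 1 := stdSimplex.add_eq_one (π t)
    have hy : (if y t = 0 then (1 : ℝ) else 0) = 1 - stateOne (y t) := by
      unfold stateOne
      rcases Fin.exists_fin_two.1 ⟨y t, rfl⟩ with h | h <;> simp [h]
    split_ifs at * <;> linarith
  have e0 : ∑ t, (if π t ∈ E then π t 0 - (if y t = 0 then 1 else 0) else (0 : ℝ)) =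
      - biasOne E (fun i : Fin T => y i) π := by
    simp only [h0, Finset.sum_neg_distrib]; rfl
  have e1 : ∑ t, (if π t ∈ E then π t 1 - (if y t = 1 then 1 else 0) else (0 : ℝ)) =
      biasOne E (fun i : Fin T => y i) π := by
    simp only [h1]; rfl
  rw [StageGame.bias, Fin.sum_univ_two]
  have c0 : |∑ t, (if π t ∈ E then π t 0 - (if y t = 0 then 1 else 0) else (0 : ℝ))| =
      |biasOne E (fun i : Fin T => y i) π| := by rw [e0, abs_neg]
  have c1 : |∑ t, (if π t ∈ E then π t 1 - (if y t = 1 then 1 else 0) else (0 : ℝ))| =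
      |biasOne E (fun i : Fin T => y i) π| := by rw [e1]
  rw [two_mul]
  refine congrArg₂ _ (Eq.trans ?_ c0) (Eq.trans ?_ c1)
  · exact congrArg abs (Finset.sum_congr rfl fun t _ => by congr)
  · exact congrArg abs (Finset.sum_congr rfl fun t _ => by congr)

/-- Every finite family of events admits a forecasting algorithm of low bias. -/
theorem exists_hasLowBias {ι : Type*} [Fintype ι] [Nonempty ι]
    (𝓔 : ι → Set (stdSimplex ℝ (Fin 2))) {T : ℕ} (hT : 2 ≤ T) :
    ∃ F : Forecaster (Fin 2), HasLowBias F 𝓔 T 4 := by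
  classical
  have hT0 : (0 : ℝ) < T := by positivity
  have hT2 : (2 : ℝ) ≤ T := by exact_mod_cast hT
  set M : ℝ := (Fintype.card (Fin 2) : ℝ) * (Fintype.card ι : ℝ) * (T : ℝ) with hM
  have hι : (1 : ℝ) ≤ Fintype.card ι := by exact_mod_cast Fintype.card_pos (α := ι)
  have hM4 : 4 ≤ M := by
    rw [hM, Fintype.card_fin]; push_cast; nlinarith
  set ℓ := Real.log M with hℓdef
  have hℓ : 1 ≤ ℓ := by
    have h1 : Real.log 4 ≤ ℓ := Real.log_le_log (by norm_num) hM4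
    have h2 : Real.log 4 = 2 * Real.log 2 := by
      rw [show (4 : ℝ) = 2 ^ 2 by norm_num, Real.log_pow]; norm_num
    linarith [Real.log_two_gt_d9]
  -- One rate per possible number of visits, capped at `1/2` to stay in the range of
  -- `exp_sub_two_mul_sq_le`.
  set lam : Fin T → ℝ := fun j => min (1 / 2) √(ℓ / (j + 1 : ℝ)) with hlam
  have hlam0 : ∀ j, 0 ≤ lam j := fun j => le_min (by norm_num) (Real.sqrt_nonneg _)
  set l : ι × Bool × Fin T → ℝ := fun x => (bif x.2.1 then 1 else -1) * lam x.2.2 with hl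
  have hlhalf : ∀ x, |l x| ≤ 1 / 2 := by
    rintro ⟨i, s, j⟩
    have : |l (i, s, j)| = lam j := by
      cases s <;> simp [hl, abs_of_nonneg (hlam0 j)]
    rw [this]
    exact min_le_left _ _
  -- With mesh `1/T` the potential grows by a factor of at most `(1 + 1/T)^T ≤ e` over all rounds.
  obtain ⟨F, hF⟩ := exists_forecaster_potential_le (fun x : ι × Bool × Fin T => 𝓔 x.1) hlhalf
    (m := T) (by omega)
  refine ⟨F, fun y i => ?_⟩
  set μ := forecastLaw F y T
  set Φ : (Fin T → stdSimplex ℝ (Fin 2)) → ℝ :=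
    potential (fun x : ι × Bool × Fin T => 𝓔 x.1) l (fun i : Fin T => y i)
  have hΦ0 : ∀ π, 0 ≤ Φ π := potential_nonneg _ _ _
  have hvis : ∀ π : Fin T → stdSimplex ℝ (Fin 2),
      visits (𝓔 i) π = ((Finset.univ.filter fun t : Fin T => π t ∈ 𝓔 i).card : ℝ) := fun π => by
    rw [visits, Finset.sum_boole]
  have hcardT : ∀ π : Fin T → stdSimplex ℝ (Fin 2),
      (Finset.univ.filter fun t : Fin T => π t ∈ 𝓔 i).card ≤ T := fun π =>
    (Finset.card_filter_le _ _).trans (by simp)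
  have hrate : ∀ π (j : Fin T), Real.exp (lam j * |biasOne (𝓔 i) (fun i : Fin T => y i) π| -
      2 * lam j ^ 2 * visits (𝓔 i) π) ≤ Φ π := by
    intro π j
    have single := fun s : Bool => Finset.single_le_sum
      (f := fun x : ι × Bool × Fin T => Real.exp (l x * biasOne (𝓔 x.1) (fun i : Fin T => y i) π -
        2 * l x ^ 2 * visits (𝓔 x.1) π)) (fun _ _ => (Real.exp_pos _).le)
      (Finset.mem_univ (i, s, j))
    rcases abs_cases (biasOne (𝓔 i) (fun i : Fin T => y i) π) with ⟨h, _⟩ | ⟨h, _⟩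
    · refine le_trans (le_of_eq ?_) (single true)
      simp [hl, h]
    · refine le_trans (le_of_eq ?_) (single false)
      simp [hl, h]
  have point : ∀ π, |biasOne (𝓔 i) (fun i : Fin T => y i) π| ≤
      4 * √(ℓ * visits (𝓔 i) π) + √T * (Φ π * Real.exp (-(2 * ℓ))) := fun π =>
    abs_bias_le_of_forall_rate (hvis π) (hcardT π) hℓ (hΦ0 π) (abs_biasOne_le_visits _ _ _)
      (hrate π)
  -- The number of potential terms is exactly the argument of the logarithm in `ℓ`. So the mean of
  -- `Φ` is at most `3M`, while `exp (-(2ℓ)) = M⁻²`.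
  have hcardJ : (Fintype.card (ι × Bool × Fin T) : ℝ) = M := by
    rw [hM]; simp; ring
  have hEΦ : expect μ Φ ≤ 3 * M := by
    rw [expect_eq_toReal μ hΦ0]
    refine ENNReal.toReal_le_of_le_ofReal (by positivity) ((hF y T).trans
      (ENNReal.ofReal_le_ofReal ?_))
    rw [hcardJ, mul_comm]
    refine mul_le_mul_of_nonneg_right ?_ (by positivity)
    calc (1 + 1 / (T : ℝ)) ^ T ≤ (Real.exp (1 / T)) ^ T := by
          refine pow_le_pow_left₀ (by positivity) ?_ _
          rw [add_comm]; exact Real.add_one_le_exp _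
      _ = Real.exp 1 := by rw [← Real.exp_nat_mul]; congr 1; field_simp
      _ ≤ 3 := by linarith [Real.exp_one_lt_d9]
  have hexp : Real.exp (-(2 * ℓ)) = 1 / M ^ 2 := by
    rw [Real.exp_neg, two_mul, Real.exp_add, hℓdef, Real.exp_log (by linarith), sq, one_div]
  have bddΦ : ∃ K, ∀ π, |Φ π| ≤ K := by
    refine ⟨∑ x : ι × Bool × Fin T, Real.exp (1 / 2 * T), fun π => ?_⟩
    rw [abs_of_nonneg (hΦ0 π)]
    refine Finset.sum_le_sum fun x _ => Real.exp_le_exp.2 ?_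
    have h1 := abs_biasOne_le_visits (𝓔 x.1) (fun i : Fin T => y i) π
    have h2 : visits (𝓔 x.1) π ≤ T := by
      rw [visits, Finset.sum_boole]
      exact_mod_cast (Finset.card_filter_le _ _).trans (by simp)
    have h3 : l x * biasOne (𝓔 x.1) (fun i : Fin T => y i) π ≤ 1 / 2 * T :=
      (le_abs_self _).trans (by
        rw [abs_mul]
        exact mul_le_mul (hlhalf x) (h1.trans h2) (abs_nonneg _) (by norm_num))
    have h4 : 0 ≤ 2 * l x ^ 2 * visits (𝓔 x.1) π :=
      mul_nonneg (by positivity) (visits_nonneg _ _)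
    linarith
  have bddsqrt : ∃ K, ∀ π : Fin T → stdSimplex ℝ (Fin 2), |√(ℓ * visits (𝓔 i) π)| ≤ K := by
    refine ⟨√(ℓ * T), fun π => ?_⟩
    rw [abs_of_nonneg (Real.sqrt_nonneg _)]
    refine Real.sqrt_le_sqrt (mul_le_mul_of_nonneg_left ?_ (by linarith))
    rw [hvis]; exact_mod_cast hcardT π
  have bddbias := StageGame.bias_bounded y T (𝓔 i)
  have main : expect μ (fun π => StageGame.bias y π (𝓔 i)) ≤
      8 * expect μ (fun π => √(ℓ * visits (𝓔 i) π)) + 8 * ℓ := by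
    have h1 := expect_mono_on_support μ bddbias (bounded_add (bounded_const_mul 8 bddsqrt)
      (bounded_const_mul (2 * √T * Real.exp (-(2 * ℓ))) bddΦ)) fun π _ => by
        rw [sum_abs_bias_eq]
        linarith [point π]
    rw [expect_add μ (bounded_const_mul 8 bddsqrt) (bounded_const_mul _ bddΦ), expect_const_mul,
      expect_const_mul, hexp] at h1
    have h2 := mul_le_mul_of_nonneg_left hEΦ (show 0 ≤ 2 * √T * (1 / M ^ 2) by positivity)
    have h3 : 2 * √T * (1 / M ^ 2) * (3 * M) = 6 * √T / M := by field_simp; norm_num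
    have h4 : √T ≤ M := by
      have : √T ≤ T := Real.sqrt_le_left (by positivity) |>.2 (by nlinarith)
      refine this.trans ?_
      rw [hM, Fintype.card_fin]; push_cast; nlinarith
    have h5 : 6 * √T / M ≤ 6 := by rw [div_le_iff₀ (by linarith)]; linarith
    linarith
  change expect μ (fun π => (1 / (T : ℝ)) * StageGame.bias y π (𝓔 i)) ≤ _
  rw [expect_const_mul]
  have hr : expect μ (fun π => 4 * ((Fintype.card (Fin 2) : ℝ) * ℓ / T +
        (Fintype.card (Fin 2) : ℝ) *
          √(ℓ * ((Finset.univ.filter fun t : Fin T => π t ∈ 𝓔 i).card : ℝ)) / T)) =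
      8 * ℓ / T + 8 / T * expect μ (fun π => √(ℓ * visits (𝓔 i) π)) := by
    rw [← expect_const μ (8 * ℓ / T), ← expect_const_mul μ (8 / T),
      ← expect_add μ (bounded_const _) (bounded_const_mul _ bddsqrt)]
    refine congrArg _ (funext fun π => ?_)
    rw [← hvis π, Fintype.card_fin]
    push_cast
    ring
  refine le_trans ?_ hr.ge
  rw [one_div, inv_mul_le_iff₀ hT0]
  refine main.trans_eq ?_
  field_simp
  ring

end Forecasts

/-! ## Optimal stable policies in binary-state persuasion -/

section Trim

/-- Here `(α, β)` is the unnormalized belief of a signal, and `d₀ k`, `d₁ k` are the advantages of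
its strategy over the rival `k` in the two states. A violated constraint with `d₀ > 0 > d₁` says
that state 1 has too much mass. Reducing that mass until the tightest such constraint binds does not
overshoot: the margin belief satisfies this constraint as well, so its share of state 1 is no
larger, and the opposite constraints, which hold there, only profit from more of state 1. -/
theorem exists_trim_of_violated {K : Type*} [Finite K] {d₀ d₁ : K → ℝ} {C τ : ℝ} (hτ : 0 ≤ τ)
    (hτC : τ < C)
    (hsign : ∀ k, (C ≤ d₀ k ∧ d₁ k ≤ -C) ∨ (d₀ k ≤ -C ∧ C ≤ d₁ k)) {m₀ m₁ : ℝ}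
    (hm₁ : 0 ≤ m₁) (hm : m₀ + m₁ = 1) (hmC : ∀ k, C ≤ m₀ * d₀ k + m₁ * d₁ k)
    {α β g : ℝ} (hα : 0 ≤ α) (hg : ∀ k, -(α * d₀ k + β * d₁ k) ≤ g)
    {k₀ : K} (hk₀ : C ≤ d₀ k₀) (hk₀' : α * d₀ k₀ + β * d₁ k₀ < τ * (α + β)) :
    ∃ b, 0 ≤ b ∧ b ≤ β ∧ (∀ k, τ * (α + b) ≤ α * d₀ k + b * d₁ k) ∧
      C * (β - b) ≤ τ * (α + β) + g := by
  have hneg : ∀ k, C ≤ d₀ k → d₁ k ≤ -C := fun k hk => by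
    rcases hsign k with h | h
    · exact h.2
    · linarith [h.1]
  obtain ⟨k, hkC, hkmin⟩ := Set.exists_min_image {k | C ≤ d₀ k}
    (fun k => (d₀ k - τ) / (τ - d₁ k)) (Set.toFinite _) ⟨k₀, hk₀⟩
  have hkC : C ≤ d₀ k := hkC
  have hk1 := hneg k hkC
  set ρ := (d₀ k - τ) / (τ - d₁ k) with hρ
  have hden : 0 < τ - d₁ k := by linarith
  have hρ0 : 0 ≤ ρ := div_nonneg (by linarith) hden.le
  have hρmul : ρ * (τ - d₁ k) = d₀ k - τ := div_mul_cancel₀ _ hden.ne'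
  have hupper : ∀ k', C ≤ d₀ k' → ρ * (τ - d₁ k') ≤ d₀ k' - τ := fun k' hk' =>
    (le_div_iff₀ (by linarith [hneg k' hk'])).1 (hkmin k' hk')
  have hbβ : α * ρ ≤ β := by
    have h1 := mul_le_mul_of_nonneg_left (hupper k₀ hk₀) hα
    have h2 : 0 < τ - d₁ k₀ := by linarith [hneg k₀ hk₀]
    by_contra hcon
    push Not at hcon
    nlinarith [mul_lt_mul_of_pos_right hcon h2]
  refine ⟨α * ρ, by positivity, hbβ, fun k' => ?_, ?_⟩
  · rcases hsign k' with h | h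
    · have := mul_le_mul_of_nonneg_left (hupper k' h.1) hα
      linarith
    · have hm₀ : 0 < m₀ := by
        by_contra hcon
        push Not at hcon
        have := hmC k
        nlinarith
      have hmk := hmC k
      have hratio : m₁ ≤ m₀ * ρ := by
        have : m₁ * (τ - d₁ k) ≤ m₀ * ρ * (τ - d₁ k) := by
          rw [mul_assoc, hρmul]; nlinarith
        exact le_of_mul_le_mul_right this hden
      have h1 := hmC k'
      have h2 : 0 ≤ m₀ * (d₀ k' - τ) + m₁ * (d₁ k' - τ) := by nlinarith
      have h3 : m₁ * (d₁ k' - τ) ≤ m₀ * ρ * (d₁ k' - τ) :=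
        mul_le_mul_of_nonneg_right hratio (by linarith)
      have h4 : 0 ≤ m₀ * ((d₀ k' - τ) + ρ * (d₁ k' - τ)) := by linarith
      have h5 := mul_nonneg hα (nonneg_of_mul_nonneg_right h4 hm₀)
      linarith
  -- The constraint of `k` binds at `αρ`, so the removed mass times the slope `τ - d₁ k ≥ C` equals
  -- the shortfall at `(α, β)`.
  · have h1 : (τ - d₁ k) * (β - α * ρ) = τ * (α + β) - (α * d₀ k + β * d₁ k) := by
      linear_combination -α * hρmul
    have h2 : C * (β - α * ρ) ≤ (τ - d₁ k) * (β - α * ρ) :=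
      mul_le_mul_of_nonneg_right (by linarith) (by linarith)
    linarith [hg k]

/-- Any violated constraint tells which state has too much mass. The two cases are exchanged by
swapping the states. -/
theorem exists_trim {K : Type*} [Finite K] {d₀ d₁ : K → ℝ} {C τ : ℝ} (hτ : 0 ≤ τ)
    (hτC : τ < C)
    (hsign : ∀ k, (C ≤ d₀ k ∧ d₁ k ≤ -C) ∨ (d₀ k ≤ -C ∧ C ≤ d₁ k)) {m₀ m₁ : ℝ} (hm₀ : 0 ≤ m₀)
    (hm₁ : 0 ≤ m₁) (hm : m₀ + m₁ = 1) (hmC : ∀ k, C ≤ m₀ * d₀ k + m₁ * d₁ k)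
    {α β g : ℝ} (hα : 0 ≤ α) (hβ : 0 ≤ β) (hg0 : 0 ≤ g)
    (hg : ∀ k, -(α * d₀ k + β * d₁ k) ≤ g) :
    ∃ a b, 0 ≤ a ∧ a ≤ α ∧ 0 ≤ b ∧ b ≤ β ∧ (∀ k, τ * (a + b) ≤ a * d₀ k + b * d₁ k) ∧
      C * (α + β - (a + b)) ≤ τ * (α + β) + g := by
  by_cases hall : ∀ k, τ * (α + β) ≤ α * d₀ k + β * d₁ k
  · exact ⟨α, β, hα, le_rfl, hβ, le_rfl, hall, by rw [sub_self, mul_zero]; positivity⟩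
  push Not at hall
  obtain ⟨k₀, hk₀⟩ := hall
  rcases hsign k₀ with h | h
  · obtain ⟨b, h1, h2, h3, h4⟩ := exists_trim_of_violated hτ hτC hsign hm₁ hm hmC hα hg h.1 hk₀
    exact ⟨α, b, hα, le_rfl, h1, h2, h3, by linarith⟩
  · obtain ⟨a, h1, h2, h3, h4⟩ := exists_trim_of_violated (d₀ := d₁) (d₁ := d₀) (m₀ := m₁) (m₁ := m₀) hτ hτC
      (fun k => (hsign k).symm.imp And.symm And.symm) hm₀ (by linarith)
      (fun k => by linarith [hmC k]) hβ (g := g) (β := α)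
      (fun k => by linarith [hg k]) h.2 (by linarith)
    exact ⟨a, β, h1, h2, hβ, le_rfl, fun k => by linarith [h3 k], by linarith⟩

end Trim

/-! ### Reduction to two signals. -/

section Caratheodory

/-- Carathéodory's theorem for cones in the plane, with an objective: a nonnegative combination can
be replaced by one of at most two of its vectors, without lowering the objective. -/
theorem exists_pair_combination {S : Type*} [Fintype S] [Nonempty S] {z : S → Fin 2 → ℝ}
    (hz : ∀ s y, 0 ≤ z s y) {f : S → ℝ} (hf : ∀ s, z s = 0 → f s = 0) :
    ∃ i j : S, ∃ a b : ℝ, 0 ≤ a ∧ 0 ≤ b ∧ a • z i + b • z j = ∑ s, z s ∧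
      ∑ s, f s ≤ a * f i + b * f j := by
  classical
  let good : (S → ℝ) → Prop := fun w =>
    (∀ s, 0 ≤ w s) ∧ ∑ s, w s • z s = ∑ s, z s ∧ ∑ s, f s ≤ ∑ s, w s * f s
  let supp : (S → ℝ) → Finset S := fun w => Finset.univ.filter fun s => w s ≠ 0
  have hex : ∃ n w, good w ∧ (supp w).card = n :=
    ⟨_, fun _ => 1, ⟨fun _ => zero_le_one, by simp, by simp⟩, rfl⟩
  obtain ⟨w, hw, hcard⟩ := Nat.find_spec hex
  have hmin : ∀ w', good w' → (supp w).card ≤ (supp w').card := fun w' hw' => by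
    rw [hcard]; exact Nat.find_min' hex ⟨w', hw', rfl⟩
  -- The support of `w` has minimal size, so an admissible vector supported inside it cannot vanish
  -- at any of its points.
  have hdrop : ∀ w', good w' → (∀ s, w s = 0 → w' s = 0) → ∀ s, w s ≠ 0 → w' s ≠ 0 := by
    intro w' hw' hsub s hs hs'
    refine absurd (hmin w' hw') (not_le.2 (Finset.card_lt_card ?_))
    refine Finset.ssubset_iff_of_subset (fun r hr => ?_) |>.2 ⟨s, by simp [supp, hs], by simp [supp, hs']⟩
    simp only [supp, Finset.mem_filter, Finset.mem_univ, true_and] at hr ⊢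
    exact fun h => hr (hsub r h)
  have hnz : ∀ s, w s ≠ 0 → z s ≠ 0 := by
    intro s hs hzs
    refine hdrop (Function.update w s 0) ⟨fun r => ?_, ?_, ?_⟩ (fun r hr => ?_) s hs (by simp)
    · rcases eq_or_ne r s with rfl | h
      · simp
      · simpa [h] using hw.1 r
    · rw [← hw.2.1]
      refine Finset.sum_congr rfl fun r _ => ?_
      rcases eq_or_ne r s with rfl | h
      · simp [hzs]
      · simp [h]
    · refine hw.2.2.trans_eq (Finset.sum_congr rfl fun r _ => ?_)
      rcases eq_or_ne r s with rfl | h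
      · simp [hf r hzs]
      · simp [h]
    · rcases eq_or_ne r s with rfl | h
      · simp
      · simpa [h] using hr
  have hle : (supp w).card ≤ 2 := by
    by_contra hcon
    push Not at hcon
    have hdep : ¬ LinearIndependent ℝ fun s : supp w => z s := fun h => by
      have := h.fintype_card_le_finrank
      simp at this
      omega
    obtain ⟨g, hg, s₀, hs₀⟩ := Fintype.not_linearIndependent_iff.1 hdep
    let η₀ : S → ℝ := fun s => if h : s ∈ supp w then g ⟨s, h⟩ else 0
    have hη₀ : ∑ s, η₀ s • z s = 0 := by
      rw [← hg, ← Finset.sum_subset (Finset.subset_univ (supp w)) fun s _ hs => by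
        simp [η₀, hs], ← Finset.sum_coe_sort]
      exact Finset.sum_congr rfl fun s _ => by simp [η₀, s.2]
    have hη₀s : ∀ s, w s = 0 → η₀ s = 0 := fun s hs => by simp [η₀, supp, hs]
    have hη₀ne : ∃ s, η₀ s ≠ 0 := ⟨s₀, by simpa [η₀] using hs₀⟩
    -- A linear dependence may be replaced by its negative, so it can be oriented not to lower the
    -- objective.
    obtain ⟨η, hη, hηs, hηne, hηf⟩ : ∃ η : S → ℝ, ∑ s, η s • z s = 0 ∧ (∀ s, w s = 0 → η s = 0) ∧
        (∃ s, η s ≠ 0) ∧ 0 ≤ ∑ s, η s * f s := by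
      rcases le_total 0 (∑ s, η₀ s * f s) with h | h
      · exact ⟨η₀, hη₀, hη₀s, hη₀ne, h⟩
      · refine ⟨fun s => - η₀ s, by simp [hη₀], fun s hs => by simp [hη₀s s hs], ?_, ?_⟩
        · simpa using hη₀ne
        · simpa using h
    have hnegex : ∃ s, η s < 0 := by
      by_contra hall
      push Not at hall
      obtain ⟨s, hs⟩ := hηne
      have hws : w s ≠ 0 := fun h => hs (hηs s h)
      refine hnz s hws (funext fun y => ?_)
      have h1 : ∑ s, η s * z s y = 0 := by
        have := congrFun hη y
        simpa using this
      have h2 := (Finset.sum_eq_zero_iff_of_nonneg fun s _ => mul_nonneg (hall s) (hz s y)).1 h1 s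
        (Finset.mem_univ s)
      simpa [hs] using h2
    obtain ⟨s, hs, hsmin⟩ := Set.exists_min_image {s | η s < 0} (fun s => w s / - η s)
      (Set.toFinite _) hnegex
    have hs : η s < 0 := hs
    set t := w s / - η s with ht
    have ht0 : 0 ≤ t := div_nonneg (hw.1 s) (by linarith)
    refine hdrop (fun r => w r + t * η r) ⟨fun r => ?_, ?_, ?_⟩
      (fun r hr => by simp [hr, hηs r hr]) s (fun h => hs.ne (hηs s h)) ?_
    · rcases lt_or_ge (η r) 0 with h | h
      · have := (le_div_iff₀ (neg_pos.2 h)).1 (hsmin r h)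
        linarith
      · have := hw.1 r
        positivity
    · simp only [add_smul, Finset.sum_add_distrib, mul_smul, ← Finset.smul_sum, hη, smul_zero,
        add_zero]
      exact hw.2.1
    · simp only [add_mul, Finset.sum_add_distrib, mul_assoc, ← Finset.mul_sum]
      have := mul_nonneg ht0 hηf
      linarith [hw.2.2]
    · have : t * η s = - w s := by
        rw [ht, div_mul_eq_mul_div, div_eq_iff (by linarith)]; ring
      simp only [this]; ring
  have hsumz : ∑ s ∈ supp w, w s • z s = ∑ s, z s := by
    rw [← hw.2.1]
    exact Finset.sum_subset (Finset.subset_univ _) fun s _ hs => by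
      have : w s = 0 := by simpa [supp] using hs
      simp [this]
  have hsumf : ∑ s, f s ≤ ∑ s ∈ supp w, w s * f s := by
    refine hw.2.2.trans_eq (Finset.sum_subset (Finset.subset_univ _) fun s _ hs => ?_).symm
    have : w s = 0 := by simpa [supp] using hs
    simp [this]
  obtain h | h | h : (supp w).card = 0 ∨ (supp w).card = 1 ∨ (supp w).card = 2 := by omega
  · rw [Finset.card_eq_zero.1 h] at hsumz hsumf
    obtain ⟨i⟩ := ‹Nonempty S›
    exact ⟨i, i, 0, 0, le_rfl, le_rfl, by simpa using hsumz, by simpa using hsumf⟩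
  · obtain ⟨i, hi⟩ := Finset.card_eq_one.1 h
    rw [hi] at hsumz hsumf
    exact ⟨i, i, w i, 0, hw.1 i, le_rfl, by simpa using hsumz, by simpa using hsumf⟩
  · obtain ⟨i, j, hij, hi⟩ := Finset.card_eq_two.1 h
    rw [hi, Finset.sum_pair hij] at hsumz hsumf
    exact ⟨i, j, w i, w j, hw.1 i, hw.1 j, hsumz, hsumf⟩

end Caratheodory

/-! ### Separation of strategies and obedient direct schemes. -/

section Persuasion

variable {S : Type*}

/-- Utility of the strategy `s` for Receiver at the unnormalized belief `z`. -/
def beliefUtil (u : S → Fin 2 → ℝ) (s : S) (z : Fin 2 → ℝ) : ℝ := z 0 * u s 0 + z 1 * u s 1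

/-- The strategy `s` beats all others by `τ` at the unnormalized belief `z`. -/
def ObedientBy (u : S → Fin 2 → ℝ) (τ : ℝ) (s : S) (z : Fin 2 → ℝ) : Prop :=
  ∀ s', s' ≠ s → τ * (z 0 + z 1) ≤ beliefUtil u s z - beliefUtil u s' z

theorem ObedientBy.add {u : S → Fin 2 → ℝ} {τ : ℝ} {s : S} {z z' : Fin 2 → ℝ}
    (h : ObedientBy u τ s z) (h' : ObedientBy u τ s z') : ObedientBy u τ s (z + z') :=
  fun r hr => by
    have h1 := h r hr
    have h2 := h' r hr
    simp only [beliefUtil, Pi.add_apply] at *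
    linarith

theorem ObedientBy.smul {u : S → Fin 2 → ℝ} {τ : ℝ} {s : S} {z : Fin 2 → ℝ}
    (h : ObedientBy u τ s z) {c : ℝ} (hc : 0 ≤ c) : ObedientBy u τ s (c • z) :=
  fun r hr => by
    have h1 := mul_le_mul_of_nonneg_left (h r hr) hc
    simp only [beliefUtil, Pi.smul_apply, smul_eq_mul] at *
    linarith

/-- A game in which any two strategies differ by at least `C` in each state, with opposite signs,
and each strategy beats all others by `C` at some belief. -/
structure SeparatedBy (u : S → Fin 2 → ℝ) (C : ℝ) : Prop where
  pos : 0 < C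
  le_one : C ≤ 1
  sign : ∀ s s', s' ≠ s → (C ≤ u s 0 - u s' 0 ∧ u s 1 - u s' 1 ≤ -C) ∨
    (u s 0 - u s' 0 ≤ -C ∧ C ≤ u s 1 - u s' 1)
  margin : ∀ s, ∃ m₀ m₁ : ℝ, 0 ≤ m₀ ∧ 0 ≤ m₁ ∧ m₀ + m₁ = 1 ∧
    ∀ s', s' ≠ s → C ≤ m₀ * (u s 0 - u s' 0) + m₁ * (u s 1 - u s' 1)

/-- The difference of two strategies is affine in the belief and positive at one belief, negative at
another. Hence it has strictly opposite signs at the two endpoints. Finitely many strict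
inequalities then share one positive constant. -/
theorem exists_separatedBy [Finite S] {u : S → Fin 2 → ℝ} (hu : EveryStrategyStrictlyOptimal u) :
    ∃ C, SeparatedBy u C := by
  choose μ hμ hopt using hu
  have small : ∀ f : ℝ, 0 < f → ∀ᶠ C in nhdsWithin (0 : ℝ) (Set.Ioi 0), C ≤ f := fun f hf =>
    Filter.mem_of_superset (Ioc_mem_nhdsGT hf) fun C hC => hC.2
  have signs : ∀ s s', s' ≠ s → (0 < u s 0 - u s' 0 ∧ u s 1 - u s' 1 < 0) ∨
      (u s 0 - u s' 0 < 0 ∧ 0 < u s 1 - u s' 1) := by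
    intro s s' hs
    have h1 := hopt s s' hs
    have h2 := hopt s' s hs.symm
    have p1 := (hμ s).1
    have p2 := (hμ s).2
    have q1 := (hμ s').1
    have q2 := (hμ s').2
    rcases lt_or_ge 0 (u s 0 - u s' 0) with h | h
    · refine Or.inl ⟨h, ?_⟩
      by_contra hcon
      push Not at hcon
      nlinarith [mul_nonneg (sub_nonneg.2 q2) h.le, mul_nonneg q1 hcon]
    · have h' : 0 < u s 1 - u s' 1 := by
        by_contra hcon
        push Not at hcon
        nlinarith [mul_nonneg (sub_nonneg.2 p2) (neg_nonneg.2 h), mul_nonneg p1 (neg_nonneg.2 hcon)]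
      refine Or.inr ⟨?_, h'⟩
      by_contra hcon
      push Not at hcon
      nlinarith [mul_nonneg (sub_nonneg.2 q2) hcon, mul_nonneg q1 h'.le]
  have e1 : ∀ᶠ C in nhdsWithin (0 : ℝ) (Set.Ioi 0), ∀ s s' y, s' ≠ s → C ≤ |u s y - u s' y| := by
    simp only [Filter.eventually_all]
    intro s s' y hs
    refine small _ (abs_pos.2 ?_)
    fin_cases y
    · rcases signs s s' hs with h | h
      · exact h.1.ne'
      · exact h.1.ne
    · rcases signs s s' hs with h | h
      · exact h.2.ne
      · exact h.2.ne'
  have e2 : ∀ᶠ C in nhdsWithin (0 : ℝ) (Set.Ioi 0), ∀ s s', s' ≠ s →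
      C ≤ (1 - μ s) * (u s 0 - u s' 0) + μ s * (u s 1 - u s' 1) := by
    simp only [Filter.eventually_all]
    intro s s' hs
    exact small _ (by linarith [hopt s s' hs])
  have e0 : ∀ᶠ C in nhdsWithin (0 : ℝ) (Set.Ioi 0), 0 < C := self_mem_nhdsWithin
  obtain ⟨C, h0, h1, h2, h3⟩ := (e0.and ((small 1 one_pos).and (e1.and e2))).exists
  refine ⟨C, h0, h1, fun s s' hs => ?_, fun s => ⟨1 - μ s, μ s, sub_nonneg.2 (hμ s).2, (hμ s).1,
    by ring, h3 s⟩⟩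
  have a0 := h2 s s' 0 hs
  have a1 := h2 s s' 1 hs
  rcases signs s s' hs with h | h
  · rw [abs_of_pos h.1] at a0
    rw [abs_of_neg h.2] at a1
    exact Or.inl ⟨a0, by linarith⟩
  · rw [abs_of_neg h.1] at a0
    rw [abs_of_pos h.2] at a1
    exact Or.inr ⟨by linarith, a1⟩

variable [Fintype S]

/-- Joint probability of the state `y` and the signal `s`. -/
def jointProb (p : SignalScheme S) (π : stdSimplex ℝ (Fin 2)) (s : S) (y : Fin 2) : ℝ := π y * p y s

theorem jointProb_nonneg (p : SignalScheme S) (π : stdSimplex ℝ (Fin 2)) (s : S) (y : Fin 2) :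
    0 ≤ jointProb p π s y := mul_nonneg (π.2.1 y) ((p y).2.1 s)

theorem sum_jointProb (p : SignalScheme S) (π : stdSimplex ℝ (Fin 2)) (y : Fin 2) :
    ∑ s, jointProb p π s y = π y := by
  simp only [jointProb, ← Finset.mul_sum]
  rw [stdSimplex.sum_eq_one (p y), mul_one]

theorem persuasionGame_U (u : S → Fin 2 → ℝ) (v : S → ℝ) (a : S → S) (p : SignalScheme S)
    (π : stdSimplex ℝ (Fin 2)) :
    (persuasionGame u v).U a p π = ∑ s, beliefUtil u (a s) (jointProb p π s) := by
  simp only [StageGame.U, persuasionGame, Fin.sum_univ_two, Finset.mul_sum,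
    ← Finset.sum_add_distrib]
  exact Finset.sum_congr rfl fun s _ => by simp only [beliefUtil, jointProb]; ring

theorem persuasionGame_V (u : S → Fin 2 → ℝ) (v : S → ℝ) (a : S → S) (p : SignalScheme S)
    (π : stdSimplex ℝ (Fin 2)) :
    (persuasionGame u v).V a p π =
      ∑ s, (jointProb p π s 0 + jointProb p π s 1) * v (a s) := by
  simp only [StageGame.V, persuasionGame, Fin.sum_univ_two, Finset.mul_sum,
    ← Finset.sum_add_distrib]
  exact Finset.sum_congr rfl fun s _ => by simp only [jointProb]; ring

/-- A deviation at one signal changes only that summand, so a best response is optimal signal by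
signal. -/
theorem beliefUtil_le_of_isBestResponse {u : S → Fin 2 → ℝ} {v : S → ℝ} {p : SignalScheme S}
    {π : stdSimplex ℝ (Fin 2)} {a : S → S} (h : (persuasionGame u v).IsBestResponse p π a)
    (s s' : S) : beliefUtil u s' (jointProb p π s) ≤ beliefUtil u (a s) (jointProb p π s) := by
  classical
  have h1 := h.1 (Function.update a s s')
  rw [persuasionGame_U, persuasionGame_U, ← sub_nonneg, ← Finset.sum_sub_distrib,
    Finset.sum_eq_single s] at h1
  · simpa using h1
  · intro r _ hr
    simp [hr]
  · simp

/-- Shifting mass between signals makes an almost obedient scheme obedient with a margin. -/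
theorem exists_obedient_of_gap_le [Nonempty S] {u : S → Fin 2 → ℝ} {v : S → ℝ}
    (hv : ∀ s, v s ∈ Set.Icc (0 : ℝ) 1) {C : ℝ} (hC : SeparatedBy u C) {τ ε : ℝ} (hτ : 0 ≤ τ)
    (hτC : τ < C) {q : Fin 2 → ℝ} (hq : q 0 + q 1 = 1) {z : S → Fin 2 → ℝ}
    (hz : ∀ s y, 0 ≤ z s y) (hzq : ∀ y, ∑ s, z s y = q y) {g : S → ℝ} (hg0 : ∀ s, 0 ≤ g s)
    (hg : ∀ s s', beliefUtil u s' (z s) - beliefUtil u s (z s) ≤ g s) (hgε : ∑ s, g s ≤ ε) :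
    ∃ z' : S → Fin 2 → ℝ, (∀ s y, 0 ≤ z' s y) ∧ (∀ y, ∑ s, z' s y = q y) ∧
      (∀ s, ObedientBy u τ s (z' s)) ∧
      ∑ s, (z s 0 + z s 1) * v s - (τ + ε) / C ≤ ∑ s, (z' s 0 + z' s 1) * v s := by
  classical
  have trim : ∀ s, ∃ x : Fin 2 → ℝ, (∀ y, 0 ≤ x y ∧ x y ≤ z s y) ∧ ObedientBy u τ s x ∧
      C * (z s 0 + z s 1 - (x 0 + x 1)) ≤ τ * (z s 0 + z s 1) + g s := by
    intro s
    obtain ⟨m₀, m₁, h0, h1, h2, h3⟩ := hC.margin s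
    obtain ⟨a, b, a0, a1, b0, b1, h, h'⟩ := exists_trim (K := {s' // s' ≠ s})
      (d₀ := fun k => u s 0 - u k.1 0) (d₁ := fun k => u s 1 - u k.1 1) hτ hτC
      (fun k => hC.sign s k.1 k.2) h0 h1 h2 (fun k => h3 k.1 k.2) (hz s 0) (hz s 1) (hg0 s)
      (fun k => by
        have := hg s k.1
        simp only [beliefUtil] at this
        linarith)
    refine ⟨![a, b], fun y => ?_, fun s' hs' => ?_, by simpa using h'⟩
    · fin_cases y
      · exact ⟨a0, a1⟩
      · exact ⟨b0, b1⟩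
    · have := h ⟨s', hs'⟩
      simp only [beliefUtil, Matrix.cons_val_zero, Matrix.cons_val_one]
      linarith
  choose x hx hxob hxcost using trim
  -- The best strategy in a state beats the others there by `C`, since the sign dichotomy excludes
  -- smaller differences.
  have best : ∀ y, ∃ s : S, ∀ s', s' ≠ s → C ≤ u s y - u s' y := by
    intro y
    obtain ⟨s, hs⟩ := Finite.exists_max fun s => u s y
    refine ⟨s, fun s' hs' => ?_⟩
    have h1 := hs s'
    have h2 := hC.pos
    fin_cases y
    · rcases hC.sign s s' hs' with h | h
      · exact h.1
      · have := h.1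
        simp only [Fin.zero_eta] at h1
        linarith
    · rcases hC.sign s s' hs' with h | h
      · have := h.2
        simp only [Fin.mk_one] at h1
        linarith
      · exact h.2
  choose r hr using best
  have hrest : ∀ y, 0 ≤ q y - ∑ s, x s y := fun y => by
    rw [← hzq y, sub_nonneg]
    exact Finset.sum_le_sum fun s _ => (hx s y).2
  -- The trimmed mass is disclosed: what is left in state `y` recommends the best strategy for `y`,
  -- where obedience has margin `C > τ`.
  have full : ∀ s, ObedientBy u τ s ![if s = r 0 then q 0 - ∑ s, x s 0 else 0,
      if s = r 1 then q 1 - ∑ s, x s 1 else 0] := by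
    intro s s' hs'
    have h0 := hrest 0
    have h1 := hrest 1
    have e : ∀ y, τ * (if s = r y then q y - ∑ s, x s y else 0) ≤
        (if s = r y then q y - ∑ s, x s y else 0) * (u s y - u s' y) := by
      intro y
      split_ifs with h
      · rw [mul_comm τ]
        refine mul_le_mul_of_nonneg_left ?_ (hrest y)
        rw [h] at hs' ⊢
        linarith [hr y s' hs']
      · simp
    have e0 := e 0
    have e1 := e 1
    simp only [beliefUtil, Matrix.cons_val_zero, Matrix.cons_val_one]
    linarith
  have hlow : ∀ s y, x s y ≤ x s y + if s = r y then q y - ∑ s, x s y else 0 := fun s y => by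
    split_ifs
    · linarith [hrest y]
    · simp
  refine ⟨fun s y => x s y + if s = r y then q y - ∑ s, x s y else 0, fun s y =>
    (hx s y).1.trans (hlow s y), fun y => ?_, fun s => ?_, ?_⟩
  · rw [Finset.sum_add_distrib]
    simp
  · convert (hxob s).add (full s) using 1
    ext y
    fin_cases y <;> rfl
  · have h1 : ∑ s, (x s 0 + x s 1) * v s ≤ ∑ s, ((x s 0 + if s = r 0 then q 0 - ∑ s, x s 0 else 0) +
        (x s 1 + if s = r 1 then q 1 - ∑ s, x s 1 else 0)) * v s :=
      Finset.sum_le_sum fun s _ => mul_le_mul_of_nonneg_right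
        (add_le_add (hlow s 0) (hlow s 1)) (hv s).1
    -- Only removed mass can lower the value, by at most 1 per unit, and the redistributed mass
    -- contributes nonnegatively.
    have h2 : ∑ s, (z s 0 + z s 1) * v s - ∑ s, (x s 0 + x s 1) * v s ≤
        ∑ s, (z s 0 + z s 1 - (x s 0 + x s 1)) := by
      rw [← Finset.sum_sub_distrib]
      refine Finset.sum_le_sum fun s _ => ?_
      rw [← sub_mul]
      exact mul_le_of_le_one_right (by linarith [(hx s 0).2, (hx s 1).2]) (hv s).2
    have h3 := Finset.sum_le_sum fun s (_ : s ∈ Finset.univ) => hxcost s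
    rw [← Finset.mul_sum, Finset.sum_add_distrib, ← Finset.mul_sum] at h3
    have h4 : ∑ s, (z s 0 + z s 1) = 1 := by
      rw [Finset.sum_add_distrib, hzq, hzq, hq]
    rw [h4, mul_one, ← le_div_iff₀' hC.pos] at h3
    have h5 : (τ + ∑ s, g s) / C ≤ (τ + ε) / C :=
      div_le_div_of_nonneg_right (by linarith) hC.pos.le
    linarith

/-- The direct scheme of an `ε`-best response recommends the strategy that is played. -/
theorem exists_direct_scheme [Nonempty S] {u : S → Fin 2 → ℝ} {v : S → ℝ}
    {aStar : SignalScheme S → stdSimplex ℝ (Fin 2) → (S → S)}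
    (hStar : (persuasionGame u v).IsBestResponseRule aStar) {p : SignalScheme S}
    {π : stdSimplex ℝ (Fin 2)} {ε : ℝ} {a : S → S}
    (ha : a ∈ (persuasionGame u v).epsBestResponses aStar p π ε) :
    ∃ (z : S → Fin 2 → ℝ) (g : S → ℝ), (∀ s y, 0 ≤ z s y) ∧ (∀ y, ∑ s, z s y = π y) ∧
      (∀ s, 0 ≤ g s) ∧ (∀ s s', beliefUtil u s' (z s) - beliefUtil u s (z s) ≤ g s) ∧
      ∑ s, g s ≤ ε ∧ (persuasionGame u v).V a p π = ∑ s, (z s 0 + z s 1) * v s := by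
  classical
  -- Revelation principle: signals that lead to the same strategy are pooled into a recommendation
  -- of that strategy.
  set z : S → Fin 2 → ℝ := fun s y => ∑ s' with a s' = s, jointProb p π s' y with hz
  have fiber : ∀ f : S → S → ℝ, ∑ s, ∑ s' with a s' = s, f s s' = ∑ s', f (a s') s' := by
    intro f
    rw [← Finset.sum_fiberwise_of_maps_to (g := a) (t := Finset.univ) (by simp) fun s' => f (a s') s']
    refine Finset.sum_congr rfl fun s _ => Finset.sum_congr rfl fun s' hs' => ?_
    rw [(Finset.mem_filter.1 hs').2]
  have util : ∀ c : S → S, ∑ s, beliefUtil u (c s) (z s) = (persuasionGame u v).U (c ∘ a) p π := by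
    intro c
    rw [persuasionGame_U]
    refine Eq.trans ?_ (fiber fun s s' => beliefUtil u (c s) (jointProb p π s'))
    refine Finset.sum_congr rfl fun s _ => ?_
    simp only [beliefUtil, hz, Finset.sum_mul, Finset.sum_add_distrib]
  choose b hb using fun s => Finite.exists_max fun s' => beliefUtil u s' (z s)
  refine ⟨z, fun s => beliefUtil u (b s) (z s) - beliefUtil u s (z s),
    fun s y => Finset.sum_nonneg fun s' _ => jointProb_nonneg p π s' y, fun y => ?_,
    fun s => sub_nonneg.2 (hb s s), fun s s' => sub_le_sub_right (hb s s') _, ?_, ?_⟩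
  · simp only [hz]
    rw [← sum_jointProb p π y]
    exact fiber fun _ s' => jointProb p π s' y
  · rw [Finset.sum_sub_distrib, util b, util fun s => s]
    -- Correcting every pooled recommendation at once is a single action, so the sum of all gaps,
    -- and not only each gap, is at most `ε`.
    have h1 := (hStar p π).1 (b ∘ a)
    have h2 : (persuasionGame u v).U (aStar p π) p π - ε ≤ (persuasionGame u v).U a p π := ha
    have h3 : (persuasionGame u v).U ((fun s => s) ∘ a) p π = (persuasionGame u v).U a p π := rfl
    linarith
  · rw [persuasionGame_V]
    refine Eq.trans
      (fiber fun s s' => (jointProb p π s' 0 + jointProb p π s' 1) * v s).symm ?_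
    refine Finset.sum_congr rfl fun s _ => ?_
    simp only [hz, ← Finset.sum_add_distrib, Finset.sum_mul]

end Persuasion

/-! ### Rounding to a grid of two-signal schemes, and the oracle. -/

section Grid

variable {S : Type*} [Fintype S]

open Classical in
/-- The scheme that sends the signal `i` with probability `k y / N` in state `y`, and else `j`. -/
noncomputable def gridScheme (N : ℕ) (i j : S) (k : Fin 2 → Fin (N + 1)) : SignalScheme S := fun y =>
  ⟨fun s => (if s = i then ((k y : ℕ) : ℝ) / N else 0) +
      if s = j then 1 - ((k y : ℕ) : ℝ) / N else 0, by
    have h1 : ((k y : ℕ) : ℝ) / N ≤ 1 :=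
      div_le_one_of_le₀ (by exact_mod_cast Nat.lt_succ_iff.1 (k y).2) (Nat.cast_nonneg N)
    refine ⟨fun s => ?_, by simp [Finset.sum_add_distrib]⟩
    refine add_nonneg ?_ ?_ <;> split_ifs <;> linarith [show 0 ≤ ((k y : ℕ) : ℝ) / N by positivity]⟩

open Classical in
/-- All schemes with at most two signals and probabilities that are multiples of `1/N`. -/
noncomputable def gridSchemes (S : Type*) [Fintype S] (N : ℕ) : Finset (SignalScheme S) :=
  Finset.univ.image fun x : S × S × (Fin 2 → Fin (N + 1)) => gridScheme N x.1 x.2.1 x.2.2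

theorem gridScheme_mem_gridSchemes (N : ℕ) (i j : S) (k : Fin 2 → Fin (N + 1)) :
    gridScheme N i j k ∈ gridSchemes S N := by
  classical
  exact Finset.mem_image.2 ⟨(i, j, k), Finset.mem_univ _, rfl⟩

theorem card_gridSchemes_le {δ : ℝ} (hδ : 0 < δ) (hδ1 : δ ≤ 1) :
    ((gridSchemes S ⌈1 / δ⌉₊).card : ℝ) ≤ 9 * ((Fintype.card S : ℝ) ^ 2 / δ ^ 2) := by
  classical
  have h1 : (gridSchemes S ⌈1 / δ⌉₊).card ≤ Fintype.card S ^ 2 * (⌈1 / δ⌉₊ + 1) ^ 2 := by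
    refine Finset.card_image_le.trans (le_of_eq ?_)
    simp only [Finset.card_univ, Fintype.card_prod, Fintype.card_fun, Fintype.card_fin]
    ring
  have h2 : ((⌈1 / δ⌉₊ : ℝ) + 1) ≤ 3 / δ := by
    have := (Nat.ceil_lt_add_one (show 0 ≤ 1 / δ by positivity)).le
    have h3 : 1 ≤ 1 / δ := (one_le_div hδ).2 hδ1
    have h4 : 3 / δ = 3 * (1 / δ) := by ring
    linarith
  calc ((gridSchemes S ⌈1 / δ⌉₊).card : ℝ) ≤ (Fintype.card S : ℝ) ^ 2 * ((⌈1 / δ⌉₊ : ℝ) + 1) ^ 2 := by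
        exact_mod_cast h1
    _ ≤ (Fintype.card S : ℝ) ^ 2 * (3 / δ) ^ 2 := by gcongr
    _ = _ := by field_simp; norm_num

open Classical in
theorem jointProb_gridScheme (N : ℕ) (i j : S) (k : Fin 2 → Fin (N + 1)) (π : stdSimplex ℝ (Fin 2))
    (s : S) (y : Fin 2) : jointProb (gridScheme N i j k) π s y =
      (if s = i then π y * (((k y : ℕ) : ℝ) / N) else 0) +
        if s = j then π y - π y * (((k y : ℕ) : ℝ) / N) else 0 := by
  change π y * ((if s = i then ((k y : ℕ) : ℝ) / N else 0) +
      if s = j then 1 - ((k y : ℕ) : ℝ) / N else 0) = _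
  split_ifs <;> ring

/-- The signals of `p` that are not rare are obedient by `τ`, and all signals but `k` and `l` have
probability zero, where `k` has probability at least one half. -/
structure IsRobust (u : S → Fin 2 → ℝ) (τ θ : ℝ) (p : SignalScheme S) (π : stdSimplex ℝ (Fin 2))
    (k l : S) : Prop where
  half : 1 / 2 ≤ jointProb p π k 0 + jointProb p π k 1
  zero : ∀ s, s ≠ k → s ≠ l → jointProb p π s 0 + jointProb p π s 1 = 0
  obedient : ∀ s, θ ≤ jointProb p π s 0 + jointProb p π s 1 → ObedientBy u τ s (jointProb p π s)

variable {u : S → Fin 2 → ℝ} {v : S → ℝ} {τ θ : ℝ} {p : SignalScheme S} {π : stdSimplex ℝ (Fin 2)}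
  {k l : S} {aStar : SignalScheme S → stdSimplex ℝ (Fin 2) → (S → S)}

theorem IsRobust.aStar_eq (h : IsRobust u τ θ p π k l) (hτ : 0 < τ) (hθ : 0 < θ)
    (hStar : (persuasionGame u v).IsBestResponseRule aStar) {s : S}
    (hs : θ ≤ jointProb p π s 0 + jointProb p π s 1) : aStar p π s = s := by
  by_contra hne
  have h1 := h.obedient s hs _ hne
  have h2 := beliefUtil_le_of_isBestResponse (hStar p π) s s
  have h3 : 0 < τ * (jointProb p π s 0 + jointProb p π s 1) := mul_pos hτ (by linarith)
  linarith

/-- The recommendation can fail only on a rare signal. This can only be `l`, as `k` is heavy, and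
its mass is below `θ`. -/
theorem IsRobust.value_le (h : IsRobust u τ θ p π k l) (hτ : 0 < τ) (hθ : 0 < θ) (hθ' : θ ≤ 1 / 2)
    (hv : ∀ s, v s ∈ Set.Icc (0 : ℝ) 1)
    (hStar : (persuasionGame u v).IsBestResponseRule aStar) :
    ∑ s, (jointProb p π s 0 + jointProb p π s 1) * v s - θ ≤
      (persuasionGame u v).V (aStar p π) p π := by
  rw [persuasionGame_V, sub_le_comm, ← Finset.sum_sub_distrib, Finset.sum_eq_single l]
  · rcases le_or_gt θ (jointProb p π l 0 + jointProb p π l 1) with hl | hl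
    · rw [h.aStar_eq hτ hθ hStar hl, sub_self]
      exact hθ.le
    · have h0 := jointProb_nonneg p π l 0
      have h1 := jointProb_nonneg p π l 1
      rw [← mul_sub]
      refine (mul_le_of_le_one_right (by linarith) ?_).trans hl.le
      linarith [(hv l).2, (hv (aStar p π l)).1]
  · intro s _ hs
    by_cases hk : s = k
    · rw [h.aStar_eq hτ hθ hStar (by rw [hk]; linarith [h.half]), sub_self]
    · rw [h.zero s hk hs]; ring
  · simp

/-- A deviation on a signal of mass at least `max θ (x/2)` loses `τ` per unit of mass. A deviation
that avoids such signals happens on `l` alone and changes the Principal's value by less than that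
threshold. -/
theorem IsRobust.isStable (h : IsRobust u τ θ p π k l) (hτ : 0 < τ) (hθ : 0 < θ) (hθ' : θ ≤ 1 / 2)
    (hv : ∀ s, v s ∈ Set.Icc (0 : ℝ) 1) {x : ℝ} (hx : x ∈ Set.Icc (0 : ℝ) 1)
    (hStar : (persuasionGame u v).IsBestResponseRule aStar) :
    (persuasionGame u v).IsStable aStar (x / 2 * τ) (max x θ) π p := by
  intro a _
  by_cases hbig : ∃ s, a s ≠ aStar p π s ∧ max θ (x / 2) ≤ jointProb p π s 0 + jointProb p π s 1
  · obtain ⟨s, hs, hm⟩ := hbig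
    left
    have hsθ := (le_max_left θ (x / 2)).trans hm
    have hsx := (le_max_right θ (x / 2)).trans hm
    have heq := h.aStar_eq hτ hθ hStar hsθ
    rw [heq] at hs
    have h1 := h.obedient s hsθ (a s) hs
    have h2 : beliefUtil u (aStar p π s) (jointProb p π s) - beliefUtil u (a s) (jointProb p π s) ≤
        (persuasionGame u v).U (aStar p π) p π - (persuasionGame u v).U a p π := by
      rw [persuasionGame_U, persuasionGame_U, ← Finset.sum_sub_distrib]
      exact Finset.single_le_sum (f := fun s => beliefUtil u (aStar p π s) (jointProb p π s) -
        beliefUtil u (a s) (jointProb p π s)) (fun r _ => sub_nonneg.2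
          (beliefUtil_le_of_isBestResponse (hStar p π) r (a r))) (Finset.mem_univ s)
    rw [heq] at h2
    have h3 := mul_le_mul_of_nonneg_left hsx hτ.le
    linarith
  · right
    push Not at hbig
    have hmax : max θ (x / 2) ≤ max x θ :=
      max_le (le_max_right _ _) ((half_le_self hx.1).trans (le_max_left _ _))
    -- The threshold is `x/2` and not `x` so that it never exceeds `1/2`, the mass guaranteed for
    -- `k`.
    have hmax' : max θ (x / 2) ≤ 1 / 2 := max_le hθ' (by linarith [hx.2])
    refine sub_le_comm.1 (le_trans ?_ hmax)
    rw [persuasionGame_V, persuasionGame_V, ← Finset.sum_sub_distrib, Finset.sum_eq_single l]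
    · by_cases hl : a l = aStar p π l
      · rw [hl, sub_self]
        exact hθ.le.trans (le_max_left _ _)
      · have h0 := jointProb_nonneg p π l 0
        have h1 := jointProb_nonneg p π l 1
        rw [← mul_sub]
        refine (mul_le_of_le_one_right (by linarith) ?_).trans (hbig l hl).le
        linarith [(hv (a l)).1, (hv (aStar p π l)).2]
    · intro s _ hs
      by_cases hk : s = k
      · have : a s = aStar p π s := by
          by_contra hne
          have := hbig s hne
          rw [hk] at this
          linarith [h.half]
        rw [this, sub_self]
      · rw [h.zero s hk hs]; ring
    · simp

/-- Rounding a two-signal scheme to the grid. -/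
theorem exists_robust_gridScheme (hu : ∀ s y, u s y ∈ Set.Icc (0 : ℝ) 1)
    (hv : ∀ s, v s ∈ Set.Icc (0 : ℝ) 1) {β δ : ℝ} (hβ : 0 < β) (hβ1 : β ≤ 1) (hδ : 0 < δ)
    (hδβ : δ ≤ β ^ 2 / 16) {i j : S} {zi zj : Fin 2 → ℝ} (hzi : ∀ y, 0 ≤ zi y)
    (hzj : ∀ y, 0 ≤ zj y) (hz : ∀ y, zi y + zj y = π y) (hi : ObedientBy u β i zi)
    (hj : ObedientBy u β j zj) :
    ∃ (κ : Fin 2 → Fin (⌈1 / δ⌉₊ + 1)) (k l : S),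
      IsRobust u (β / 2) √δ (gridScheme ⌈1 / δ⌉₊ i j κ) π k l ∧
      (zi 0 + zi 1) * v i + (zj 0 + zj 1) * v j - √δ ≤
        ∑ s, (jointProb (gridScheme ⌈1 / δ⌉₊ i j κ) π s 0 +
          jointProb (gridScheme ⌈1 / δ⌉₊ i j κ) π s 1) * v s := by
  classical
  set N := ⌈1 / δ⌉₊ with hN
  have hNδ : 1 / δ ≤ N := Nat.le_ceil _
  have hN0 : (0 : ℝ) < N := lt_of_lt_of_le (by positivity) hNδ
  have hNδ' : 1 / (N : ℝ) ≤ δ := by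
    rw [div_le_iff₀ hN0]; rwa [div_le_iff₀' hδ] at hNδ
  have hπ : ∀ y, 0 ≤ π y := fun y => π.2.1 y
  have hπ1 : π 0 + π 1 = 1 := stdSimplex.add_eq_one π
  have hsq : √δ ≤ β / 4 := by
    rw [Real.sqrt_le_left (by positivity)]; linarith [hδβ, show (β / 4) ^ 2 = β ^ 2 / 16 by ring]
  have hsq0 : 0 < √δ := Real.sqrt_pos.2 hδ
  have hδsq : √δ * √δ = δ := Real.mul_self_sqrt hδ.le
  have hδle : δ ≤ √δ := by nlinarith
  -- In a state of probability zero the quotient is 0 by convention; the last identity survives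
  -- because `zi y` is then zero too.
  have hfrac : ∀ y, 0 ≤ zi y / π y ∧ zi y / π y ≤ 1 ∧ π y * (zi y / π y) = zi y := by
    intro y
    refine ⟨div_nonneg (hzi y) (hπ y), div_le_one_of_le₀ (by linarith [hz y, hzj y]) (hπ y), ?_⟩
    rcases eq_or_ne (π y) 0 with h | h
    · rw [h, zero_mul]; linarith [hz y, hzi y, hzj y]
    · field_simp
  have hfloor : ∀ y, ⌊zi y / π y * N⌋₊ < N + 1 := fun y => by
    rw [Nat.lt_succ_iff]
    exact Nat.floor_le_of_le (mul_le_of_le_one_left hN0.le (hfrac y).2.1)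
  -- The conditional probability of the signal `i` is rounded down, which moves mass at most `π y *
  -- δ` from `i` to `j` in state `y`.
  set κ : Fin 2 → Fin (N + 1) := fun y => ⟨⌊zi y / π y * N⌋₊, hfloor y⟩ with hκ
  set w : Fin 2 → ℝ := fun y => π y * (((κ y : ℕ) : ℝ) / N) with hw
  have hwz : ∀ y, w y ≤ zi y ∧ zi y - π y * δ ≤ w y := by
    intro y
    have h1 : ((κ y : ℕ) : ℝ) ≤ zi y / π y * N :=
      Nat.floor_le (mul_nonneg (hfrac y).1 hN0.le)
    have h2 : zi y / π y * N < ((κ y : ℕ) : ℝ) + 1 := Nat.lt_floor_add_one _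
    have h3 : ((κ y : ℕ) : ℝ) / N ≤ zi y / π y := (div_le_iff₀ hN0).2 h1
    have h4 : zi y / π y - δ ≤ ((κ y : ℕ) : ℝ) / N := by
      have : zi y / π y ≤ (((κ y : ℕ) : ℝ) + 1) / N := (le_div_iff₀ hN0).2 h2.le
      rw [add_div] at this
      linarith
    have h5 := mul_le_mul_of_nonneg_left h3 (hπ y)
    have h6 := mul_le_mul_of_nonneg_left h4 (hπ y)
    rw [mul_sub, (hfrac y).2.2] at h6
    rw [(hfrac y).2.2] at h5
    exact ⟨h5, h6⟩
  have hjoint : ∀ s y, jointProb (gridScheme N i j κ) π s y =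
      (if s = i then w y else 0) + if s = j then π y - w y else 0 := jointProb_gridScheme N i j κ π
  refine ⟨κ, ?_⟩
  have hz0 := hz 0
  have hz1 := hz 1
  -- If both signals coincide the scheme is uninformative, and rounding has no effect.
  by_cases hij : i = j
  · subst hij
    have hji : ∀ y, jointProb (gridScheme N i i κ) π i y = π y := fun y => by
      rw [hjoint]; simp
    have hjs : ∀ s, s ≠ i → ∀ y, jointProb (gridScheme N i i κ) π s y = 0 := fun s hs y => by
      rw [hjoint]; simp [hs]
    refine ⟨i, i, ⟨?_, fun s hs _ => ?_, fun s hs => ?_⟩, ?_⟩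
    · rw [hji, hji, hπ1]; norm_num
    · rw [hjs s hs, hjs s hs, add_zero]
    · rcases eq_or_ne s i with rfl | h
      · have : jointProb (gridScheme N s s κ) π s = zi + zj := by
          ext y; rw [hji, Pi.add_apply, hz]
        rw [this]
        intro s' hs'
        have h1 := hi.add hj s' hs'
        have h2 : 0 ≤ (zi + zj) 0 + (zi + zj) 1 := by
          simp only [Pi.add_apply, hz, hπ1]; norm_num
        nlinarith
      · rw [hjs s h, hjs s h] at hs
        linarith
    · rw [Finset.sum_eq_single i]
      · rw [hji, hji]
        have : (zi 0 + zi 1) * v i + (zj 0 + zj 1) * v i = (π 0 + π 1) * v i := by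
          rw [← hz0, ← hz1]; ring
        linarith
      · intro s _ hs
        rw [hjs s hs, hjs s hs]; ring
      · simp
  · have hji : jointProb (gridScheme N i j κ) π i = w := by
      ext y; rw [hjoint]; simp [hij]
    have hjj : jointProb (gridScheme N i j κ) π j = fun y => π y - w y := by
      ext y; rw [hjoint]; simp [Ne.symm hij]
    have hjs : ∀ s, s ≠ i → s ≠ j → ∀ y, jointProb (gridScheme N i j κ) π s y = 0 :=
      fun s hs hs' y => by rw [hjoint]; simp [hs, hs']
    have hmass : (w 0 + w 1) + ((π 0 - w 0) + (π 1 - w 1)) = 1 := by linarith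
    -- Rounding costs at most `2δ` of the margin. Since `√δ ≤ β/4`, a signal of mass at least `√δ`
    -- has `2δ ≤ β/2` times its mass and keeps half of the margin.
    have perturb : ∀ (s : S) (x x' : Fin 2 → ℝ), ObedientBy u β s x →
        (∀ y, |x' y - x y| ≤ π y * δ) → √δ ≤ x' 0 + x' 1 → ObedientBy u (β / 2) s x' := by
      intro s x x' hx hxx' hm s' hs'
      have h1 := hx s' hs'
      have hd : ∀ y, -(π y * δ) ≤ (x' y - x y) * (u s y - u s' y) := by
        intro y
        have h2 : |(x' y - x y) * (u s y - u s' y)| ≤ π y * δ := by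
          rw [abs_mul]
          refine (mul_le_of_le_one_right (abs_nonneg _) ?_).trans (hxx' y)
          rw [abs_le]
          exact ⟨by linarith [(hu s y).1, (hu s' y).2], by linarith [(hu s y).2, (hu s' y).1]⟩
        exact (abs_le.1 h2).1
      have hd0 := hd 0
      have hd1 := hd 1
      have hx0 := (abs_le.1 (hxx' 0)).2
      have hx1 := (abs_le.1 (hxx' 1)).2
      have h3 : π 0 * δ + π 1 * δ = δ := by rw [← add_mul, hπ1, one_mul]
      have h4 : β * ((x' 0 + x' 1) - δ) ≤ β * (x 0 + x 1) :=
        mul_le_mul_of_nonneg_left (by linarith) hβ.le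
      have h5 : β * δ ≤ δ := mul_le_of_le_one_left hδ.le hβ1
      have h6 : 2 * δ ≤ β / 2 * (x' 0 + x' 1) := by
        have := mul_le_mul hsq hm hsq0.le (by linarith)
        linarith
      simp only [beliefUtil] at h1 ⊢
      linarith
    have hobi : √δ ≤ w 0 + w 1 → ObedientBy u (β / 2) i w := perturb i zi w hi fun y => by
      have := hwz y
      have := mul_nonneg (hπ y) hδ.le
      exact abs_le.2 ⟨by linarith, by linarith⟩
    have hobj : √δ ≤ (π 0 - w 0) + (π 1 - w 1) → ObedientBy u (β / 2) j (fun y => π y - w y) :=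
      perturb j zj (fun y => π y - w y) hj fun y => by
        have := hwz y
        have := mul_nonneg (hπ y) hδ.le
        have := hz y
        exact abs_le.2 ⟨by linarith, by linarith⟩
    have hob : ∀ s, √δ ≤ jointProb (gridScheme N i j κ) π s 0 +
        jointProb (gridScheme N i j κ) π s 1 →
        ObedientBy u (β / 2) s (jointProb (gridScheme N i j κ) π s) := by
      intro s hs
      rcases eq_or_ne s i with rfl | hsi
      · rw [hji] at hs ⊢; exact hobi hs
      · rcases eq_or_ne s j with rfl | hsj
        · rw [hjj] at hs ⊢; exact hobj hs
        · rw [hjs s hsi hsj, hjs s hsi hsj] at hs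
          linarith
    have hval : (zi 0 + zi 1) * v i + (zj 0 + zj 1) * v j - √δ ≤
        ∑ s, (jointProb (gridScheme N i j κ) π s 0 + jointProb (gridScheme N i j κ) π s 1) * v s := by
      rw [← Finset.sum_subset (Finset.subset_univ {i, j}) fun s _ hs => by
        simp only [Finset.mem_insert, Finset.mem_singleton, not_or] at hs
        rw [hjs s hs.1 hs.2, hjs s hs.1 hs.2]; ring, Finset.sum_pair hij, hji, hjj]
      set e := zi 0 + zi 1 - (w 0 + w 1) with he
      have he0 : 0 ≤ e := by linarith [(hwz 0).1, (hwz 1).1]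
      have h3 : π 0 * δ + π 1 * δ = δ := by rw [← add_mul, hπ1, one_mul]
      have he1 : e ≤ δ := by linarith [(hwz 0).2, (hwz 1).2]
      have h4 : e * v i ≤ e := mul_le_of_le_one_right he0 (hv i).2
      have h5 : 0 ≤ e * v j := mul_nonneg he0 (hv j).1
      have h6 : (zi 0 + zi 1) * v i = (w 0 + w 1) * v i + e * v i := by rw [he]; ring
      have h7 : (π 0 - w 0 + (π 1 - w 1)) * v j = (zj 0 + zj 1) * v j + e * v j := by
        rw [he, ← hz0, ← hz1]; ring
      linarith
    -- One of the two signals has mass at least one half; it plays the role of `k`.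
    rcases le_total (1 / 2) (w 0 + w 1) with h | h
    · refine ⟨i, j, ⟨by rw [hji]; exact h, fun s h1 h2 => ?_, hob⟩, hval⟩
      rw [hjs s h1 h2, hjs s h1 h2, add_zero]
    · refine ⟨j, i, ⟨?_, fun s h1 h2 => ?_, hob⟩, hval⟩
      · rw [hjj]; linarith
      · rw [hjs s h2 h1, hjs s h2 h1, add_zero]

/-- Against any `ε`-best response to any scheme, the grid contains a stable competitor. -/
theorem exists_stable_gridScheme [Nonempty S] (hu : ∀ s y, u s y ∈ Set.Icc (0 : ℝ) 1)
    (hv : ∀ s, v s ∈ Set.Icc (0 : ℝ) 1) {C : ℝ} (hC : SeparatedBy u C)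
    (hStar : (persuasionGame u v).IsBestResponseRule aStar) {β ε x δ : ℝ} (hβ : 0 < β)
    (hβC : β < C) (hx : x ∈ Set.Icc (0 : ℝ) 1) (hδ : 0 < δ) (hδβ : δ ≤ β ^ 2 / 16)
    {p₀ : SignalScheme S} {a : S → S}
    (ha : a ∈ (persuasionGame u v).epsBestResponses aStar p₀ π ε) :
    ∃ p ∈ gridSchemes S ⌈1 / δ⌉₊,
      (persuasionGame u v).IsStable aStar (x / 2 * (β / 2)) (max x √δ) π p ∧
      (persuasionGame u v).V a p₀ π - ((β + ε) / C + 2 * √δ) ≤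
        (persuasionGame u v).V (aStar p π) p π := by
  have hβ1 : β ≤ 1 := hβC.le.trans hC.le_one
  have hsq : √δ ≤ 1 / 2 := by
    rw [Real.sqrt_le_left (by norm_num)]; nlinarith
  obtain ⟨z, g, hz, hzπ, hg0, hg, hgε, hV⟩ := exists_direct_scheme hStar ha
  obtain ⟨z', hz', hzπ', hob, hval⟩ := exists_obedient_of_gap_le hv hC hβ.le hβC
    (stdSimplex.add_eq_one π) hz hzπ hg0 hg hgε
  obtain ⟨i, j, c, d, hc, hd, hcd, hf⟩ := exists_pair_combination hz'
    (f := fun s => (z' s 0 + z' s 1) * v s) fun s hs => by simp [hs]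
  obtain ⟨κ, k, l, hrob, hgrid⟩ := exists_robust_gridScheme (π := π) hu hv hβ hβ1 hδ hδβ
    (i := i) (j := j) (zi := c • z' i) (zj := d • z' j) (fun y => mul_nonneg hc (hz' i y))
    (fun y => mul_nonneg hd (hz' j y)) (fun y => by
      have := congrFun hcd y
      rw [Finset.sum_apply, hzπ' y] at this
      exact this) ((hob i).smul hc) ((hob j).smul hd)
  refine ⟨_, gridScheme_mem_gridSchemes _ i j κ,
    hrob.isStable (by linarith) (Real.sqrt_pos.2 hδ) hsq hv hx hStar, ?_⟩
  have h1 := hrob.value_le (by linarith) (Real.sqrt_pos.2 hδ) hsq hv hStar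
  simp only [Pi.smul_apply, smul_eq_mul] at hgrid
  rw [hV]
  linarith

/-- The competitor on the grid depends on the benchmark policy and the response, but the best stable
grid scheme is at least as good as all of them. -/
theorem exists_optimalStableOracle [Nonempty S] (hu : ∀ s y, u s y ∈ Set.Icc (0 : ℝ) 1)
    (hv : ∀ s, v s ∈ Set.Icc (0 : ℝ) 1) {C : ℝ} (hC : SeparatedBy u C)
    (hStar : (persuasionGame u v).IsBestResponseRule aStar) (P₀ : Set (SignalScheme S))
    {β ε x δ : ℝ} (hβ : 0 < β)
    (hβC : β < C) (hε : 0 ≤ ε) (hx : x ∈ Set.Icc (0 : ℝ) 1) (hδ : 0 < δ) (hδβ : δ ≤ β ^ 2 / 16) :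
    ∃ O : stdSimplex ℝ (Fin 2) → SignalScheme S, (persuasionGame u v).IsOptimalStableOracle aStar P₀
      ((β + ε) / C + 2 * √δ) ε (x / 2 * (β / 2)) (max x √δ) (gridSchemes S ⌈1 / δ⌉₊) O := by
  classical
  have key : ∀ π, ∃ p ∈ gridSchemes S ⌈1 / δ⌉₊, (persuasionGame u v).IsOptimalStable aStar P₀
      ((β + ε) / C + 2 * √δ) ε (x / 2 * (β / 2)) (max x √δ) π p := by
    intro π
    set A := (gridSchemes S ⌈1 / δ⌉₊).filter fun p =>
      (persuasionGame u v).IsStable aStar (x / 2 * (β / 2)) (max x √δ) π p with hA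
    have hne : A.Nonempty := by
      obtain ⟨s⟩ := ‹Nonempty S›
      -- Stable grid schemes exist whatever the benchmark, so any scheme serves as input. With `N =
      -- 0` the division by zero gives the scheme that always sends `s`.
      obtain ⟨p, hp, hst, _⟩ := exists_stable_gridScheme hu hv hC hStar (π := π) hβ hβC hx hδ hδβ
        (ε := ε) (p₀ := gridScheme 0 s s 0) (a := aStar (gridScheme 0 s s 0) π) (by
          change _ - ε ≤ _
          linarith)
      exact ⟨p, Finset.mem_filter.2 ⟨hp, hst⟩⟩
    obtain ⟨p, hpA, hmax⟩ := Finset.exists_max_image A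
      (fun p => (persuasionGame u v).V (aStar p π) p π) hne
    refine ⟨p, (Finset.mem_filter.1 hpA).1, (Finset.mem_filter.1 hpA).2, fun p₀ _ a ha => ?_⟩
    obtain ⟨p', hp', hst, hval⟩ := exists_stable_gridScheme hu hv hC hStar hβ hβC hx hδ hδβ ha
    exact hval.trans (hmax p' (Finset.mem_filter.2 ⟨hp', hst⟩))
  choose O hO using key
  exact ⟨O, fun π => hO π⟩

end Grid

/-! ### Arithmetic of the rates. -/

section Rates

/-- The error terms of the regret bound when the oracle has `O(τ⁻⁴)` policies and `T = τ⁻¹⁰`. -/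
theorem regret_error_le {T τ Z ℓ N M κ κs κn : ℝ} (hτ : 0 < τ) (hτ1 : τ ≤ 1) (hT : T * τ ^ 10 = 1)
    (hZ : 1 ≤ Z) (hN : N ≤ Z / τ ^ 4) (hM : M ≤ Z / τ ^ 4) (hℓ : 1 ≤ ℓ) :
    (T * (κs * √(M / T)) + |κn| * √(N * T) + 2 * (|κ| * 2 * (N * ℓ + √ℓ * √(N * T)))) / T ≤
      (|κs| + |κn| + 8 * |κ|) * Z * τ ^ 3 * ℓ := by
  have hT0 : 0 < T := pos_of_mul_pos_left (hT ▸ one_pos) (by positivity)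
  have hτT : Z / τ ^ 4 = T * (Z * τ ^ 6) := by
    rw [div_eq_iff (by positivity)]
    linear_combination -Z * hT
  rw [hτT] at hN hM
  -- Since `Z ≥ 1`, the square root of `Z τ⁶` is at most `Z τ³`. The policies per round thus
  -- contribute `τ³`.
  have hpow : Z * τ ^ 6 ≤ (Z * τ ^ 3) ^ 2 := by
    have : (Z * τ ^ 3) ^ 2 = Z * (Z * τ ^ 6) := by ring
    rw [this]
    exact le_mul_of_one_le_left (by positivity) hZ
  have hpow3 : Z * τ ^ 6 ≤ Z * τ ^ 3 :=
    mul_le_mul_of_nonneg_left (pow_le_pow_of_le_one hτ.le hτ1 (by norm_num)) (by linarith)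
  have h1 : √(M / T) ≤ Z * τ ^ 3 := by
    rw [Real.sqrt_le_left (by positivity)]
    exact ((div_le_iff₀' hT0).2 hM).trans hpow
  have h2 : √(N * T) ≤ T * (Z * τ ^ 3) := by
    rw [Real.sqrt_le_left (by positivity)]
    calc N * T ≤ T * (Z * τ ^ 6) * T := mul_le_mul_of_nonneg_right hN hT0.le
      _ = T ^ 2 * (Z * τ ^ 6) := by ring
      _ ≤ T ^ 2 * (Z * τ ^ 3) ^ 2 := mul_le_mul_of_nonneg_left hpow (by positivity)
      _ = _ := by ring
  have h3 : √ℓ ≤ ℓ := by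
    rw [Real.sqrt_le_left (by linarith)]; nlinarith
  set R := Z * τ ^ 3 with hR
  have hR0 : 0 ≤ R := by positivity
  have h4 : N ≤ T * R := hN.trans (mul_le_mul_of_nonneg_left hpow3 hT0.le)
  have a1 : T * (κs * √(M / T)) ≤ T * (|κs| * (R * ℓ)) := by
    refine mul_le_mul_of_nonneg_left ?_ hT0.le
    exact mul_le_mul (le_abs_self _) (h1.trans (le_mul_of_one_le_right hR0 hℓ))
      (Real.sqrt_nonneg _) (abs_nonneg _)
  have a2 : |κn| * √(N * T) ≤ |κn| * (T * (R * ℓ)) := by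
    refine mul_le_mul_of_nonneg_left (h2.trans ?_) (abs_nonneg _)
    exact mul_le_mul_of_nonneg_left (le_mul_of_one_le_right hR0 hℓ) hT0.le
  have a3 : N * ℓ + √ℓ * √(N * T) ≤ T * R * ℓ + ℓ * (T * R) :=
    add_le_add (mul_le_mul_of_nonneg_right h4 (by linarith))
      (mul_le_mul h3 h2 (Real.sqrt_nonneg _) (by linarith))
  have a4 := mul_le_mul_of_nonneg_left a3 (show 0 ≤ |κ| * 2 by positivity)
  rw [div_le_iff₀ hT0]
  have : (|κs| + |κn| + 8 * |κ|) * Z * τ ^ 3 * ℓ * T = T * (|κs| * (R * ℓ)) +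
      |κn| * (T * (R * ℓ)) + 2 * (|κ| * 2 * (T * R * ℓ + ℓ * (T * R))) := by rw [hR]; ring
  linarith

theorem log_two_mul_mul_le {T c Z : ℝ} (hT : 2 ≤ T) (hc : 0 < c) (hZ : 1 ≤ Z) (hcZ : c ≤ Z * T) :
    Real.log (2 * c * T) ≤ (2 * Real.log (2 * Z) + 2) * Real.log T := by
  have hlog2 : 1 / 2 ≤ Real.log T :=
    (by linarith [Real.log_two_gt_d9] : 1 / 2 ≤ Real.log 2).trans
      (Real.log_le_log (by norm_num) hT)
  have h1 : Real.log (2 * c * T) ≤ Real.log (2 * Z * T ^ 2) := by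
    refine Real.log_le_log (by positivity) ?_
    have : 2 * Z * T ^ 2 = 2 * (Z * T) * T := by ring
    rw [this]
    gcongr
  have h2 : Real.log (2 * Z * T ^ 2) = Real.log (2 * Z) + 2 * Real.log T := by
    rw [Real.log_mul (by positivity) (by positivity), Real.log_pow]; norm_num
  have h3 : 0 ≤ Real.log (2 * Z) := Real.log_nonneg (by linarith)
  nlinarith

theorem regret_factor_le {τ p : ℝ} (hτ : 0 < τ) (hτ1 : τ ≤ 1) (hp : 0 ≤ p) :
    1 / (τ ^ 2 / 4) + 1 + p * (1 / τ ^ 2 + 1) ≤ (5 + 2 * p) / τ ^ 2 := by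
  have h2 : 1 ≤ 1 / τ ^ 2 := by
    rw [le_div_iff₀ (by positivity), one_mul]; exact pow_le_one₀ hτ.le hτ1
  have h3 : p ≤ p * (1 / τ ^ 2) := le_mul_of_one_le_right hp h2
  have h4 : 1 / (τ ^ 2 / 4) = 4 * (1 / τ ^ 2) := by field_simp
  have h5 : (5 + 2 * p) / τ ^ 2 = 5 * (1 / τ ^ 2) + 2 * (p * (1 / τ ^ 2)) := by ring
  linarith

end Rates

/-! ### Rate of the regret, and the main theorem. -/

section Main

variable {S : Type*} [Fintype S] [DecidableEq S] [Nonempty S]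

/-- The rate of the Principal's regret for the oracle with parameters balanced against `T`. -/
theorem persuasion_principalRegret_le {u : S → Fin 2 → ℝ} {v : S → ℝ}
    (hu : ∀ s y, u s y ∈ Set.Icc (0 : ℝ) 1) (hv : ∀ s, v s ∈ Set.Icc (0 : ℝ) 1) {C : ℝ} (hC : 0 < C)
    {aStar : SignalScheme S → stdSimplex ℝ (Fin 2) → (S → S)}
    (hStar : (persuasionGame u v).IsBestResponseRule aStar) {P₀ PO : Finset (SignalScheme S)}
    (hP₀ : P₀.Nonempty) {O : stdSimplex ℝ (Fin 2) → SignalScheme S} {T : ℕ} (hT : 2 ≤ T) {τ : ℝ}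
    (hτ : τ = (T : ℝ) ^ (-(1 / 10) : ℝ)) {Z : ℝ}
    (hZ : Z = (2304 * (Fintype.card S : ℝ) ^ 2 + 2 * P₀.card) * Fintype.card (S → S))
    (hPO : (PO.card : ℝ) ≤ 2304 * (Fintype.card S : ℝ) ^ 2 / τ ^ 4)
    (hO : (persuasionGame u v).IsOptimalStableOracle aStar P₀ ((4 / C + 1 / 2) * τ) (τ ^ 2)
      (τ ^ 2 / 4) τ PO O)
    {pOpt : stdSimplex ℝ (Fin 2) → SignalScheme S} {aOpt : stdSimplex ℝ (Fin 2) → (S → S)}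
    {F : Forecaster (Fin 2)} {κ : ℝ}
    (hF : HasLowBias F (StageGame.events aStar P₀ PO O pOpt aOpt) T κ)
    {L : Learner (S → S) (SignalScheme S) (Fin 2)} {y : ℕ → Fin 2} {κs κn : ℝ}
    (hs : (persuasionGame u v).NoSwapRegret aStar P₀ O F L y T
      (κs * √((PO.card : ℝ) / (T : ℝ))))
    (hn : (persuasionGame u v).NoSecretInformation aStar P₀ O F L y T κn) :
    (persuasionGame u v).principalRegret aStar P₀ hP₀ O F L y T ≤
      (2 * (4 / C + 3 / 2) + (5 + 2 * P₀.card) * ((|κs| + |κn| + 8 * |κ|) * Z) *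
        (2 * Real.log (2 * Z) + 2)) * τ * Real.log T := by
  have hT2 : (2 : ℝ) ≤ T := by exact_mod_cast hT
  have hT0 : (0 : ℝ) < T := by linarith
  have hτ0 : 0 < τ := by rw [hτ]; positivity
  have hτ1 : τ ≤ 1 := by
    rw [hτ]; exact Real.rpow_le_one_of_one_le_of_nonpos (by linarith) (by norm_num)
  have hTτ : (T : ℝ) * τ ^ 10 = 1 := by
    rw [hτ, ← Real.rpow_natCast, ← Real.rpow_mul hT0.le]
    norm_num
    rw [Real.rpow_neg_one, mul_inv_cancel₀ hT0.ne']
  have hU01 : ∀ a p z, (persuasionGame u v).agentUtil a p z ∈ Set.Icc (0 : ℝ) 1 := fun a p z =>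
    StageGame.expected_util_mem_Icc (fun s => hu (a s) z) (p z)
  have hV01 : ∀ a p z, (persuasionGame u v).principalUtil a p z ∈ Set.Icc (0 : ℝ) 1 := fun a p z =>
    StageGame.expected_util_mem_Icc (fun s => hv (a s)) (p z)
  have hn1 : (1 : ℝ) ≤ Fintype.card S := by exact_mod_cast Fintype.card_pos (α := S)
  have hm1 : (1 : ℝ) ≤ Fintype.card (S → S) := by exact_mod_cast Fintype.card_pos (α := S → S)
  have hp1 : (1 : ℝ) ≤ P₀.card := by exact_mod_cast hP₀.card_pos
  set n : ℝ := (Fintype.card S : ℝ)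
  set m : ℝ := (Fintype.card (S → S) : ℝ)
  set p : ℝ := (P₀.card : ℝ)
  have hZ1 : 1 ≤ Z := by
    rw [hZ]
    have : 1 ≤ 2304 * n ^ 2 + 2 * p := by nlinarith
    nlinarith
  have hτ4 : 1 ≤ 1 / τ ^ 4 := by
    rw [le_div_iff₀ (by positivity), one_mul]; exact pow_le_one₀ hτ0.le hτ1
  have hι : ((Fintype.card (((PO × (S → S)) ⊕ (P₀ × (S → S))) ⊕ (P₀ × (S → S))) : ℕ) : ℝ) =
      PO.card * m + p * m + p * m := by
    simp only [Fintype.card_sum, Fintype.card_prod, Fintype.card_coe]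
    push_cast
    rfl
  set c : ℝ := PO.card * m + p * m + p * m
  have hpm : 1 ≤ p * m := by nlinarith
  have hPOm : 0 ≤ (PO.card : ℝ) * m := by positivity
  have hc1 : 1 ≤ c := by simp only [c]; linarith
  have hN : (PO.card : ℝ) * m ≤ 2304 * n ^ 2 / τ ^ 4 * m :=
    mul_le_mul_of_nonneg_right hPO (by linarith)
  have hcZ : c ≤ Z / τ ^ 4 := by
    have h1 : 2 * (p * m) ≤ 2 * (p * m) * (1 / τ ^ 4) := le_mul_of_one_le_right (by linarith) hτ4
    have h2 : Z / τ ^ 4 = 2304 * n ^ 2 / τ ^ 4 * m + 2 * (p * m) * (1 / τ ^ 4) := by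
      rw [hZ]; ring
    rw [h2]
    simp only [c]
    linarith
  have hNZ : (PO.card : ℝ) * m ≤ Z / τ ^ 4 := le_trans (by simp only [c]; linarith) hcZ
  have hMZ : (PO.card : ℝ) ≤ Z / τ ^ 4 :=
    le_trans (le_mul_of_one_le_right (by positivity) hm1) hNZ
  -- The number of events is polynomial in `T`, so `ℓ` is of the order of `log T`.
  have hcT : c ≤ Z * T := by
    refine hcZ.trans ?_
    rw [div_le_iff₀ (by positivity), mul_assoc]
    refine le_mul_of_one_le_right (by linarith) ?_
    rw [← hTτ]
    exact mul_le_mul_of_nonneg_left (pow_le_pow_of_le_one hτ0.le hτ1 (by norm_num)) hT0.le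
  set ℓ : ℝ := Real.log (2 * c * T) with hℓ
  have hℓ1 : 1 ≤ ℓ := by
    have h1 : Real.log 4 ≤ ℓ := Real.log_le_log (by norm_num) (by nlinarith)
    have h2 : Real.log 4 = 2 * Real.log 2 := by
      rw [show (4 : ℝ) = 2 ^ 2 by norm_num, Real.log_pow]; norm_num
    linarith only [Real.log_two_gt_d9, h1, h2]
  have hreg := (persuasionGame u v).principalRegret_le hU01 hV01 hStar hP₀ (ε := τ ^ 2)
    (β := τ ^ 2 / 4) (by positivity) (by positivity) hτ0.le hO (by omega) hF hs hn (ℓ := ℓ)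
    (by rw [hι, hℓ, Fintype.card_fin]; norm_num) rfl
  rw [Fintype.card_fin, Nat.cast_ofNat] at hreg
  have herr := regret_error_le (κ := κ) (κs := κs) (κn := κn) hτ0 hτ1 hTτ hZ1 hNZ hMZ hℓ1
  have hlog : ℓ ≤ (2 * Real.log (2 * Z) + 2) * Real.log T := log_two_mul_mul_le hT2
    (by linarith only [hc1]) hZ1 hcT
  have hlogT : 1 ≤ 2 * Real.log T := by
    have := Real.log_le_log (by norm_num) hT2
    linarith only [Real.log_two_gt_d9, this]
  set Λ := (|κs| + |κn| + 8 * |κ|) * Z with hΛ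
  have hΛ0 : 0 ≤ Λ := by positivity
  have hfactor := regret_factor_le hτ0 hτ1 (show 0 ≤ p by linarith only [hp1])
  have hprod : (1 / (τ ^ 2 / 4) + 1 + p * (1 / τ ^ 2 + 1)) *
      ((T * (κs * √((PO.card : ℝ) / T)) + |κn| * √((PO.card : ℝ) * m * T) +
        2 * (|κ| * 2 * ((PO.card : ℝ) * m * ℓ + √ℓ * √((PO.card : ℝ) * m * T)))) / T) ≤
      (5 + 2 * p) / τ ^ 2 * (Λ * τ ^ 3 * ((2 * Real.log (2 * Z) + 2) * Real.log T)) := by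
    refine (mul_le_mul_of_nonneg_left herr (by positivity)).trans ?_
    refine mul_le_mul hfactor (mul_le_mul_of_nonneg_left hlog (by positivity)) (by positivity)
      (by positivity)
  have hsimp : (5 + 2 * p) / τ ^ 2 * (Λ * τ ^ 3 * ((2 * Real.log (2 * Z) + 2) * Real.log T)) =
      (5 + 2 * p) * Λ * (2 * Real.log (2 * Z) + 2) * τ * Real.log T := by
    field_simp
  -- The terms `c + γ` carry no logarithm; `2 log T ≥ 1` absorbs them into the common factor.
  have hfirst : (4 / C + 1 / 2) * τ + τ ≤ 2 * (4 / C + 3 / 2) * τ * Real.log T := by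
    have : 0 ≤ (4 / C + 3 / 2) * τ := by positivity
    nlinarith only [this, hlogT]
  rw [hsimp] at hprod
  linarith only [hreg, hprod, hfirst]

end Main

/-- `K₀` is the constant in the bound on the size of the oracle's output space and `κ₀` the constant
in the bound on the bias of the forecasts. -/
theorem theorem4 :
    ∃ K₀ κ₀ : ℝ, 0 < K₀ ∧ 0 < κ₀ ∧
    ∀ (S : Type*) [Fintype S] [DecidableEq S] [Nonempty S] (u : S → Fin 2 → ℝ) (v : S → ℝ),
      (∀ s y, u s y ∈ Set.Icc (0 : ℝ) 1) → (∀ s, v s ∈ Set.Icc (0 : ℝ) 1) →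
      EveryStrategyStrictlyOptimal u →
    ∃ C c₁ c₂ : ℝ, 0 < C ∧ 0 < c₁ ∧ 0 < c₂ ∧
      -- existence of the oracle
      (∀ aStar : SignalScheme S → stdSimplex ℝ (Fin 2) → (S → S),
        (persuasionGame u v).IsBestResponseRule aStar →
        ∀ (P₀ : Set (SignalScheme S)) (β ε x δ : ℝ), β ∈ Set.Ico 0 (C / 4) →
          ε ∈ Set.Icc (0 : ℝ) 1 → x ∈ Set.Icc (0 : ℝ) 1 → 0 < δ → δ ≤ β ^ 2 / 16 →
          ∃ (PO : Finset (SignalScheme S)) (O : stdSimplex ℝ (Fin 2) → SignalScheme S),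
            (PO.card : ℝ) ≤ K₀ * ((Fintype.card S : ℝ) ^ 2 / δ ^ 2) ∧
            (persuasionGame u v).IsOptimalStableOracle aStar P₀
              (3 * β / C + c₂ * √ε + 2 * √δ) ε (x * c₁ * β / 2) (max x (√δ)) PO O) ∧
      -- the Principal's regret
      (∀ (P₀ : Finset (SignalScheme S)) (hP₀ : P₀.Nonempty),
        ∃ (K : ℝ → ℝ → ℝ → ℝ) (k : ℕ),
        ∀ aStar : SignalScheme S → stdSimplex ℝ (Fin 2) → (S → S),
          (persuasionGame u v).IsBestResponseRule aStar →
        ∀ (T : ℕ) (β ε x δ : ℝ), 2 ≤ T →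
          ε = (T : ℝ) ^ (-(1 / 5) : ℝ) → x = √ε → β = √ε → δ = β ^ 2 / 16 → β < C / 4 →
          ∀ (PO : Finset (SignalScheme S)) (O : stdSimplex ℝ (Fin 2) → SignalScheme S),
            (PO.card : ℝ) ≤ K₀ * ((Fintype.card S : ℝ) ^ 2 / δ ^ 2) →
            (persuasionGame u v).IsOptimalStableOracle aStar P₀
              (3 * β / C + c₂ * √ε + 2 * √δ) ε (x * c₁ * β / 2) (max x (√δ)) PO O →
          ∀ (pOpt : stdSimplex ℝ (Fin 2) → SignalScheme S) (aOpt : stdSimplex ℝ (Fin 2) → (S → S)),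
            (persuasionGame u v).IsOptimisticRule aStar P₀ ε pOpt aOpt →
            (∃ F : Forecaster (Fin 2),
              HasLowBias F (StageGame.events aStar P₀ PO O pOpt aOpt) T κ₀) ∧
            ∀ (F : Forecaster (Fin 2)) (κ : ℝ),
              HasLowBias F (StageGame.events aStar P₀ PO O pOpt aOpt) T κ →
              ∀ (L : Learner (S → S) (SignalScheme S) (Fin 2)) (y : ℕ → Fin 2) (κs κn : ℝ),
                (persuasionGame u v).NoSwapRegret aStar P₀ O F L y T
                  (κs * √((PO.card : ℝ) / (T : ℝ))) →
                (persuasionGame u v).NoSecretInformation aStar P₀ O F L y T κn →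
                (persuasionGame u v).principalRegret aStar P₀ hP₀ O F L y T ≤
                  K κ κs κn * (T : ℝ) ^ (-(1 / 10) : ℝ) * (Real.log T) ^ k) := by
  classical
  refine ⟨9, 4, by norm_num, by norm_num, fun S _ _ _ u v hu hv hopt => ?_⟩
  obtain ⟨C, hC⟩ := exists_separatedBy hopt
  have hC0 := hC.pos
  -- `c₁ = 1/2` because rounding keeps half of the margin, and `c₂ = 1/C` because `ε/C ≤ √ε/C`.
  refine ⟨C, 1 / 2, 1 / C, hC0, by norm_num, by positivity, ?_, ?_⟩
  · intro aStar hStar P₀ β ε x δ hβ hε hx hδ hδβ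
    -- At `β = 0` no positive `δ` is admissible.
    have hβ0 : 0 < β := by
      refine lt_of_le_of_ne hβ.1 fun h => ?_
      rw [← h] at hδβ
      norm_num at hδβ
      linarith
    have hβC : β < C := by linarith [hβ.2]
    have hδ1 : δ ≤ 1 := by nlinarith [hC.le_one]
    obtain ⟨O, hO⟩ := exists_optimalStableOracle hu hv hC hStar P₀ hβ0 hβC hε.1 hx hδ hδβ
    refine ⟨_, O, card_gridSchemes_le hδ hδ1, fun π => ⟨(hO π).1, ?_, fun p₀ hp₀ a ha => ?_⟩⟩
    · have : x * (1 / 2) * β / 2 = x / 2 * (β / 2) := by ring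
      rw [this]
      exact (hO π).2.1
    · refine le_trans ?_ ((hO π).2.2 p₀ hp₀ a ha)
      have h1 : ε ≤ √ε := Real.le_sqrt_of_sq_le (by nlinarith [hε.1, hε.2])
      have h2 : (β + ε) / C ≤ 3 * β / C + 1 / C * √ε := by
        rw [one_div, inv_mul_eq_div, ← add_div]
        gcongr
        linarith
      linarith
  · intro P₀ hP₀
    set Z : ℝ := (2304 * (Fintype.card S : ℝ) ^ 2 + 2 * P₀.card) * Fintype.card (S → S) with hZ
    refine ⟨fun κ κs κn => 2 * (4 / C + 3 / 2) + (5 + 2 * P₀.card) *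
      ((|κs| + |κn| + 8 * |κ|) * Z) * (2 * Real.log (2 * Z) + 2), 1, ?_⟩
    intro aStar hStar T β ε x δ hT hε hx hβ hδ hβC PO O hPO hO pOpt aOpt _
    obtain ⟨p₀, hp₀⟩ := hP₀
    have hne : Nonempty (((PO × (S → S)) ⊕ (P₀ × (S → S))) ⊕ (P₀ × (S → S))) :=
      ⟨.inr (⟨p₀, hp₀⟩, id)⟩
    refine ⟨exists_hasLowBias _ hT, fun F κ hF L y κs κn hs hn => ?_⟩
    rw [pow_one]
    have hT0 : (0 : ℝ) < T := by positivity
    set τ : ℝ := (T : ℝ) ^ (-(1 / 10) : ℝ) with hτ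
    have hτ0 : 0 < τ := by positivity
    have hετ : ε = τ ^ 2 := by
      rw [hε, hτ, ← Real.rpow_natCast, ← Real.rpow_mul hT0.le]
      norm_num
    have hsqrt : √ε = τ := by rw [hετ, Real.sqrt_sq hτ0.le]
    rw [hsqrt] at hx hβ
    have hδτ : √δ = τ / 4 := by
      rw [hδ, hβ, show τ ^ 2 / 16 = (τ / 4) ^ 2 by ring, Real.sqrt_sq (by positivity)]
    have hmax : max x √δ = τ := by
      rw [hδτ, hx]; exact max_eq_left (by linarith)
    have hc : 3 * β / C + 1 / C * √ε + 2 * √δ = (4 / C + 1 / 2) * τ := by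
      rw [hδτ, hsqrt, hβ]; ring
    have hst : x * (1 / 2) * β / 2 = τ ^ 2 / 4 := by rw [hx, hβ]; ring
    rw [hmax, hc, hst, hετ] at hO
    refine persuasion_principalRegret_le hu hv hC0 hStar ⟨p₀, hp₀⟩ hT hτ hZ ?_ hO hF hs hn
    -- With `δ = τ²/16`, the bound `9 n²/δ²` becomes `9 · 256 n²/τ⁴`, which explains the constant
    -- 2304.
    refine hPO.trans_eq ?_
    rw [hδ, hβ]
    field_simp
    norm_num
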